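/- **Setting.** Let $\mathcal G$ be a Hausdorff locally compact étale groupoid, with unit space $\mathcal G^{(0)}$, range and source maps $r,s$, and $\mathcal G_x=s^{-1}(x)$, $\mathcal G^x=r^{-1}(x)$, $\mathcal G^x_x=\mathcal G_x\cap\mathcal G^x$. Let $C^*(\mathcal G)$ be the completion of $C_c(\mathcal G)$, with product $(f_1*f_2)(g)=\sum_{h\in\mathcal G^{r(g)}}f_1(h)f_2(h^{-1}g)$ and involution $f^*(g)=\overline{f(g^{-1})}$, in the norm given by the supremum over all representations of $C_c(\mathcal G)$ by bounded operators on Hilbert spaces. For a C$^*$-algebra $A$, $\operatorname{Prim}A$ is the set of its primitive ideals (kernels of irreducible representations) with the Jacobson (hull-kernel) topology. *Subgroups.* Let $\operatorname{Sub}(\mathcal G)$ be the set of all subgroups of the isotropy groups $\mathcal G^x_x$, $x\in\mathcal G^{(0)}$, with the Fell topology: a basis consists of the sets of all $S$ with $S\cap K=\emptyset$ and $S\cap U_i\neq\emptyset$ for $i=1,\dots,n$, where $K\subset\mathcal G$ is compact and $U_1,\dots,U_n\subset\mathcal G$ are open. Let $\Sigma(\mathcal G)=\{(S,g)\in\operatorname{Sub}(\mathcal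 G)\times\mathcal G: g\in S\}$, with the relative topology; it is an étale groupoid with unit space $\operatorname{Sub}(\mathcal G)$, a bundle of groups with fiber $S$ at $S$. Restriction of functions to the fiber at $S$ gives a homomorphism $q_S: C^*(\Sigma(\mathcal G))\to C^*(S)$. *Primitive ideals of subgroups.* Let $\operatorname{Sub}(\mathcal G)^{\mathrm{prim}}$ be the set of pairs $(S,J)$ with $S\in\operatorname{Sub}(\mathcal G)$ and $J\in\operatorname{Prim}C^*(S)$, with the topology induced from $\operatorname{Prim}C^*(\Sigma(\mathcal G))$ by the map $(S,J)\mapsto q_S^{-1}(J)$. Let $\operatorname{Stab}(\mathcal G)^{\mathrm{prim}}$ be the set of pairs $(x,J)$ with $x\in\mathcal G^{(0)}$ and $J\in\operatorname{Prim}C^*(\mathcal G^x_x)$; it is identified with the subset of $\operatorname{Sub}(\mathcal G)^{\mathrm{prim}}$ of the pairs $(\mathcal G^x_x,J)$. The groupoid $\mathcal G$ acts on it by $g(x,J)=(r(g),(\operatorname{Ad}g)(J))$ for $g\in\mathcal G_x$. *Induction.* For a unitary representation $\pi$ of a subgroup $S\subset\mathcal G^x_x$ on a Hilbert space $H$, let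 $\operatorname{Ind}\pi$ be the representation of $C^*(\mathcal G)$ on the Hilbert space of functions $\xi:\mathcal G_x\to H$ with $\xi(gh)=\pi(h)^*\xi(g)$ for $g\in\mathcal G_x$, $h\in S$, and $\sum_{g\in\mathcal G_x/S}\|\xi(g)\|^2<\infty$, given by $((\operatorname{Ind}\pi)(f)\xi)(g)=\sum_{h\in\mathcal G^{r(g)}}f(h)\,\xi(h^{-1}g)$ for $f\in C_c(\mathcal G)$. For $(x,J)\in\operatorname{Stab}(\mathcal G)^{\mathrm{prim}}$ put $\operatorname{Ind}(x,J)=\ker(\operatorname{Ind}\pi)$, where $\pi$ is any unitary representation of $\mathcal G^x_x$ whose kernel in $C^*(\mathcal G^x_x)$ is $J$. For a topological space $Y$, let $Y^\sim$ be its $T_0$-quotient, that is, the quotient of $Y$ by the relation of having the same closure. **Theorem.** Assume that the map $\mathcal G^{(0)}\to\operatorname{Sub}(\mathcal G)$, $x\mapsto\mathcal G^x_x$, is continuous. Then: 1. $\operatorname{Stab}(\mathcal G)^{\mathrm{prim}}$ is a closed subset of $\operatorname{Sub}(\mathcal G)^{\mathrm{prim}}$. 2. The ideal $\operatorname{Ind}(x,J)$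 does not depend on the choice of $\pi$ and is primitive for all $(x,J)\in\operatorname{Stab}(\mathcal G)^{\mathrm{prim}}$. If $\operatorname{Stab}(\mathcal G)^{\mathrm{prim}}$ is equipped with the relative topology from $\operatorname{Sub}(\mathcal G)^{\mathrm{prim}}$ and $\mathcal G\backslash\operatorname{Stab}(\mathcal G)^{\mathrm{prim}}$ with the quotient topology, then the map $(x,J)\mapsto\operatorname{Ind}(x,J)$ defines a homeomorphism of $(\mathcal G\backslash\operatorname{Stab}(\mathcal G)^{\mathrm{prim}})^\sim$ onto the subspace $\operatorname{Ind}(\operatorname{Stab}(\mathcal G)^{\mathrm{prim}})$ of $\operatorname{Prim}C^*(\mathcal G)$. -/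

import Mathlib

open scoped ENNReal InnerProductSpace CompactlySupported

universe u v w

namespace EtaleGpd

noncomputable section

/-! ### Hilbert spaces, C⋆-algebras of operator families, primitive ideals -/

/-- A complex Hilbert space (bundled). -/
structure HilbertSp where
  carrier : Type u
  [normed : NormedAddCommGroup carrier]
  [inner : InnerProductSpace ℂ carrier]
  [complete : CompleteSpace carrier]

instance : CoeSort HilbertSp.{u} (Type u) := ⟨HilbertSp.carrier⟩
attribute [instance] HilbertSp.normed HilbertSp.inner HilbertSp.complete

/-- Norm-bounded families of operators, one for each index `i`: the `ℓ^∞`-product of the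
C⋆-algebras `B(H i)`, with the supremum norm and coordinatewise operations. -/
def OpFamily {ι : Type v} (H : ι → HilbertSp.{u}) : Type (max u v) :=
  lp (fun i => H i →L[ℂ] H i) ∞

namespace OpFamily

instance {ι : Type v} (H : ι → HilbertSp.{u}) : NonUnitalCStarAlgebra (OpFamily H) :=
  inferInstanceAs (NonUnitalCStarAlgebra (lp (fun i => H i →L[ℂ] H i) ∞))

instance {ι : Type v} (H : ι → HilbertSp.{u}) :
    CoeFun (OpFamily H) (fun _ => ∀ i, H i →L[ℂ] H i) := ⟨fun a => a.1⟩

theorem norm_coord_le {ι : Type v} {H : ι → HilbertSp.{u}} (a : OpFamily H) (i : ι) :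
    ‖a i‖ ≤ ‖a‖ :=
  lp.norm_apply_le_norm (E := fun i => H i →L[ℂ] H i) (by simp) a i

/-- A bounded family of operators as an element of `OpFamily H`. -/
def mk {ι : Type v} {H : ι → HilbertSp.{u}} (T : ∀ i, H i →L[ℂ] H i) (C : ℝ)
    (h : ∀ i, ‖T i‖ ≤ C) : OpFamily H :=
  ⟨T, memℓp_infty ⟨C, by rintro _ ⟨k, rfl⟩; exact h k⟩⟩

theorem norm_le {ι : Type v} {H : ι → HilbertSp.{u}} (a : OpFamily H) (C : ℝ) (hC : 0 ≤ C)
    (h : ∀ i, ‖a i‖ ≤ C) : ‖a‖ ≤ C :=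
  lp.norm_le_of_forall_le (E := fun i => H i →L[ℂ] H i) hC h

/-- Reindexing of families of operators along a map of index sets. -/
def pull {ι : Type v} (H : ι → HilbertSp.{u}) {κ : Type w} (φ : κ → ι) :
    OpFamily H →⋆ₙₐ[ℂ] OpFamily (fun k => H (φ k)) where
  toFun a := mk (fun k => a (φ k)) ‖a‖ (fun k => norm_coord_le a (φ k))
  map_smul' _ _ := rfl
  map_zero' := rfl
  map_add' _ _ := rfl
  map_mul' _ _ := rfl
  map_star' _ := rfl

theorem continuous_pull {ι : Type v} (H : ι → HilbertSp.{u}) {κ : Type w} (φ : κ → ι) :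
    Continuous (pull H φ) := by
  apply AddMonoidHomClass.continuous_of_bound (pull H φ) 1
  intro a
  rw [one_mul]
  exact norm_le _ _ (norm_nonneg _) (fun k => norm_coord_le a (φ k))

end OpFamily

/-- The C⋆-subalgebra of `OpFamily H` generated by `X`: the norm closure of the ⋆-subalgebra
generated by `X`. -/
def genAlg {ι : Type v} (H : ι → HilbertSp.{u}) (X : Set (OpFamily H)) :
    NonUnitalStarSubalgebra ℂ (OpFamily H) :=
  (NonUnitalStarAlgebra.adjoin ℂ X).topologicalClosure

theorem isClosed_genAlg {ι : Type v} (H : ι → HilbertSp.{u}) (X : Set (OpFamily H)) :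
    IsClosed (genAlg H X : Set (OpFamily H)) :=
  NonUnitalStarSubalgebra.isClosed_topologicalClosure _

/-- The C⋆-algebra generated by a set `X` of bounded families of operators. If `i` runs through all
representations of a ⋆-algebra and `X` is the image of this algebra, this is its completion in the
norm `sup_i ‖ρ_i(f)‖`, modulo the elements of norm zero. -/
def GenCStar {ι : Type v} (H : ι → HilbertSp.{u}) (X : Set (OpFamily H)) : Type (max u v) :=
  genAlg H X

namespace GenCStar

instance {ι : Type v} (H : ι → HilbertSp.{u}) (X : Set (OpFamily H)) :
    NonUnitalCStarAlgebra (GenCStar H X) :=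
  NonUnitalStarSubalgebra.nonUnitalCStarAlgebra (genAlg H X) (h_closed := isClosed_genAlg H X)

/-- Evaluation at the index `i`, a representation on `H i`. -/
def evalAt {ι : Type v} (H : ι → HilbertSp.{u}) (X : Set (OpFamily H)) (i : ι) :
    GenCStar H X →⋆ₙₐ[ℂ] (H i →L[ℂ] H i) where
  toFun a := a.1 i
  map_smul' _ _ := rfl
  map_zero' := rfl
  map_add' _ _ := rfl
  map_mul' _ _ := rfl
  map_star' _ := rfl

theorem pull_mem {ι : Type v} (H : ι → HilbertSp.{u}) {κ : Type w} (φ : κ → ι)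
    (X : Set (OpFamily H)) (Y : Set (OpFamily (fun k => H (φ k))))
    (h : ∀ a ∈ X, OpFamily.pull H φ a ∈ genAlg _ Y) (a : OpFamily H) (ha : a ∈ genAlg H X) :
    OpFamily.pull H φ a ∈ genAlg _ Y := by
  have h1 : NonUnitalStarAlgebra.adjoin ℂ X ≤ (genAlg _ Y).comap (OpFamily.pull H φ) :=
    NonUnitalStarAlgebra.adjoin_le (fun a ha => h a ha)
  have h2 : IsClosed (((genAlg _ Y).comap (OpFamily.pull H φ) : NonUnitalStarSubalgebra ℂ _) :
      Set (OpFamily H)) :=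
    (isClosed_genAlg _ Y).preimage (OpFamily.continuous_pull H φ)
  exact NonUnitalStarSubalgebra.topologicalClosure_minimal _ h1 h2 ha

/-- Reindexing of families, as a homomorphism of the generated C⋆-algebras. -/
def pull {ι : Type v} (H : ι → HilbertSp.{u}) {κ : Type w} (φ : κ → ι)
    (X : Set (OpFamily H)) (Y : Set (OpFamily (fun k => H (φ k))))
    (h : ∀ a ∈ X, OpFamily.pull H φ a ∈ genAlg _ Y) :
    GenCStar H X →⋆ₙₐ[ℂ] GenCStar (fun k => H (φ k)) Y where
  toFun a := ⟨OpFamily.pull H φ a.1, pull_mem H φ X Y h a.1 a.2⟩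
  map_smul' _ _ := rfl
  map_zero' := rfl
  map_add' _ _ := rfl
  map_mul' _ _ := rfl
  map_star' _ := rfl

end GenCStar

/-- Irreducible representations: nonzero, without nontrivial closed invariant subspaces. -/
def IsIrreducible {A : Type v} [NonUnitalCStarAlgebra A] {H : HilbertSp.{w}}
    (π : A →⋆ₙₐ[ℂ] (H →L[ℂ] H)) : Prop :=
  (∃ a, π a ≠ 0) ∧
    ∀ K : Submodule ℂ H, IsClosed (K : Set H) → (∀ a, ∀ ξ ∈ K, π a ξ ∈ K) → K = ⊥ ∨ K = ⊤

/-- Primitive ideals: kernels of irreducible representations. The Hilbert spaces are taken in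
`Type w`. -/
def IsPrimitive {A : Type v} [NonUnitalCStarAlgebra A] (J : TwoSidedIdeal A) : Prop :=
  ∃ (H : HilbertSp.{w}) (π : A →⋆ₙₐ[ℂ] (H →L[ℂ] H)), IsIrreducible π ∧ TwoSidedIdeal.ker π = J

/-- The hull-kernel topology on two-sided ideals: a subbasis consists of the sets `{J | ¬ K ≤ J}`
for `K` a closed ideal. On the set of primitive ideals this is the Jacobson topology: since
primitive ideals are prime, the sets `{J | K ≤ J}` there are exactly the closed sets. -/
@[reducible] def hullKernel (A : Type v) [NonUnitalCStarAlgebra A] : TopologicalSpace (TwoSidedIdeal A) :=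
  .generateFrom {U | ∃ K : TwoSidedIdeal A, IsClosed (K : Set A) ∧ U = {J | ¬ K ≤ J}}

/-- The primitive ideals of a C⋆-algebra. -/
def Prim (A : Type v) [NonUnitalCStarAlgebra A] : Type v :=
  {J : TwoSidedIdeal A // IsPrimitive.{v, w} J}

/-! ### Groupoids -/

/-- A groupoid with space of units `X` and set of arrows `G`. The product `mul g h` has a meaning
only if `s g = r h`; its other values are arbitrary and never matter. -/
structure Gpd (X G : Type u) where
  r : G → X
  s : G → X
  unit : X → G
  mul : G → G → G
  inv : G → G
  r_unit : ∀ x, r (unit x) = x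
  s_unit : ∀ x, s (unit x) = x
  r_mul : ∀ g h, s g = r h → r (mul g h) = r g
  s_mul : ∀ g h, s g = r h → s (mul g h) = s h
  mul_assoc : ∀ g h k, s g = r h → s h = r k → mul (mul g h) k = mul g (mul h k)
  unit_mul : ∀ g, mul (unit (r g)) g = g
  mul_unit : ∀ g, mul g (unit (s g)) = g
  r_inv : ∀ g, r (inv g) = s g
  s_inv : ∀ g, s (inv g) = r g
  inv_mul : ∀ g, mul (inv g) g = unit (s g)
  mul_inv : ∀ g, mul g (inv g) = unit (r g)

namespace Gpd

variable {X G : Type u} (𝒢 : Gpd X G)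

/-- A topological groupoid (`mul` is continuous on the composable pairs) whose range map is a local
homeomorphism. As `r ∘ unit = id`, the map `unit` is then a homeomorphism onto its image. -/
class IsEtale [TopologicalSpace X] [TopologicalSpace G] : Prop where
  continuous_s : Continuous 𝒢.s
  continuous_unit : Continuous 𝒢.unit
  continuous_inv : Continuous 𝒢.inv
  continuousOn_mul : ContinuousOn (fun p : G × G => 𝒢.mul p.1 p.2) {p | 𝒢.s p.1 = 𝒢.r p.2}
  isLocalHomeomorph_r : IsLocalHomeomorph 𝒢.r

theorem inv_mul_cancel {g h : G} (e : 𝒢.s g = 𝒢.r h) : 𝒢.mul (𝒢.inv g) (𝒢.mul g h) = h := by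
  rw [← 𝒢.mul_assoc _ _ _ (𝒢.s_inv g) e, 𝒢.inv_mul, e, 𝒢.unit_mul]

theorem mul_inv_cancel {g h : G} (e : 𝒢.r g = 𝒢.r h) : 𝒢.mul g (𝒢.mul (𝒢.inv g) h) = h := by
  rw [← 𝒢.mul_assoc _ _ _ (𝒢.r_inv g).symm ((𝒢.s_inv g).trans e), 𝒢.mul_inv, e, 𝒢.unit_mul]

theorem eq_inv_of_mul {g h : G} (e : 𝒢.s g = 𝒢.r h) (h1 : 𝒢.mul g h = 𝒢.unit (𝒢.r g)) :
    h = 𝒢.inv g := by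
  rw [← 𝒢.inv_mul_cancel e, h1, ← 𝒢.s_inv, 𝒢.mul_unit]

theorem inv_inv (g : G) : 𝒢.inv (𝒢.inv g) = g := by
  refine (𝒢.eq_inv_of_mul (𝒢.s_inv g) ?_).symm
  rw [𝒢.inv_mul, 𝒢.r_inv]

theorem mul_inv_rev {g h : G} (e : 𝒢.s g = 𝒢.r h) :
    𝒢.inv (𝒢.mul g h) = 𝒢.mul (𝒢.inv h) (𝒢.inv g) := by
  have e' : 𝒢.s (𝒢.inv h) = 𝒢.r (𝒢.inv g) := by rw [𝒢.s_inv, 𝒢.r_inv, e]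
  refine (𝒢.eq_inv_of_mul ?_ ?_).symm
  · rw [𝒢.s_mul _ _ e, 𝒢.r_mul _ _ e', 𝒢.r_inv]
  · rw [𝒢.mul_assoc _ _ _ e (by rw [𝒢.r_mul _ _ e', 𝒢.r_inv]),
      𝒢.mul_inv_cancel (by rw [𝒢.r_inv, e]), 𝒢.mul_inv, 𝒢.r_mul _ _ e]

/-! ### Representations of the convolution algebra -/

/-- Convolution: `(f₁ * f₂)(g) = ∑ f₁(h) f₂(h⁻¹ g)`, the sum over all `h` with `r h = r g`. -/
def conv (f₁ f₂ : G → ℂ) (g : G) : ℂ :=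
  ∑ᶠ h ∈ {h : G | 𝒢.r h = 𝒢.r g}, f₁ h * f₂ (𝒢.mul (𝒢.inv h) g)

/-- Representations of the ⋆-algebra `C_c(𝒢)` by bounded operators. The product is convolution and
the involution is `f⋆(g) = star (f (g⁻¹))`. -/
structure Rep [TopologicalSpace G] where
  H : HilbertSp.{u}
  op : C_c(G, ℂ) →ₗ[ℂ] (H →L[ℂ] H)
  op_conv : ∀ f₁ f₂ f : C_c(G, ℂ), (∀ g, f g = 𝒢.conv f₁ f₂ g) → op f = op f₁ * op f₂
  op_star : ∀ f f' : C_c(G, ℂ), (∀ g, f' g = star (f (𝒢.inv g))) → op f' = star (op f)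

/-- The full groupoid C⋆-algebra `C⋆(𝒢)`: the completion of `C_c(𝒢)` in the norm `sup_ρ ‖ρ(f)‖` over
all representations `ρ`. For an étale groupoid every `f` defines a bounded family `(ρ(f))_ρ`. Every
cyclic representation can be realized in the universe of `G`, so that it is enough to take these. -/
def CStar [TopologicalSpace G] : Type (u + 1) :=
  GenCStar (fun ρ : 𝒢.Rep => ρ.H) {a | ∃ f : C_c(G, ℂ), ∀ ρ : 𝒢.Rep, a ρ = ρ.op f}

instance [TopologicalSpace G] : NonUnitalCStarAlgebra 𝒢.CStar :=
  inferInstanceAs (NonUnitalCStarAlgebra (GenCStar _ _))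

variable {𝒢} in
/-- The extension of a representation of `C_c(𝒢)` to `C⋆(𝒢)`. -/
def Rep.extend [TopologicalSpace G] (ρ : 𝒢.Rep) : 𝒢.CStar →⋆ₙₐ[ℂ] (ρ.H →L[ℂ] ρ.H) :=
  GenCStar.evalAt _ _ ρ

end Gpd

/-- Unitary representations of a (discrete) group. -/
structure URep (Γ : Type u) [Group Γ] where
  H : HilbertSp.{u}
  op : Γ →* unitary (H →L[ℂ] H)

/-- The full group C⋆-algebra of a discrete group. -/
def GroupCStar (Γ : Type u) [Group Γ] : Type (u + 1) :=
  GenCStar (fun π : URep Γ => π.H)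
    {a | ∃ g : Γ, ∀ π : URep Γ, a π = π.op g}

instance (Γ : Type u) [Group Γ] : NonUnitalCStarAlgebra (GroupCStar Γ) :=
  inferInstanceAs (NonUnitalCStarAlgebra (GenCStar _ _))

/-- The extension of a unitary representation to the group C⋆-algebra. -/
def URep.extend {Γ : Type u} [Group Γ] (π : URep Γ) : GroupCStar Γ →⋆ₙₐ[ℂ] (π.H →L[ℂ] π.H) :=
  GenCStar.evalAt _ _ π

theorem norm_unitary_le {H : HilbertSp.{u}} (U : unitary (H →L[ℂ] H)) :
    ‖(U : H →L[ℂ] H)‖ ≤ 1 := by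
  rcases subsingleton_or_nontrivial (H →L[ℂ] H) with h | h
  · rw [Subsingleton.elim (U : H →L[ℂ] H) 0, norm_zero]
    exact zero_le_one
  · exact (CStarRing.norm_coe_unitary U).le

/-- Composition of a unitary representation with a homomorphism of groups. -/
def URep.comp {Γ Δ : Type u} [Group Γ] [Group Δ] (π : URep Δ) (φ : Γ →* Δ) : URep Γ where
  H := π.H
  op := π.op.comp φ

/-- The canonical unitary of the group C⋆-algebra given by a group element. -/
def GroupCStar.gen {Γ : Type u} [Group Γ] (g : Γ) : OpFamily (fun π : URep Γ => π.H) :=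
  OpFamily.mk (fun π => (π.op g : π.H →L[ℂ] π.H)) 1 (fun π => norm_unitary_le _)

theorem GroupCStar.gen_mem {Γ : Type u} [Group Γ] (g : Γ) :
    gen g ∈ genAlg (fun π : URep Γ => π.H) {a | ∃ g : Γ, ∀ π : URep Γ, a π = π.op g} :=
  NonUnitalStarSubalgebra.le_topologicalClosure _
    (NonUnitalStarAlgebra.subset_adjoin ℂ _ ⟨g, fun _ => rfl⟩)

/-- The homomorphism of group C⋆-algebras defined by a homomorphism of groups. -/
def GroupCStar.map {Γ Δ : Type u} [Group Γ] [Group Δ] (φ : Γ →* Δ) :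
    GroupCStar Γ →⋆ₙₐ[ℂ] GroupCStar Δ :=
  GenCStar.pull (fun π : URep Γ => π.H) (fun π : URep Δ => π.comp φ) _ _ (by
    rintro a ⟨g, hg⟩
    have : OpFamily.pull (fun π : URep Γ => π.H) (fun π : URep Δ => π.comp φ) a = gen (φ g) :=
      Subtype.ext (funext fun π => hg _)
    rw [this]
    exact gen_mem (φ g))

namespace Gpd
variable {X G : Type u} (𝒢 : Gpd X G)

/-! ### Subgroups -/

/-- The space `Sub(𝒢)` of subgroups of `𝒢`, that is, of the subgroups of the isotropy groups. -/
structure Sub where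
  base : X
  carrier : Set G
  r_eq : ∀ g ∈ carrier, 𝒢.r g = base
  s_eq : ∀ g ∈ carrier, 𝒢.s g = base
  unit_mem : 𝒢.unit base ∈ carrier
  mul_mem : ∀ g ∈ carrier, ∀ h ∈ carrier, 𝒢.mul g h ∈ carrier
  inv_mem : ∀ g ∈ carrier, 𝒢.inv g ∈ carrier

variable {𝒢}

/-- A subgroup of `𝒢`, as a type with a group structure. -/
def Sub.El (S : 𝒢.Sub) : Type u := S.carrier

theorem Sub.comp (S : 𝒢.Sub) {g h : G} (hg : g ∈ S.carrier) (hh : h ∈ S.carrier) :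
    𝒢.s g = 𝒢.r h := by rw [S.s_eq g hg, S.r_eq h hh]

instance (S : 𝒢.Sub) : Group S.El where
  mul g h := ⟨𝒢.mul g.1 h.1, S.mul_mem _ g.2 _ h.2⟩
  one := ⟨𝒢.unit S.base, S.unit_mem⟩
  inv g := ⟨𝒢.inv g.1, S.inv_mem _ g.2⟩
  mul_assoc g h k := Subtype.ext (𝒢.mul_assoc _ _ _ (S.comp g.2 h.2) (S.comp h.2 k.2))
  one_mul g := Subtype.ext (by
    change 𝒢.mul (𝒢.unit S.base) g.1 = g.1
    rw [← S.r_eq g.1 g.2]; exact 𝒢.unit_mul _)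
  mul_one g := Subtype.ext (by
    change 𝒢.mul g.1 (𝒢.unit S.base) = g.1
    rw [← S.s_eq g.1 g.2]; exact 𝒢.mul_unit _)
  inv_mul_cancel g := Subtype.ext (by
    change 𝒢.mul (𝒢.inv g.1) g.1 = 𝒢.unit S.base
    rw [𝒢.inv_mul, S.s_eq g.1 g.2])

theorem Sub.coe_mul (S : 𝒢.Sub) (g h : S.El) : (g * h).1 = 𝒢.mul g.1 h.1 := rfl
theorem Sub.coe_inv (S : 𝒢.Sub) (g : S.El) : (g⁻¹).1 = 𝒢.inv g.1 := rfl
theorem Sub.coe_one (S : 𝒢.Sub) : (1 : S.El).1 = 𝒢.unit S.base := rfl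

variable (𝒢)

/-- The isotropy group at `x`. -/
def iso (x : X) : 𝒢.Sub where
  base := x
  carrier := {g | 𝒢.r g = x ∧ 𝒢.s g = x}
  r_eq _ h := h.1
  s_eq _ h := h.2
  unit_mem := ⟨𝒢.r_unit x, 𝒢.s_unit x⟩
  mul_mem g hg h hh := by
    have e : 𝒢.s g = 𝒢.r h := hg.2.trans hh.1.symm
    exact ⟨(𝒢.r_mul g h e).trans hg.1, (𝒢.s_mul g h e).trans hh.2⟩
  inv_mem g hg := ⟨(𝒢.r_inv g).trans hg.2, (𝒢.s_inv g).trans hg.1⟩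

/-- Conjugation `h ↦ g h g⁻¹` by an arrow `g` from `x` to `y`, between the isotropy groups. -/
def conj (g : G) {x y : X} (hs : 𝒢.s g = x) (hr : 𝒢.r g = y) :
    (𝒢.iso x).El →* (𝒢.iso y).El where
  toFun h := ⟨𝒢.mul (𝒢.mul g h.1) (𝒢.inv g), by
    have e1 : 𝒢.s g = 𝒢.r h.1 := by rw [hs, h.2.1]
    have e2 : 𝒢.s (𝒢.mul g h.1) = 𝒢.r (𝒢.inv g) := by rw [𝒢.s_mul _ _ e1, h.2.2, 𝒢.r_inv, hs]
    exact ⟨by rw [𝒢.r_mul _ _ e2, 𝒢.r_mul _ _ e1, hr], by rw [𝒢.s_mul _ _ e2, 𝒢.s_inv, hr]⟩⟩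
  map_one' := by
    apply Subtype.ext
    change 𝒢.mul (𝒢.mul g (𝒢.unit x)) (𝒢.inv g) = 𝒢.unit y
    rw [← hs, 𝒢.mul_unit, 𝒢.mul_inv, hr]
  map_mul' h k := by
    apply Subtype.ext
    have h1 : 𝒢.r h.1 = x := h.2.1
    have h2 : 𝒢.s h.1 = x := h.2.2
    have k1 : 𝒢.r k.1 = x := k.2.1
    have k2 : 𝒢.s k.1 = x := k.2.2
    have hk : 𝒢.s h.1 = 𝒢.r k.1 := h2.trans k1.symm
    have gh : 𝒢.s g = 𝒢.r h.1 := hs.trans h1.symm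
    have gk : 𝒢.s g = 𝒢.r k.1 := hs.trans k1.symm
    have ki : 𝒢.s k.1 = 𝒢.r (𝒢.inv g) := by rw [k2, 𝒢.r_inv, hs]
    have hi : 𝒢.s h.1 = 𝒢.r (𝒢.inv g) := by rw [h2, 𝒢.r_inv, hs]
    change 𝒢.mul (𝒢.mul g (𝒢.mul h.1 k.1)) (𝒢.inv g) =
      𝒢.mul (𝒢.mul (𝒢.mul g h.1) (𝒢.inv g)) (𝒢.mul (𝒢.mul g k.1) (𝒢.inv g))
    have e1 : 𝒢.s (𝒢.mul g h.1) = 𝒢.r (𝒢.inv g) := by rw [𝒢.s_mul _ _ gh, hi]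
    have e2 : 𝒢.s (𝒢.inv g) = 𝒢.r (𝒢.mul (𝒢.mul g k.1) (𝒢.inv g)) := by
      rw [𝒢.s_inv, 𝒢.r_mul _ _ (by rw [𝒢.s_mul _ _ gk, ki]), 𝒢.r_mul _ _ gk]
    rw [𝒢.mul_assoc _ _ _ e1 e2, 𝒢.mul_assoc g k.1 _ gk ki,
      𝒢.inv_mul_cancel (by rw [𝒢.r_mul _ _ ki, gk]), ← 𝒢.mul_assoc g h.1 k.1 gh hk,
      𝒢.mul_assoc (𝒢.mul g h.1) k.1 _ (by rw [𝒢.s_mul _ _ gh, hk]) ki]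

end Gpd

/-! ### Finiteness -/

theorem exists_card_bound {X G : Type u} [TopologicalSpace G] (p : G → X)
    (hp : ∀ g, ∃ U ∈ nhds g, Set.InjOn p U) {K : Set G} (hK : IsCompact K) :
    ∃ N : ℕ, ∀ x, ∀ A : Finset G, (∀ h ∈ A, h ∈ K ∧ p h = x) → A.card ≤ N := by
  choose U hU hinj using hp
  obtain ⟨t, -, ht⟩ := hK.elim_nhds_subcover U (fun g _ => hU g)
  refine ⟨t.card, fun x A hA => ?_⟩
  have h1 : ∀ h ∈ A, ∃ i ∈ t, h ∈ U i := fun h hh => by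
    simpa using ht (hA h hh).1
  choose! j hj hjU using h1
  refine Finset.card_le_card_of_injOn j hj ?_
  intro a ha b hb hab
  have hb' := hjU b hb
  rw [← hab] at hb'
  exact hinj (j a) (hjU a ha) hb' ((hA a ha).2.trans (hA b hb).2.symm)

theorem set_finite_of_card_bound {α : Type u} {s : Set α} (N : ℕ)
    (h : ∀ A : Finset α, (∀ a ∈ A, a ∈ s) → A.card ≤ N) : s.Finite := by
  by_contra hs
  obtain ⟨t, ht, hc⟩ := Set.Infinite.exists_subset_card_eq hs (N + 1)
  have := h t (fun a ha => ht ha)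
  omega

theorem sum_comp_le {α Q : Type*} (A : Finset α) (m : α → Q) (N : ℕ)
    (hN : ∀ q, ∀ B : Finset α, B ⊆ A → (∀ a ∈ B, m a = q) → B.card ≤ N) (φ : Q → ℝ)
    (hφ : ∀ q, 0 ≤ φ q) (hs : Summable φ) : ∑ a ∈ A, φ (m a) ≤ N * ∑' q, φ q := by
  classical
  rw [Finset.sum_comp]
  calc ∑ b ∈ A.image m, (A.filter (fun a => m a = b)).card • φ b
      ≤ ∑ b ∈ A.image m, N * φ b := by
        refine Finset.sum_le_sum fun b _ => ?_
        rw [nsmul_eq_mul]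
        refine mul_le_mul_of_nonneg_right ?_ (hφ b)
        exact_mod_cast hN b _ (Finset.filter_subset _ _) (by simp)
    _ = N * ∑ b ∈ A.image m, φ b := by rw [Finset.mul_sum]
    _ ≤ N * ∑' q, φ q :=
        mul_le_mul_of_nonneg_left (hs.sum_le_tsum _ (fun q _ => hφ q)) (Nat.cast_nonneg _)

namespace Gpd
variable {X G : Type u} {𝒢 : Gpd X G}

theorem finsum_range_eq {V : Type*} [AddCommGroup V] [Module ℂ V] {f : G → ℂ} {x : X}
    (hf : {h | f h ≠ 0 ∧ 𝒢.r h = x}.Finite) (v : G → V) :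
    ∑ᶠ h ∈ {h : G | 𝒢.r h = x}, f h • v h = ∑ h ∈ hf.toFinset, f h • v h := by
  refine finsum_mem_eq_sum_of_subset _ ?_ ?_
  · rintro h ⟨h1, h2⟩
    simp only [Set.Finite.coe_toFinset, Set.mem_ofPred_eq]
    exact ⟨fun h0 => h2 (by simp [h0]), h1⟩
  · intro h hh
    simp only [Set.Finite.coe_toFinset, Set.mem_ofPred_eq] at hh
    exact hh.2

theorem conv_sum {V : Type*} [AddCommGroup V] [Module ℂ V] (f₁ f₂ f : G → ℂ)
    (hf : ∀ g, f g = 𝒢.conv f₁ f₂ g) (x : X) (hf₁ : {h | f₁ h ≠ 0 ∧ 𝒢.r h = x}.Finite)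
    (hf₂ : ∀ y, {h | f₂ h ≠ 0 ∧ 𝒢.r h = y}.Finite) (v : G → V) :
    ∑ᶠ h ∈ {h : G | 𝒢.r h = x}, f h • v h =
      ∑ᶠ l ∈ {l : G | 𝒢.r l = x}, f₁ l • ∑ᶠ m ∈ {m : G | 𝒢.r m = 𝒢.s l}, f₂ m • v (𝒢.mul l m) := by
  classical
  -- the inner sum, reindexed by h = l m
  have hin : ∀ l, 𝒢.r l = x → ∑ᶠ m ∈ {m : G | 𝒢.r m = 𝒢.s l}, f₂ m • v (𝒢.mul l m) =
      ∑ᶠ h ∈ {h : G | 𝒢.r h = x}, f₂ (𝒢.mul (𝒢.inv l) h) • v h := by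
    intro l hl
    refine finsum_mem_eq_of_bijOn (fun m => 𝒢.mul l m) ⟨?_, ?_, ?_⟩ ?_
    · intro m hm
      simp only [Set.mem_ofPred_eq] at hm ⊢
      rw [𝒢.r_mul _ _ hm.symm, hl]
    · intro m hm m' hm' e
      simp only [Set.mem_ofPred_eq] at hm hm' e
      rw [← 𝒢.inv_mul_cancel hm.symm, e, 𝒢.inv_mul_cancel hm'.symm]
    · intro h hh
      simp only [Set.mem_ofPred_eq] at hh
      refine ⟨𝒢.mul (𝒢.inv l) h, ?_, 𝒢.mul_inv_cancel (hl.trans hh.symm)⟩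
      simp only [Set.mem_ofPred_eq]
      rw [𝒢.r_mul _ _ (by rw [𝒢.s_inv, hl, hh]), 𝒢.r_inv]
    · intro m hm
      simp only [Set.mem_ofPred_eq] at hm
      simp only [𝒢.inv_mul_cancel hm.symm]
  have hfin : ∀ l, 𝒢.r l = x →
      ({h : G | 𝒢.r h = x} ∩ Function.support fun h => f₂ (𝒢.mul (𝒢.inv l) h) • v h).Finite := by
    intro l hl
    refine ((hf₂ (𝒢.s l)).image (fun m => 𝒢.mul l m)).subset ?_
    rintro h ⟨h1, h2⟩
    simp only [Set.mem_ofPred_eq] at h1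
    refine ⟨𝒢.mul (𝒢.inv l) h, ⟨fun h0 => h2 (by simp [h0]), ?_⟩,
      𝒢.mul_inv_cancel (hl.trans h1.symm)⟩
    rw [𝒢.r_mul _ _ (by rw [𝒢.s_inv, hl, h1]), 𝒢.r_inv]
  have step : ∀ h, 𝒢.r h = x → f h • v h = ∑ l ∈ hf₁.toFinset,
      f₁ l • (f₂ (𝒢.mul (𝒢.inv l) h) • v h) := by
    intro h hh
    rw [hf h, conv, hh]
    have := finsum_range_eq hf₁ (fun l => f₂ (𝒢.mul (𝒢.inv l) h))
    simp only [smul_eq_mul] at this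
    rw [this, Finset.sum_smul]
    exact Finset.sum_congr rfl fun l _ => mul_smul _ _ _
  rw [finsum_range_eq hf₁]
  refine (finsum_mem_congr (t := {h : G | 𝒢.r h = x}) rfl (fun h hh => step h hh)).trans ?_
  rw [finsum_mem_def]
  have ind : ∀ h, Set.indicator {h : G | 𝒢.r h = x} (fun h => ∑ l ∈ hf₁.toFinset,
      f₁ l • (f₂ (𝒢.mul (𝒢.inv l) h) • v h)) h = ∑ l ∈ hf₁.toFinset,
      f₁ l • Set.indicator {h : G | 𝒢.r h = x} (fun h => f₂ (𝒢.mul (𝒢.inv l) h) • v h) h := by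
    intro h
    by_cases hh : h ∈ {h : G | 𝒢.r h = x}
    · simp only [Set.indicator_of_mem hh]
    · simp only [Set.indicator_of_notMem hh, smul_zero, Finset.sum_const_zero]
  rw [finsum_congr ind, finsum_sum_comm]
  · refine Finset.sum_congr rfl fun l hl => ?_
    have hl' : 𝒢.r l = x := by
      simp only [Set.Finite.mem_toFinset, Set.mem_ofPred_eq] at hl
      exact hl.2
    rw [hin l hl', finsum_mem_def, smul_finsum' _ ?_]
    change (Function.support _).Finite
    rw [Set.support_indicator]
    exact hfin l hl'
  · intro l hl
    have hl' : 𝒢.r l = x := by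
      simp only [Set.Finite.mem_toFinset, Set.mem_ofPred_eq] at hl
      exact hl.2
    have := hfin l hl'
    rw [← Set.support_indicator] at this
    exact this.subset (Function.support_const_smul_subset _ _)
section
variable [TopologicalSpace X] [TopologicalSpace G] [𝒢.IsEtale]

variable (𝒢) in
theorem r_locInj (g : G) : ∃ U ∈ nhds g, Set.InjOn 𝒢.r U := by
  obtain ⟨e, he, hr⟩ := IsEtale.isLocalHomeomorph_r (𝒢 := 𝒢) g
  refine ⟨e.source, e.open_source.mem_nhds he, ?_⟩
  rw [hr]; exact e.injOn

variable (𝒢) in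
theorem s_locInj (g : G) : ∃ U ∈ nhds g, Set.InjOn 𝒢.s U := by
  obtain ⟨U, hU, hi⟩ := r_locInj 𝒢 (𝒢.inv g)
  refine ⟨𝒢.inv ⁻¹' U, (IsEtale.continuous_inv (𝒢 := 𝒢)).continuousAt hU, ?_⟩
  intro a ha b hb hab
  rw [← 𝒢.inv_inv a, ← 𝒢.inv_inv b, hi ha hb (by rw [𝒢.r_inv, 𝒢.r_inv, hab])]

variable (𝒢) in
theorem exists_bound (f : C_c(G, ℂ)) : ∃ N : ℕ, ∀ x, ∀ A : Finset G,
    ((∀ h ∈ A, f h ≠ 0 ∧ 𝒢.r h = x) → A.card ≤ N) ∧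
    ((∀ h ∈ A, f h ≠ 0 ∧ 𝒢.s h = x) → A.card ≤ N) := by
  obtain ⟨N, hN⟩ := exists_card_bound 𝒢.r (r_locInj 𝒢) f.hasCompactSupport'
  obtain ⟨M, hM⟩ := exists_card_bound 𝒢.s (s_locInj 𝒢) f.hasCompactSupport'
  refine ⟨max N M, fun x A => ⟨fun h => ?_, fun h => ?_⟩⟩
  · exact (hN x A fun a ha => ⟨subset_tsupport _ (h a ha).1, (h a ha).2⟩).trans (le_max_left _ _)
  · exact (hM x A fun a ha => ⟨subset_tsupport _ (h a ha).1, (h a ha).2⟩).trans (le_max_right _ _)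

variable (𝒢) in
theorem finite_r (f : C_c(G, ℂ)) (x : X) : {h | f h ≠ 0 ∧ 𝒢.r h = x}.Finite := by
  obtain ⟨N, hN⟩ := exists_bound 𝒢 f
  exact set_finite_of_card_bound N fun A hA => (hN x A).1 hA

end
end Gpd

/-! ### Induced representations -/

namespace Gpd
variable {X G : Type u} {𝒢 : Gpd X G}

/-- Two arrows with source the base point of `S` are in the same coset if they differ by an element
of `S` on the right. -/
def Sub.cosetRel (S : 𝒢.Sub) : Setoid {g : G // 𝒢.s g = S.base} where
  r a b := ∃ k ∈ S.carrier, b.1 = 𝒢.mul a.1 k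
  iseqv := by
    refine ⟨fun a => ⟨_, S.unit_mem, ?_⟩, ?_, ?_⟩
    · have := 𝒢.mul_unit a.1
      rw [a.2] at this; exact this.symm
    · rintro a b ⟨k, hk, e⟩
      refine ⟨_, S.inv_mem k hk, ?_⟩
      rw [e, 𝒢.mul_assoc _ _ _ (by rw [a.2, S.r_eq k hk]) (𝒢.r_inv k).symm, 𝒢.mul_inv, S.r_eq k hk]
      have := 𝒢.mul_unit a.1
      rw [a.2] at this; exact this.symm
    · rintro a b c ⟨k, hk, e⟩ ⟨l, hl, e'⟩
      refine ⟨_, S.mul_mem k hk l hl, ?_⟩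
      rw [e', e, 𝒢.mul_assoc _ _ _ (by rw [a.2, S.r_eq k hk]) (S.comp hk hl)]

/-- The set `𝒢_x / S` of left cosets, where `x` is the base point of `S`. -/
def Sub.Coset (S : 𝒢.Sub) : Type u := Quotient S.cosetRel

/-- A representative of a coset. -/
def Sub.rep (S : 𝒢.Sub) (c : S.Coset) : G := (Quotient.out c).1

theorem Sub.s_rep (S : 𝒢.Sub) (c : S.Coset) : 𝒢.s (S.rep c) = S.base := (Quotient.out c).2

theorem Sub.s_rep' (S : 𝒢.Sub) (c : S.Coset) (k : S.El) : 𝒢.s (S.rep c) = 𝒢.r k.1 := by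
  rw [S.s_rep, S.r_eq _ k.2]

theorem Sub.exists_rep (S : 𝒢.Sub) (g : G) (hg : 𝒢.s g = S.base) :
    ∃ (c : S.Coset) (k : S.El), g = 𝒢.mul (S.rep c) k.1 := by
  obtain ⟨k, hk, e⟩ := Quotient.exact (s := S.cosetRel)
    (Quotient.out_eq (Quotient.mk S.cosetRel ⟨g, hg⟩))
  exact ⟨Quotient.mk S.cosetRel ⟨g, hg⟩, ⟨k, hk⟩, e⟩

theorem Sub.rep_inj (S : 𝒢.Sub) {c c' : S.Coset} {k k' : S.El}
    (h : 𝒢.mul (S.rep c) k.1 = 𝒢.mul (S.rep c') k'.1) : c = c' ∧ k = k' := by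
  have hc : c = c' := by
    rw [← Quotient.out_eq c, ← Quotient.out_eq c']
    refine Quotient.sound ⟨𝒢.mul k.1 (𝒢.inv k'.1), S.mul_mem _ k.2 _ (S.inv_mem _ k'.2), ?_⟩
    change S.rep c' = 𝒢.mul (S.rep c) _
    rw [← 𝒢.mul_assoc _ _ _ (S.s_rep' c k) (S.comp k.2 (S.inv_mem _ k'.2)), h,
      𝒢.mul_assoc _ _ _ (S.s_rep' c' k') (𝒢.r_inv _).symm, 𝒢.mul_inv, S.r_eq _ k'.2,
      ← S.s_rep c', 𝒢.mul_unit]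
  subst hc
  refine ⟨rfl, Subtype.ext ?_⟩
  rw [← 𝒢.inv_mul_cancel (S.s_rep' c k), h, 𝒢.inv_mul_cancel (S.s_rep' c k')]

variable {S : 𝒢.Sub}

theorem star_op_mul (π : URep S.El) (k l : S.El) (v : π.H) :
    star (π.op (k * l) : π.H →L[ℂ] π.H) v =
      star (π.op l : π.H →L[ℂ] π.H) (star (π.op k : π.H →L[ℂ] π.H) v) := by
  rw [map_mul, Submonoid.coe_mul, star_mul]; rfl

theorem norm_star_op (π : URep S.El) (k : S.El) (v : π.H) :
    ‖star (π.op k : π.H →L[ℂ] π.H) v‖ = ‖v‖ := by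
  have h : (π.op k : π.H →L[ℂ] π.H) (star (π.op k : π.H →L[ℂ] π.H) v) = v := by
    have := Unitary.mul_star_self_of_mem (π.op k).2
    exact congrArg (fun T : π.H →L[ℂ] π.H => T v) this
  have h1 : ∀ (T : π.H →L[ℂ] π.H) (w : π.H), ‖T‖ ≤ 1 → ‖T w‖ ≤ ‖w‖ := fun T w hT =>
    (T.le_opNorm w).trans (by simpa using mul_le_mul_of_nonneg_right hT (norm_nonneg w))
  refine le_antisymm (h1 _ _ ?_) ?_
  · rw [norm_star]; exact norm_unitary_le _
  · conv_lhs => rw [← h]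
    exact h1 _ _ (norm_unitary_le _)

theorem inner_star_op (π : URep S.El) (k : S.El) (v w : π.H) :
    ⟪star (π.op k : π.H →L[ℂ] π.H) v, w⟫_ℂ = ⟪v, (π.op k : π.H →L[ℂ] π.H) w⟫_ℂ :=
  ContinuousLinearMap.adjoint_inner_left _ _ _

/-- The space of the representation induced from `π`: functions `ξ` on `𝒢_x` (extended by zero to
the other arrows) with `ξ(g k) = π(k)⋆ ξ(g)` for `k ∈ S` and `∑ ‖ξ(g)‖² < ∞`, the sum over
`g ∈ 𝒢_x / S`. As `‖ξ(g k)‖ = ‖ξ(g)‖`, the choice of representatives does not matter. -/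
def indSpace (π : URep S.El) : Submodule ℂ (G → π.H) where
  carrier := {ξ | (∀ g, 𝒢.s g ≠ S.base → ξ g = 0) ∧
    (∀ (g : G) (k : S.El), 𝒢.s g = S.base →
      ξ (𝒢.mul g k.1) = star (π.op k : π.H →L[ℂ] π.H) (ξ g)) ∧
    Summable fun c : S.Coset => ‖ξ (S.rep c)‖ ^ 2}
  zero_mem' := ⟨fun _ _ => rfl, fun _ _ _ => by simp, by simp⟩
  add_mem' := by
    rintro ξ η ⟨h1, h2, h3⟩ ⟨k1, k2, k3⟩
    refine ⟨fun g hg => by simp [h1 g hg, k1 g hg], fun g k hg => by simp [h2 g k hg, k2 g k hg], ?_⟩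
    refine Summable.of_nonneg_of_le (fun _ => sq_nonneg _) (fun c => ?_)
      ((h3.mul_left 2).add (k3.mul_left 2))
    have := norm_add_le (ξ (S.rep c)) (η (S.rep c))
    simp only [Pi.add_apply]
    nlinarith [sq_nonneg (‖ξ (S.rep c)‖ - ‖η (S.rep c)‖), norm_nonneg (ξ (S.rep c) + η (S.rep c)),
      norm_nonneg (ξ (S.rep c)), norm_nonneg (η (S.rep c))]
  smul_mem' := by
    rintro a ξ ⟨h1, h2, h3⟩
    refine ⟨fun g hg => by simp [h1 g hg], fun g k hg => by simp [h2 g k hg], ?_⟩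
    refine (h3.mul_left (‖a‖ ^ 2)).congr fun c => ?_
    simp only [Pi.smul_apply, norm_smul, mul_pow]

/-- The space `indSpace π`, as a Hilbert space with inner product `∑ ⟪ξ(g), η(g)⟫` over
`g ∈ 𝒢_x / S`. -/
def IndSp (π : URep S.El) : Type u := indSpace π

instance (π : URep S.El) : AddCommGroup (IndSp π) := inferInstanceAs (AddCommGroup (indSpace π))
instance (π : URep S.El) : Module ℂ (IndSp π) := inferInstanceAs (Module ℂ (indSpace π))

/-- Restriction of a function to the coset representatives. -/
def restr (π : URep S.El) : IndSp π →ₗ[ℂ] lp (fun _ : S.Coset => π.H) 2 where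
  toFun ξ := ⟨fun c => ξ.1 (S.rep c), by
    have h : Memℓp (fun c : S.Coset => ξ.1 (S.rep c)) 2 := by
      rw [memℓp_gen_iff (by norm_num)]
      simpa using ξ.2.2.2
    exact h⟩
  map_add' _ _ := rfl
  map_smul' _ _ := rfl

theorem restr_apply (π : URep S.El) (ξ : IndSp π) (c : S.Coset) :
    restr π ξ c = ξ.1 (S.rep c) := rfl

theorem restr_injective (π : URep S.El) : Function.Injective (restr π) := by
  intro ξ η h
  refine Subtype.ext (funext fun g => ?_)
  by_cases hg : 𝒢.s g = S.base
  · obtain ⟨c, k, rfl⟩ := S.exists_rep g hg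
    rw [ξ.2.2.1 _ _ (S.s_rep c), η.2.2.1 _ _ (S.s_rep c)]
    have := congrArg (fun v : lp (fun _ : S.Coset => π.H) 2 => v c) h
    simp only [restr_apply] at this
    rw [this]
  · rw [ξ.2.1 g hg, η.2.1 g hg]

theorem restr_surjective (π : URep S.El) : Function.Surjective (restr π) := by
  classical
  intro v
  choose c k hck using fun g hg => S.exists_rep g hg
  have key : ∀ (d : S.Coset) (l : S.El) (h : 𝒢.s (𝒢.mul (S.rep d) l.1) = S.base),
      c _ h = d ∧ k _ h = l := fun d l h => S.rep_inj (hck _ h).symm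
  let ξ : G → π.H := fun g =>
    if h : 𝒢.s g = S.base then star (π.op (k g h) : π.H →L[ℂ] π.H) (v (c g h)) else 0
  have hξ : ∀ (d : S.Coset) (l : S.El),
      ξ (𝒢.mul (S.rep d) l.1) = star (π.op l : π.H →L[ℂ] π.H) (v d) := by
    intro d l
    have h : 𝒢.s (𝒢.mul (S.rep d) l.1) = S.base := by
      rw [𝒢.s_mul _ _ (S.s_rep' d l), S.s_eq _ l.2]
    simp only [ξ, dif_pos h]
    rw [(key d l h).1, (key d l h).2]
  have hξ' : ∀ d, ξ (S.rep d) = v d := by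
    intro d
    have := hξ d 1
    rw [Sub.coe_one, ← S.s_rep d, 𝒢.mul_unit] at this
    rw [this]; simp
  refine ⟨⟨ξ, fun g hg => dif_neg hg, ?_, ?_⟩, ?_⟩
  · intro g l hg
    obtain ⟨d, m, rfl⟩ := S.exists_rep g hg
    rw [𝒢.mul_assoc _ _ _ (S.s_rep' d m) (S.comp m.2 l.2), ← Sub.coe_mul, hξ, hξ, star_op_mul]
  · have := lp.memℓp v
    rw [memℓp_gen_iff (by norm_num)] at this
    simpa [hξ'] using this
  · refine lp.ext (funext fun d => ?_)
    exact hξ' d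

instance (π : URep S.El) : NormedAddCommGroup (IndSp π) :=
  NormedAddCommGroup.induced _ _ (restr π) (restr_injective π)

instance (π : URep S.El) : InnerProductSpace ℂ (IndSp π) where
  norm_smul_le a ξ := by
    change ‖restr π (a • ξ)‖ ≤ ‖a‖ * ‖restr π ξ‖
    rw [map_smul]; exact norm_smul_le _ _
  inner ξ η := ∑' c : S.Coset, ⟪ξ.1 (S.rep c), η.1 (S.rep c)⟫_ℂ
  norm_sq_eq_re_inner ξ := norm_sq_eq_re_inner (𝕜 := ℂ) (restr π ξ)
  conj_inner_symm ξ η := inner_conj_symm (𝕜 := ℂ) (restr π ξ) (restr π η)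
  add_left ξ η ζ := inner_add_left (𝕜 := ℂ) (restr π ξ) (restr π η) (restr π ζ)
  smul_left ξ η a := inner_smul_left (𝕜 := ℂ) (restr π ξ) (restr π η) a

theorem norm_restr (π : URep S.El) (ξ : IndSp π) : ‖restr π ξ‖ = ‖ξ‖ := rfl

instance (π : URep S.El) : CompleteSpace (IndSp π) := by
  let e : IndSp π ≃ₗᵢ[ℂ] lp (fun _ : S.Coset => π.H) 2 :=
    { LinearEquiv.ofBijective (restr π) ⟨restr_injective π, restr_surjective π⟩ with
      norm_map' := fun ξ => rfl }
  exact e.toIsometryEquiv.completeSpace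

/-- The Hilbert space of the induced representation. -/
def indHilbert (π : URep S.El) : HilbertSp.{u} := ⟨IndSp π⟩

theorem norm_sq_ind (π : URep S.El) (ξ : IndSp π) :
    ‖ξ‖ ^ 2 = ∑' c : S.Coset, ‖ξ.1 (S.rep c)‖ ^ 2 := by
  have := lp.norm_rpow_eq_tsum (p := 2) (by norm_num) (restr π ξ)
  simpa [norm_restr, restr_apply] using this

end Gpd

namespace Gpd
variable {X G : Type u} {𝒢 : Gpd X G}

variable (𝒢) in
/-- The action of functions: `(f ξ)(g) = ∑ f(h) ξ(h⁻¹ g)`, the sum over all `h` with `r h = r g`. -/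
def convVec {V : Type*} [AddCommGroup V] [Module ℂ V] (f : G → ℂ) (ξ : G → V) (g : G) : V :=
  ∑ᶠ h ∈ {h : G | 𝒢.r h = 𝒢.r g}, f h • ξ (𝒢.mul (𝒢.inv h) g)

section
variable {S : 𝒢.Sub}

/-- The arrow `c * (d * k)⁻¹` for coset representatives `c`, `d` and `k ∈ S`. -/
def Sub.kap (S : 𝒢.Sub) (c c' : S.Coset) (k : S.El) : G :=
  𝒢.mul (S.rep c) (𝒢.inv (𝒢.mul (S.rep c') k.1))

theorem Sub.s_repmul (S : 𝒢.Sub) (c : S.Coset) (k : S.El) :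
    𝒢.s (𝒢.mul (S.rep c) k.1) = S.base := by
  rw [𝒢.s_mul _ _ (S.s_rep' c k), S.s_eq _ k.2]

theorem Sub.kap_comp (S : 𝒢.Sub) (c c' : S.Coset) (k : S.El) :
    𝒢.s (S.rep c) = 𝒢.r (𝒢.inv (𝒢.mul (S.rep c') k.1)) := by
  rw [𝒢.r_inv, S.s_rep, S.s_repmul]

theorem Sub.r_kap (S : 𝒢.Sub) (c c' : S.Coset) (k : S.El) :
    𝒢.r (S.kap c c' k) = 𝒢.r (S.rep c) := 𝒢.r_mul _ _ (S.kap_comp c c' k)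

theorem Sub.s_kap (S : 𝒢.Sub) (c c' : S.Coset) (k : S.El) :
    𝒢.s (S.kap c c' k) = 𝒢.r (S.rep c') := by
  rw [Sub.kap, 𝒢.s_mul _ _ (S.kap_comp c c' k), 𝒢.s_inv, 𝒢.r_mul _ _ (S.s_rep' c' k)]

theorem Sub.inv_kap (S : 𝒢.Sub) (c c' : S.Coset) (k : S.El) :
    𝒢.inv (S.kap c c' k) = S.kap c' c k⁻¹ := by
  have e1 : 𝒢.s k.1 = 𝒢.r (𝒢.inv (S.rep c)) := by rw [𝒢.r_inv, S.s_rep, S.s_eq _ k.2]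
  rw [Sub.kap, Sub.kap, 𝒢.mul_inv_rev (S.kap_comp c c' k), 𝒢.inv_inv,
    𝒢.mul_inv_rev (S.s_rep' c k⁻¹), ← Sub.coe_inv, _root_.inv_inv,
    𝒢.mul_assoc _ _ _ (S.s_rep' c' k) e1]

theorem Sub.inv_kap_mul (S : 𝒢.Sub) (c c' : S.Coset) (k : S.El) :
    𝒢.mul (𝒢.inv (S.kap c c' k)) (S.rep c) = 𝒢.mul (S.rep c') k.1 := by
  have e := S.s_repmul c' k
  rw [Sub.kap, 𝒢.mul_inv_rev (S.kap_comp c c' k), 𝒢.inv_inv,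
    𝒢.mul_assoc _ _ _ (by rw [e, 𝒢.r_inv, S.s_rep]) (𝒢.s_inv _), 𝒢.inv_mul, S.s_rep, ← e,
    𝒢.mul_unit]

theorem Sub.kap_inj (S : 𝒢.Sub) (c : S.Coset) {p q : S.Coset × S.El}
    (h : S.kap c p.1 p.2 = S.kap c q.1 q.2) : p = q := by
  have := S.inv_kap_mul c p.1 p.2
  rw [h, S.inv_kap_mul] at this
  exact Prod.ext (S.rep_inj this.symm).1 (S.rep_inj this.symm).2

theorem Sub.kap_inj' (S : 𝒢.Sub) (c' : S.Coset) {c d : S.Coset} {k l : S.El}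
    (h : S.kap c c' k = S.kap d c' l) : c = d ∧ k = l := by
  have := congrArg 𝒢.inv h
  rw [S.inv_kap, S.inv_kap] at this
  have h2 := S.kap_inj c' (p := (c, k⁻¹)) (q := (d, l⁻¹)) this
  simpa using h2

theorem Sub.bijOn_kap (S : 𝒢.Sub) (c : S.Coset) :
    Set.BijOn (fun p : S.Coset × S.El => S.kap c p.1 p.2) Set.univ
      {h | 𝒢.r h = 𝒢.r (S.rep c)} := by
  refine ⟨fun p _ => S.r_kap c _ _, fun p _ q _ h => S.kap_inj c h, fun h hh => ?_⟩
  have hh' : 𝒢.r h = 𝒢.r (S.rep c) := hh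
  have e1 : 𝒢.s (𝒢.inv h) = 𝒢.r (S.rep c) := by rw [𝒢.s_inv, hh']
  obtain ⟨c', k, e⟩ := S.exists_rep (𝒢.mul (𝒢.inv h) (S.rep c))
    (by rw [𝒢.s_mul _ _ e1, S.s_rep])
  refine ⟨(c', k), trivial, ?_⟩
  change 𝒢.mul (S.rep c) (𝒢.inv (𝒢.mul (S.rep c') k.1)) = h
  rw [← e, 𝒢.mul_inv_rev e1, 𝒢.inv_inv, 𝒢.mul_inv_cancel hh'.symm]

section
variable [TopologicalSpace X] [TopologicalSpace G] [𝒢.IsEtale]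

theorem Sub.finite_kap (S : 𝒢.Sub) (f : C_c(G, ℂ)) (c : S.Coset) :
    {p : S.Coset × S.El | f (S.kap c p.1 p.2) ≠ 0}.Finite := by
  refine Set.Finite.of_finite_image (f := fun p : S.Coset × S.El => S.kap c p.1 p.2)
    ((finite_r 𝒢 f (𝒢.r (S.rep c))).subset ?_) (fun p _ q _ h => S.kap_inj c h)
  rintro _ ⟨p, hp, rfl⟩
  exact ⟨hp, S.r_kap c _ _⟩

theorem convVec_rep (π : URep S.El) (f : C_c(G, ℂ)) (ξ : IndSp π) (c : S.Coset) :
    𝒢.convVec f ξ.1 (S.rep c) = ∑ p ∈ (S.finite_kap f c).toFinset,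
      f (S.kap c p.1 p.2) • star (π.op p.2 : π.H →L[ℂ] π.H) (ξ.1 (S.rep p.1)) := by
  have h1 : 𝒢.convVec f ξ.1 (S.rep c) = ∑ᶠ p ∈ (Set.univ : Set (S.Coset × S.El)),
      f (S.kap c p.1 p.2) • star (π.op p.2 : π.H →L[ℂ] π.H) (ξ.1 (S.rep p.1)) := by
    refine (finsum_mem_eq_of_bijOn _ (S.bijOn_kap c) fun p _ => ?_).symm
    rw [S.inv_kap_mul, ξ.2.2.1 _ _ (S.s_rep _)]
  rw [h1]
  refine finsum_mem_eq_sum_of_subset _ ?_ (Set.subset_univ _)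
  rintro p ⟨-, hp⟩
  simp only [Set.Finite.coe_toFinset]
  exact fun h0 => hp (by simp [h0])

theorem exists_norm_bound (f : C_c(G, ℂ)) : ∃ C : ℝ, 0 ≤ C ∧ ∀ g, ‖f g‖ ≤ C := by
  obtain ⟨C, hC⟩ := f.hasCompactSupport'.exists_bound_of_continuous f.continuous
  exact ⟨max C 0, le_max_right _ _, fun g => (hC g).trans (le_max_left _ _)⟩

theorem exists_kap_bound (S : 𝒢.Sub) (f : C_c(G, ℂ)) : ∃ N : ℕ,
    (∀ c, (S.finite_kap f c).toFinset.card ≤ N) ∧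
    ∀ (A : Finset (S.Coset × (S.Coset × S.El))), (∀ a ∈ A, f (S.kap a.1 a.2.1 a.2.2) ≠ 0) →
    ∀ φ : S.Coset → ℝ, (∀ c, 0 ≤ φ c) → Summable φ →
    ∑ a ∈ A, φ a.1 ≤ N * ∑' c, φ c ∧ ∑ a ∈ A, φ a.2.1 ≤ N * ∑' c, φ c := by
  classical
  obtain ⟨N, hN⟩ := exists_bound 𝒢 f
  refine ⟨N, fun c => ?_, fun A hA φ hφ hs => ⟨?_, ?_⟩⟩
  · rw [← Finset.card_image_of_injective (f := fun p : S.Coset × S.El => S.kap c p.1 p.2) _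
      (fun p q h => S.kap_inj c h)]
    refine (hN (𝒢.r (S.rep c)) _).1 fun h hh => ?_
    obtain ⟨p, hp, rfl⟩ := Finset.mem_image.1 hh
    exact ⟨by simpa using hp, S.r_kap c _ _⟩
  · refine sum_comp_le A (fun a => a.1) N (fun q B hB hq => ?_) φ hφ hs
    have hinj : Set.InjOn (fun a : S.Coset × (S.Coset × S.El) => S.kap a.1 a.2.1 a.2.2) B := by
      intro a ha b hb h
      have ha' := hq a ha
      have hb' := hq b hb
      simp only at ha' hb' h
      rw [ha', hb'] at h
      exact Prod.ext (ha'.trans hb'.symm) (S.kap_inj q h)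
    rw [← Finset.card_image_of_injOn hinj]
    refine (hN (𝒢.r (S.rep q)) _).1 fun h hh => ?_
    obtain ⟨a, ha, rfl⟩ := Finset.mem_image.1 hh
    exact ⟨hA a (hB ha), by rw [S.r_kap, hq a ha]⟩
  · refine sum_comp_le A (fun a => a.2.1) N (fun q B hB hq => ?_) φ hφ hs
    have hinj : Set.InjOn (fun a : S.Coset × (S.Coset × S.El) => S.kap a.1 a.2.1 a.2.2) B := by
      intro a ha b hb h
      have ha' := hq a ha
      have hb' := hq b hb
      simp only at ha' hb' h
      rw [ha', hb'] at h
      have := S.kap_inj' q h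
      exact Prod.ext this.1 (Prod.ext (ha'.trans hb'.symm) this.2)
    rw [← Finset.card_image_of_injOn hinj]
    refine (hN (𝒢.r (S.rep q)) _).2 fun h hh => ?_
    obtain ⟨a, ha, rfl⟩ := Finset.mem_image.1 hh
    exact ⟨hA a (hB ha), by rw [S.s_kap, hq a ha]⟩

theorem norm_sum_smul_sq_le {ι V : Type*} [NormedAddCommGroup V] [NormedSpace ℂ V]
    (A : Finset ι) (N : ℕ) (hA : A.card ≤ N) (a : ι → ℂ) (C : ℝ) (hC : ∀ i, ‖a i‖ ≤ C)
    (v : ι → V) : ‖∑ i ∈ A, a i • v i‖ ^ 2 ≤ N * C ^ 2 * ∑ i ∈ A, ‖v i‖ ^ 2 := by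
  calc ‖∑ i ∈ A, a i • v i‖ ^ 2 ≤ (∑ i ∈ A, ‖a i • v i‖) ^ 2 :=
        pow_le_pow_left₀ (norm_nonneg _) (norm_sum_le _ _) 2
    _ ≤ A.card * ∑ i ∈ A, ‖a i • v i‖ ^ 2 := sq_sum_le_card_mul_sum_sq
    _ ≤ N * ∑ i ∈ A, C ^ 2 * ‖v i‖ ^ 2 := by
        refine mul_le_mul (by exact_mod_cast hA) (Finset.sum_le_sum fun i _ => ?_)
          (Finset.sum_nonneg fun _ _ => sq_nonneg _) (Nat.cast_nonneg _)
        rw [norm_smul, mul_pow]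
        exact mul_le_mul_of_nonneg_right (pow_le_pow_left₀ (norm_nonneg _) (hC i) 2) (sq_nonneg _)
    _ = N * C ^ 2 * ∑ i ∈ A, ‖v i‖ ^ 2 := by rw [← Finset.mul_sum]; ring

theorem exists_ind_bound (π : URep S.El) (f : C_c(G, ℂ)) : ∃ M : ℝ, 0 ≤ M ∧
    ∀ ξ : IndSp π, ∀ A : Finset S.Coset,
      ∑ c ∈ A, ‖𝒢.convVec f ξ.1 (S.rep c)‖ ^ 2 ≤ M ^ 2 * ‖ξ‖ ^ 2 := by
  classical
  obtain ⟨N, hN, hN'⟩ := exists_kap_bound S f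
  obtain ⟨C, hC0, hC⟩ := exists_norm_bound (G := G) f
  refine ⟨N * C, by positivity, fun ξ A => ?_⟩
  calc ∑ c ∈ A, ‖𝒢.convVec f ξ.1 (S.rep c)‖ ^ 2
      ≤ ∑ c ∈ A, N * C ^ 2 * ∑ p ∈ (S.finite_kap f c).toFinset, ‖ξ.1 (S.rep p.1)‖ ^ 2 := by
        refine Finset.sum_le_sum fun c _ => ?_
        rw [convVec_rep]
        refine (norm_sum_smul_sq_le _ N (hN c) _ C (fun _ => hC _) _).trans_eq ?_
        simp only [norm_star_op]
    _ = N * C ^ 2 * ∑ a ∈ (A.sigma fun c => (S.finite_kap f c).toFinset).map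
          (Equiv.sigmaEquivProd S.Coset (S.Coset × S.El)).toEmbedding,
          ‖ξ.1 (S.rep a.2.1)‖ ^ 2 := by
        rw [← Finset.mul_sum, Finset.sum_map, Finset.sum_sigma]; rfl
    _ ≤ N * C ^ 2 * (N * ∑' c, ‖ξ.1 (S.rep c)‖ ^ 2) := by
        refine mul_le_mul_of_nonneg_left (hN' _ ?_ _ (fun _ => sq_nonneg _) ξ.2.2.2).2 (by positivity)
        intro a ha
        obtain ⟨b, hb, rfl⟩ := Finset.mem_map.1 ha
        simpa using (Finset.mem_sigma.1 hb).2
    _ = (N * C) ^ 2 * ‖ξ‖ ^ 2 := by rw [norm_sq_ind]; ring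

theorem convVec_mem (π : URep S.El) (f : C_c(G, ℂ)) (ξ : IndSp π) :
    𝒢.convVec f ξ.1 ∈ indSpace π := by
  refine ⟨fun g hg => ?_, fun g k hg => ?_, ?_⟩
  · refine finsum_mem_eq_zero_of_forall_eq_zero fun h hh => ?_
    rw [ξ.2.1, smul_zero]
    rwa [𝒢.s_mul _ _ (by rw [𝒢.s_inv]; exact hh)]
  · have e : 𝒢.s g = 𝒢.r k.1 := by rw [hg, S.r_eq _ k.2]
    rw [convVec, convVec, 𝒢.r_mul _ _ e, finsum_range_eq (finite_r 𝒢 f (𝒢.r g)),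
      finsum_range_eq (finite_r 𝒢 f (𝒢.r g)), map_sum]
    refine Finset.sum_congr rfl fun h hh => ?_
    have hh' : 𝒢.s (𝒢.inv h) = 𝒢.r g := by
      rw [𝒢.s_inv]
      have := (Set.Finite.mem_toFinset _).1 hh
      exact this.2
    rw [map_smul, ← 𝒢.mul_assoc _ _ _ hh' e, ξ.2.2.1 _ _ (by rw [𝒢.s_mul _ _ hh', hg])]
  · obtain ⟨M, -, hM⟩ := exists_ind_bound π f
    exact summable_of_sum_le (fun _ => sq_nonneg _) (hM ξ)

theorem convVec_eq_sum {V : Type*} [AddCommGroup V] [Module ℂ V] (f : C_c(G, ℂ)) (ξ : G → V)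
    (g : G) : 𝒢.convVec f ξ g =
      ∑ h ∈ (finite_r 𝒢 f (𝒢.r g)).toFinset, f h • ξ (𝒢.mul (𝒢.inv h) g) :=
  finsum_range_eq (finite_r 𝒢 f (𝒢.r g)) _

theorem convVec_add {V : Type*} [AddCommGroup V] [Module ℂ V] (f : C_c(G, ℂ)) (ξ η : G → V) :
    𝒢.convVec f (ξ + η) = 𝒢.convVec f ξ + 𝒢.convVec f η := by
  funext g
  simp only [convVec_eq_sum, Pi.add_apply, smul_add, Finset.sum_add_distrib]

theorem convVec_smul {V : Type*} [AddCommGroup V] [Module ℂ V] (f : C_c(G, ℂ)) (a : ℂ)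
    (ξ : G → V) : 𝒢.convVec f (a • ξ) = a • 𝒢.convVec f ξ := by
  funext g
  simp only [convVec_eq_sum, Pi.smul_apply, Finset.smul_sum, smul_comm a]

/-- The operator of the induced representation given by `f ∈ C_c(𝒢)`. -/
def indOp (π : URep S.El) (f : C_c(G, ℂ)) : IndSp π →L[ℂ] IndSp π :=
  LinearMap.mkContinuousOfExistsBound
    { toFun := fun ξ => ⟨𝒢.convVec f ξ.1, convVec_mem π f ξ⟩
      map_add' := fun ξ η => Subtype.ext (convVec_add f ξ.1 η.1)
      map_smul' := fun a ξ => Subtype.ext (convVec_smul f a ξ.1) } (by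
    obtain ⟨M, hM0, hM⟩ := exists_ind_bound π f
    refine ⟨M, fun ξ => ?_⟩
    refine abs_le_of_sq_le_sq' ?_ (by positivity) |>.2
    rw [norm_sq_ind, mul_pow]
    exact Real.tsum_le_of_sum_le (fun _ => sq_nonneg _) (hM ξ))

theorem indOp_apply (π : URep S.El) (f : C_c(G, ℂ)) (ξ : IndSp π) (g : G) :
    (indOp π f ξ).1 g = 𝒢.convVec f ξ.1 g := rfl

end
end
end Gpd

namespace Gpd
variable {X G : Type u} {𝒢 : Gpd X G}
variable [TopologicalSpace X] [TopologicalSpace G] [𝒢.IsEtale]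
variable {S : 𝒢.Sub}

/-- Terms of the sum for the matrix coefficients of the induced representation. -/
def coeffTerm (π : URep S.El) (f : C_c(G, ℂ)) (ξ η : IndSp π)
    (a : S.Coset × (S.Coset × S.El)) : ℂ :=
  f (S.kap a.1 a.2.1 a.2.2) *
    ⟪ξ.1 (S.rep a.1), star (π.op a.2.2 : π.H →L[ℂ] π.H) (η.1 (S.rep a.2.1))⟫_ℂ

theorem summable_coeffTerm (π : URep S.El) (f : C_c(G, ℂ)) (ξ η : IndSp π) :
    Summable (coeffTerm π f ξ η) := by
  classical
  obtain ⟨N, -, hN⟩ := exists_kap_bound S f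
  obtain ⟨C, hC0, hC⟩ := exists_norm_bound (G := G) f
  refine Summable.of_norm ?_
  refine summable_of_sum_le (c := C * (N * ∑' c, ‖ξ.1 (S.rep c)‖ ^ 2) +
    C * (N * ∑' c, ‖η.1 (S.rep c)‖ ^ 2)) (fun _ => norm_nonneg _) fun A => ?_
  have h1 := (hN (A.filter fun a => f (S.kap a.1 a.2.1 a.2.2) ≠ 0)
    (fun a ha => (Finset.mem_filter.1 ha).2) _ (fun _ => sq_nonneg _) ξ.2.2.2).1
  have h2 := (hN (A.filter fun a => f (S.kap a.1 a.2.1 a.2.2) ≠ 0)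
    (fun a ha => (Finset.mem_filter.1 ha).2) _ (fun _ => sq_nonneg _) η.2.2.2).2
  calc ∑ a ∈ A, ‖coeffTerm π f ξ η a‖
      = ∑ a ∈ A.filter (fun a => f (S.kap a.1 a.2.1 a.2.2) ≠ 0), ‖coeffTerm π f ξ η a‖ := by
        refine (Finset.sum_filter_of_ne (p := fun a : S.Coset × (S.Coset × S.El) =>
          f (S.kap a.1 a.2.1 a.2.2) ≠ 0)
          fun a _ ha h0 => ha ?_).symm
        rw [coeffTerm, h0, zero_mul, norm_zero]
    _ ≤ ∑ a ∈ A.filter (fun a => f (S.kap a.1 a.2.1 a.2.2) ≠ 0),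
          (C * ‖ξ.1 (S.rep a.1)‖ ^ 2 + C * ‖η.1 (S.rep a.2.1)‖ ^ 2) := by
        refine Finset.sum_le_sum fun a _ => ?_
        rw [coeffTerm, norm_mul, ← mul_add]
        refine mul_le_mul (hC _) ?_ (norm_nonneg _) hC0
        refine (norm_inner_le_norm _ _).trans ?_
        rw [norm_star_op]
        nlinarith [sq_nonneg (‖ξ.1 (S.rep a.1)‖ - ‖η.1 (S.rep a.2.1)‖),
          sq_nonneg ‖ξ.1 (S.rep a.1)‖, sq_nonneg ‖η.1 (S.rep a.2.1)‖]
    _ ≤ _ := by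
        rw [Finset.sum_add_distrib, ← Finset.mul_sum, ← Finset.mul_sum]
        exact add_le_add (mul_le_mul_of_nonneg_left h1 hC0) (mul_le_mul_of_nonneg_left h2 hC0)

theorem inner_indOp (π : URep S.El) (f : C_c(G, ℂ)) (ξ η : IndSp π) :
    ⟪ξ, indOp π f η⟫_ℂ = ∑' a, coeffTerm π f ξ η a := by
  rw [(summable_coeffTerm π f ξ η).tsum_prod]
  change ∑' c : S.Coset, ⟪ξ.1 (S.rep c), 𝒢.convVec f η.1 (S.rep c)⟫_ℂ = _
  refine tsum_congr fun c => ?_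
  rw [convVec_rep, inner_sum, tsum_eq_sum (s := (S.finite_kap f c).toFinset)]
  · refine Finset.sum_congr rfl fun p _ => ?_
    rw [inner_smul_right]; rfl
  · intro p hp
    have : f (S.kap c p.1 p.2) = 0 := by simpa using hp
    simp [coeffTerm, this]

theorem indOp_star (π : URep S.El) (f f' : C_c(G, ℂ))
    (hf : ∀ g, f' g = star (f (𝒢.inv g))) (ξ η : IndSp π) :
    ⟪indOp π f' ξ, η⟫_ℂ = ⟪ξ, indOp π f η⟫_ℂ := by
  rw [← inner_conj_symm, inner_indOp, inner_indOp, Complex.conj_tsum]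
  let e : S.Coset × (S.Coset × S.El) ≃ S.Coset × (S.Coset × S.El) :=
    { toFun := fun a => (a.2.1, a.1, a.2.2⁻¹)
      invFun := fun a => (a.2.1, a.1, a.2.2⁻¹)
      left_inv := fun a => by simp
      right_inv := fun a => by simp }
  rw [← e.tsum_eq]
  refine tsum_congr fun a => ?_
  change (starRingEnd ℂ) (f' (S.kap a.2.1 a.1 a.2.2⁻¹) *
    ⟪η.1 (S.rep a.2.1), star (π.op a.2.2⁻¹ : π.H →L[ℂ] π.H) (ξ.1 (S.rep a.1))⟫_ℂ) =
    f (S.kap a.1 a.2.1 a.2.2) *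
    ⟪ξ.1 (S.rep a.1), star (π.op a.2.2 : π.H →L[ℂ] π.H) (η.1 (S.rep a.2.1))⟫_ℂ
  rw [map_mul, inner_conj_symm, hf, S.inv_kap, _root_.inv_inv, inner_star_op]
  have h : ((π.op a.2.2⁻¹ : unitary (π.H →L[ℂ] π.H)) : π.H →L[ℂ] π.H) =
      star (π.op a.2.2 : π.H →L[ℂ] π.H) := by
    rw [map_inv]; rfl
  rw [h]
  congr 1
  exact star_star _

/-- The representation `Ind π` of `C_c(𝒢)` induced from a unitary representation `π` of `S`. -/
def indRep (S : 𝒢.Sub) (π : URep S.El) : 𝒢.Rep where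
  H := indHilbert π
  op :=
    { toFun := fun f => indOp π f
      map_add' := fun f₁ f₂ => by
        refine ContinuousLinearMap.ext fun ξ => Subtype.ext (funext fun g => ?_)
        change 𝒢.convVec (f₁ + f₂ : C_c(G, ℂ)) ξ.1 g =
          𝒢.convVec f₁ ξ.1 g + 𝒢.convVec f₂ ξ.1 g
        rw [convVec, convVec, convVec, ← finsum_mem_add_distrib']
        · exact finsum_mem_congr rfl fun h _ => by simp [add_smul]
        · exact (finite_r 𝒢 f₁ (𝒢.r g)).subset fun h hh =>
            ⟨fun h0 => hh.2 (by simp [h0]), hh.1⟩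
        · exact (finite_r 𝒢 f₂ (𝒢.r g)).subset fun h hh =>
            ⟨fun h0 => hh.2 (by simp [h0]), hh.1⟩
      map_smul' := fun a f => by
        refine ContinuousLinearMap.ext fun ξ => Subtype.ext (funext fun g => ?_)
        change 𝒢.convVec (a • f : C_c(G, ℂ)) ξ.1 g = a • 𝒢.convVec f ξ.1 g
        rw [← Pi.smul_apply, ← convVec_smul]
        exact finsum_mem_congr rfl fun h _ => by simp [smul_smul, mul_comm] }
  op_conv f₁ f₂ f hf := by
    refine ContinuousLinearMap.ext fun ξ => Subtype.ext (funext fun g => ?_)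
    change 𝒢.convVec f ξ.1 g = 𝒢.convVec f₁ (𝒢.convVec f₂ ξ.1) g
    refine (conv_sum f₁ f₂ f hf (𝒢.r g) (finite_r 𝒢 f₁ _) (finite_r 𝒢 f₂) fun h => ξ.1 (𝒢.mul (𝒢.inv h) g)).trans ?_
    refine finsum_mem_congr rfl fun l hl => ?_
    have hl' : 𝒢.s (𝒢.inv l) = 𝒢.r g := by rw [𝒢.s_inv]; exact hl
    rw [convVec, 𝒢.r_mul _ _ hl', 𝒢.r_inv]
    congr 1
    refine finsum_mem_congr rfl fun m hm => ?_
    have hm' : 𝒢.r m = 𝒢.s l := hm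
    rw [𝒢.mul_inv_rev hm'.symm, 𝒢.mul_assoc _ _ _ (by rw [𝒢.s_inv, 𝒢.r_inv, hm']) hl']
  op_star f f' hf := by
    change indOp π f' = ContinuousLinearMap.adjoint (indOp π f)
    rw [ContinuousLinearMap.eq_adjoint_iff]
    exact indOp_star π f f' hf

end Gpd

/-! ### The Fell topology and the group bundle over the space of subgroups -/

/-- The Fell topology, with the basis of sets `{A | A ∩ K = ∅ and A ∩ U i ≠ ∅ for all i}`, for `K`
compact and finitely many open `U i`. -/
@[reducible] def fellTopology (Y : Type u) [TopologicalSpace Y] : TopologicalSpace (Set Y) :=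
  .generateFrom {𝒰 | ∃ (K : Set Y) (n : ℕ) (U : Fin n → Set Y), IsCompact K ∧ (∀ i, IsOpen (U i)) ∧
    𝒰 = {A | A ∩ K = ∅ ∧ ∀ i, (A ∩ U i).Nonempty}}

/-- The Jacobson topology. -/
instance (A : Type v) [NonUnitalCStarAlgebra A] : TopologicalSpace (Prim.{v, w} A) :=
  .induced Subtype.val (hullKernel A)

namespace Gpd
variable {X G : Type u} (𝒢 : Gpd X G)

/-- The topology of `Sub(𝒢)`. Subgroups of a Hausdorff étale groupoid are closed subsets of `G`. -/
instance [TopologicalSpace G] : TopologicalSpace 𝒢.Sub :=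
  .induced Sub.carrier (fellTopology G)

/-- The arrows of the group bundle `Σ(𝒢) = {(S, g) ∈ Sub(𝒢) × 𝒢 : g ∈ S}` over `Sub(𝒢)`. -/
@[ext] structure SigmaArr where
  grp : 𝒢.Sub
  arr : G
  mem : arr ∈ grp.carrier

instance [TopologicalSpace G] : TopologicalSpace 𝒢.SigmaArr :=
  .induced (fun σ => (σ.grp, σ.arr)) inferInstance

variable {𝒢}

open Classical in
/-- `(S, g) (S, h) = (S, g h)`. -/
def SigmaArr.mul (σ τ : 𝒢.SigmaArr) : 𝒢.SigmaArr :=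
  if h : σ.grp = τ.grp then
    ⟨σ.grp, 𝒢.mul σ.arr τ.arr, σ.grp.mul_mem _ σ.mem _ (by rw [h]; exact τ.mem)⟩
  else σ

theorem SigmaArr.mk_mul_mk (S : 𝒢.Sub) {g h : G} (hg : g ∈ S.carrier) (hh : h ∈ S.carrier) :
    SigmaArr.mul ⟨S, g, hg⟩ ⟨S, h, hh⟩ = ⟨S, 𝒢.mul g h, S.mul_mem _ hg _ hh⟩ :=
  dif_pos rfl

variable (𝒢)

/-- The groupoid `Σ(𝒢)`, a bundle of groups over `Sub(𝒢)` with fiber `S` at `S`. -/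
def sigmaGpd : Gpd 𝒢.Sub 𝒢.SigmaArr where
  r σ := σ.grp
  s σ := σ.grp
  unit S := ⟨S, 𝒢.unit S.base, S.unit_mem⟩
  mul := SigmaArr.mul
  inv σ := ⟨σ.grp, 𝒢.inv σ.arr, σ.grp.inv_mem _ σ.mem⟩
  r_unit _ := rfl
  s_unit _ := rfl
  r_mul := by
    rintro ⟨S, g, hg⟩ ⟨T, h, hh⟩ e
    obtain rfl : S = T := e
    rw [SigmaArr.mk_mul_mk]
  s_mul := by
    rintro ⟨S, g, hg⟩ ⟨T, h, hh⟩ e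
    obtain rfl : S = T := e
    rw [SigmaArr.mk_mul_mk]
  mul_assoc := by
    rintro ⟨S, g, hg⟩ ⟨T, h, hh⟩ ⟨R, k, hk⟩ h1 h2
    obtain rfl : S = T := h1
    obtain rfl : S = R := h2
    simp only [SigmaArr.mk_mul_mk, 𝒢.mul_assoc _ _ _ (S.comp hg hh) (S.comp hh hk)]
  unit_mul := by
    rintro ⟨S, g, hg⟩
    have := 𝒢.unit_mul g
    rw [S.r_eq g hg] at this
    simp only [SigmaArr.mk_mul_mk, this]
  mul_unit := by
    rintro ⟨S, g, hg⟩
    have := 𝒢.mul_unit g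
    rw [S.s_eq g hg] at this
    simp only [SigmaArr.mk_mul_mk, this]
  r_inv _ := rfl
  s_inv _ := rfl
  inv_mul := by
    rintro ⟨S, g, hg⟩
    have := 𝒢.inv_mul g
    rw [S.s_eq g hg] at this
    simp only [SigmaArr.mk_mul_mk, this]
  mul_inv := by
    rintro ⟨S, g, hg⟩
    have := 𝒢.mul_inv g
    rw [S.r_eq g hg] at this
    simp only [SigmaArr.mk_mul_mk, this]

variable {𝒢}

/-- The inclusion of the fiber at `S`. -/
def sigmaPt (S : 𝒢.Sub) (g : S.El) : 𝒢.SigmaArr := ⟨S, g.1, g.2⟩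

theorem sigmaPt_injective (S : 𝒢.Sub) : Function.Injective (sigmaPt S) := fun _ _ e =>
  Subtype.ext (congrArg SigmaArr.arr e)

theorem sigmaPt_mul (S : 𝒢.Sub) (g h : S.El) :
    𝒢.sigmaGpd.mul (sigmaPt S g) (sigmaPt S h) = sigmaPt S (g * h) :=
  SigmaArr.mk_mul_mk S g.2 h.2

theorem sigmaPt_bijOn (S : 𝒢.Sub) :
    Set.BijOn (sigmaPt S) Set.univ {σ | 𝒢.sigmaGpd.r σ = S} := by
  refine ⟨fun g _ => rfl, (sigmaPt_injective S).injOn, ?_⟩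
  rintro ⟨T, g, hg⟩ (h : T = S)
  subst h
  exact ⟨⟨g, hg⟩, trivial, rfl⟩

/-- The operator `∑ f(S, g) π(g)`, the sum over `g ∈ S`. -/
def fiberOp {S : 𝒢.Sub} (π : URep S.El) (f : 𝒢.SigmaArr → ℂ) : π.H →L[ℂ] π.H :=
  ∑ᶠ g : S.El, f (sigmaPt S g) • (π.op g : π.H →L[ℂ] π.H)

theorem fiberOp_eq_sum [TopologicalSpace G] {S : 𝒢.Sub} (π : URep S.El) (f : C_c(𝒢.SigmaArr, ℂ)) (A : Finset S.El)
    (hA : ∀ g, f (sigmaPt S g) ≠ 0 → g ∈ A) :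
    fiberOp π f = ∑ g ∈ A, f (sigmaPt S g) • (π.op g : π.H →L[ℂ] π.H) := by
  refine finsum_eq_sum_of_support_subset _ fun g hg => ?_
  exact hA g fun h0 => hg (by simp [h0])

section
variable [TopologicalSpace X] [TopologicalSpace G] [𝒢.IsEtale]

theorem finite_sigma (f : C_c(𝒢.SigmaArr, ℂ)) (S : 𝒢.Sub) :
    {σ | f σ ≠ 0 ∧ 𝒢.sigmaGpd.r σ = S}.Finite := by
  classical
  have hc : Continuous fun σ : 𝒢.SigmaArr => σ.arr :=
    continuous_snd.comp (continuous_induced_dom (f := fun σ : 𝒢.SigmaArr => (σ.grp, σ.arr)))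
  obtain ⟨N, hN⟩ := exists_card_bound 𝒢.r (r_locInj 𝒢) (f.hasCompactSupport'.image hc)
  refine set_finite_of_card_bound N fun A hA => ?_
  rw [← Finset.card_image_of_injOn (f := SigmaArr.arr)]
  · refine hN S.base _ fun g hg => ?_
    obtain ⟨σ, hσ, rfl⟩ := Finset.mem_image.1 hg
    refine ⟨⟨σ, subset_tsupport _ (hA σ hσ).1, rfl⟩, ?_⟩
    have e : σ.grp = S := (hA σ hσ).2
    rw [← e]; exact σ.grp.r_eq _ σ.mem
  · intro σ hσ τ hτ h
    exact SigmaArr.ext ((hA σ hσ).2.trans (hA τ hτ).2.symm) h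

theorem finite_fiber (f : C_c(𝒢.SigmaArr, ℂ)) (S : 𝒢.Sub) :
    {g : S.El | f (sigmaPt S g) ≠ 0}.Finite := by
  refine Set.Finite.of_finite_image ((finite_sigma f S).subset ?_) (sigmaPt_injective S).injOn
  rintro _ ⟨g, hg, rfl⟩
  exact ⟨hg, rfl⟩

theorem fiberOp_conv {S : 𝒢.Sub} (π : URep S.El) (f₁ f₂ f : C_c(𝒢.SigmaArr, ℂ))
    (hf : ∀ σ, f σ = 𝒢.sigmaGpd.conv f₁ f₂ σ) : fiberOp π f = fiberOp π f₁ * fiberOp π f₂ := by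
  classical
  let v : 𝒢.SigmaArr → (π.H →L[ℂ] π.H) := fun σ =>
    if h : σ.grp = S then (π.op ⟨σ.arr, by rw [← h]; exact σ.mem⟩ : π.H →L[ℂ] π.H) else 0
  have hv : ∀ g, v (sigmaPt S g) = π.op g := fun g => dif_pos rfl
  have key : ∀ (f : 𝒢.SigmaArr → ℂ) (w : 𝒢.SigmaArr → (π.H →L[ℂ] π.H)),
      ∑ᶠ σ ∈ {σ | 𝒢.sigmaGpd.r σ = S}, f σ • w σ = ∑ᶠ g : S.El, f (sigmaPt S g) • w (sigmaPt S g) := by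
    intro f w
    rw [← finsum_mem_univ fun g : S.El => f (sigmaPt S g) • w (sigmaPt S g)]
    exact (finsum_mem_eq_of_bijOn _ (sigmaPt_bijOn S) fun g _ => rfl).symm
  have h := conv_sum (V := π.H →L[ℂ] π.H) f₁ f₂ f hf S (finite_sigma f₁ S) (finite_sigma f₂) v
  rw [key, key] at h
  simp only [hv] at h
  change fiberOp π f = _ at h
  rw [h]
  have h2 : ∀ g : S.El, ∑ᶠ m ∈ {m | 𝒢.sigmaGpd.r m = 𝒢.sigmaGpd.s (sigmaPt S g)},
      f₂ m • v (𝒢.sigmaGpd.mul (sigmaPt S g) m) = (π.op g : π.H →L[ℂ] π.H) * fiberOp π f₂ := by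
    intro g
    change ∑ᶠ m ∈ {m | 𝒢.sigmaGpd.r m = S}, _ = _
    rw [key]
    simp only [sigmaPt_mul, hv]
    rw [fiberOp_eq_sum π f₂ (finite_fiber f₂ S).toFinset (by simp), Finset.mul_sum]
    rw [finsum_eq_sum_of_support_subset (s := (finite_fiber f₂ S).toFinset)]
    · refine Finset.sum_congr rfl fun k _ => ?_
      rw [map_mul, mul_smul_comm]; rfl
    · intro k hk
      simp only [Set.Finite.coe_toFinset]
      exact fun h0 => hk (by simp [h0])
  simp only [h2]
  rw [fiberOp_eq_sum π f₁ (finite_fiber f₁ S).toFinset (by simp), Finset.sum_mul]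
  rw [finsum_eq_sum_of_support_subset (s := (finite_fiber f₁ S).toFinset)]
  · exact Finset.sum_congr rfl fun k _ => (smul_mul_assoc _ _ _).symm
  · intro k hk
    simp only [Set.Finite.coe_toFinset]
    exact fun h0 => hk (by simp [h0])

theorem fiberOp_star {S : 𝒢.Sub} (π : URep S.El) (f f' : C_c(𝒢.SigmaArr, ℂ))
    (hf : ∀ σ, f' σ = star (f (𝒢.sigmaGpd.inv σ))) : fiberOp π f' = star (fiberOp π f) := by
  classical
  rw [fiberOp_eq_sum π f (finite_fiber f S).toFinset (by simp), star_sum]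
  have h : fiberOp π f' = ∑ᶠ g : S.El, f' (sigmaPt S g⁻¹) • (π.op g⁻¹ : π.H →L[ℂ] π.H) :=
    (finsum_comp_equiv (Equiv.inv S.El)).symm
  have h2 : ∀ g : S.El, f' (sigmaPt S g⁻¹) • (π.op g⁻¹ : π.H →L[ℂ] π.H) =
      star (f (sigmaPt S g) • (π.op g : π.H →L[ℂ] π.H)) := by
    intro g
    have e : 𝒢.sigmaGpd.inv (sigmaPt S g⁻¹) = sigmaPt S g :=
      congrArg (sigmaPt S) (_root_.inv_inv g)
    rw [hf, e, star_smul, map_inv]; rfl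
  simp only [h2] at h
  rw [h]
  refine finsum_eq_sum_of_support_subset _ fun g hg => ?_
  simp only [Set.Finite.coe_toFinset]
  exact fun h0 => hg (by simp [h0])

/-- The representation of `C_c(Σ(𝒢))` given by restriction to the fiber `S` and `π`. -/
def fiberRep (S : 𝒢.Sub) (π : URep S.El) : 𝒢.sigmaGpd.Rep where
  H := π.H
  op :=
    { toFun := fun f => fiberOp π f
      map_add' := fun f₁ f₂ => by
        classical
        rw [fiberOp_eq_sum π f₁ ((finite_fiber f₁ S).union (finite_fiber f₂ S)).toFinset
            (fun g h => by simp only [Set.Finite.mem_toFinset]; exact Or.inl h),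
          fiberOp_eq_sum π f₂ ((finite_fiber f₁ S).union (finite_fiber f₂ S)).toFinset
            (fun g h => by simp only [Set.Finite.mem_toFinset]; exact Or.inr h),
          fiberOp_eq_sum π (f₁ + f₂) ((finite_fiber f₁ S).union (finite_fiber f₂ S)).toFinset ?_,
          ← Finset.sum_add_distrib]
        · exact Finset.sum_congr rfl fun g _ => by simp [add_smul]
        · intro g h
          simp only [Set.Finite.mem_toFinset]
          by_contra h0
          simp only [Set.mem_union, Set.mem_ofPred_eq, not_or, not_not] at h0
          exact h (by simp [h0.1, h0.2])
      map_smul' := fun a f => by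
        rw [RingHom.id_apply, fiberOp_eq_sum π f (finite_fiber f S).toFinset (by simp),
          fiberOp_eq_sum π (a • f) (finite_fiber f S).toFinset
            (fun g h => by
              simp only [Set.Finite.mem_toFinset, Set.mem_ofPred_eq]
              exact fun h0 => h (by simp [h0])), Finset.smul_sum]
        exact Finset.sum_congr rfl fun g _ => by simp [smul_smul] }
  op_conv f₁ f₂ f hf := fiberOp_conv π f₁ f₂ f hf
  op_star f f' hf := fiberOp_star π f f' hf

/-- Restriction to the fiber, `C⋆(Σ(𝒢)) → C⋆(S)`; a function `f` goes to `∑ f(S, g) g`. -/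
def fiberHom (S : 𝒢.Sub) : 𝒢.sigmaGpd.CStar →⋆ₙₐ[ℂ] GroupCStar S.El :=
  GenCStar.pull (fun ρ : 𝒢.sigmaGpd.Rep => ρ.H) (fun π : URep S.El => fiberRep S π) _ _ (by
    rintro a ⟨f, hf⟩
    have : OpFamily.pull (fun ρ : 𝒢.sigmaGpd.Rep => ρ.H) (fun π : URep S.El => fiberRep S π) a =
        ∑ g ∈ (finite_fiber f S).toFinset, f (sigmaPt S g) • GroupCStar.gen g := by
      refine Subtype.ext (funext fun π => ?_)
      refine (hf _).trans ((fiberOp_eq_sum π f (finite_fiber f S).toFinset (by simp)).trans ?_)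
      let ev : OpFamily (fun π : URep S.El => π.H) →+ (π.H →L[ℂ] π.H) :=
        { toFun := fun a => a π, map_zero' := rfl, map_add' := fun _ _ => rfl }
      exact (map_sum ev (fun g => f (sigmaPt S g) • GroupCStar.gen g) _).symm
    rw [this]
    exact sum_mem fun g _ => SMulMemClass.smul_mem _ (GroupCStar.gen_mem g))

end

/-! ### Pairs of subgroups and primitive ideals -/

variable (𝒢)

/-- The space `Sub(𝒢)^prim` of pairs `(S, J)`, with `S` a subgroup of `𝒢` and `J` a primitive ideal
of `C⋆(S)`. -/
structure SubPrim where
  grp : 𝒢.Sub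
  ideal : Prim.{u + 1, u} (GroupCStar grp.El)

/-- The space `Stab(𝒢)^prim` of pairs `(x, J)`, with `x` a unit and `J` a primitive ideal of the
C⋆-algebra of the isotropy group at `x`. -/
structure StabPrim where
  unit : X
  ideal : Prim.{u + 1, u} (GroupCStar (𝒢.iso unit).El)

variable {𝒢}

/-- The inclusion of `Stab(𝒢)^prim` into `Sub(𝒢)^prim`. -/
def StabPrim.toSubPrim (p : 𝒢.StabPrim) : 𝒢.SubPrim := ⟨𝒢.iso p.unit, p.ideal⟩

/-- Points of `Stab(𝒢)^prim` in the same `𝒢`-orbit: `q = g p` for some arrow `g`, where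
`g (x, J) = (r(g), (Ad g)(J))`. -/
def orbitRel (p q : 𝒢.StabPrim) : Prop :=
  ∃ (g : G) (hs : 𝒢.s g = p.unit) (hr : 𝒢.r g = q.unit),
    GroupCStar.map (𝒢.conj g hs hr) '' (p.ideal.1 : Set (GroupCStar (𝒢.iso p.unit).El)) =
      (q.ideal.1 : Set (GroupCStar (𝒢.iso q.unit).El))

variable (𝒢) in
/-- The quotient space `𝒢 \ Stab(𝒢)^prim`. -/
def OrbitSpace : Type (u + 1) := Quot (orbitRel (𝒢 := 𝒢))

section
variable [TopologicalSpace X] [TopologicalSpace G] [𝒢.IsEtale]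

/-- The topology of `Sub(𝒢)^prim`: it is induced from the Jacobson topology of the primitive ideal
space of `C⋆(Σ(𝒢))` by `(S, J) ↦ ker (π_J ∘ q_S)`, where `q_S = fiberHom S` and `ker π_J = J`. -/
instance : TopologicalSpace 𝒢.SubPrim :=
  .induced (fun p => TwoSidedIdeal.comap (fiberHom p.grp) p.ideal.1) (hullKernel 𝒢.sigmaGpd.CStar)

/-- The relative topology of `Stab(𝒢)^prim` in `Sub(𝒢)^prim`. -/
instance : TopologicalSpace 𝒢.StabPrim := .induced StabPrim.toSubPrim inferInstance

/-- The quotient topology. -/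
instance : TopologicalSpace 𝒢.OrbitSpace :=
  inferInstanceAs (TopologicalSpace (Quot (orbitRel (𝒢 := 𝒢))))

/-- The induced ideal `Ind J = ker (Ind π)`, where `π` is a unitary representation of `S` with kernel
`J` in `C⋆(S)`. All such `π` give the same ideal, so that the infimum is over one ideal. -/
def indIdeal (S : 𝒢.Sub) (J : TwoSidedIdeal (GroupCStar S.El)) : TwoSidedIdeal 𝒢.CStar :=
  sInf {I | ∃ π : URep S.El, TwoSidedIdeal.ker π.extend = J ∧
    I = TwoSidedIdeal.ker (indRep S π).extend}

/-- The induction map on `Stab(𝒢)^prim`. -/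
def StabPrim.ind (p : 𝒢.StabPrim) : TwoSidedIdeal 𝒢.CStar :=
  indIdeal (𝒢.iso p.unit) p.ideal.1

end
end Gpd

end

end EtaleGpd

namespace EtaleGpd

noncomputable section

/-! ### Kernels and ideals of C⋆-algebras -/

section CStar
variable {A : Type v} [NonUnitalCStarAlgebra A]

/-! Everything is read off matrix coefficients. For a representation `π` of a subgroup S at x, let
δ_g v be the vector of the induced space supported on the coset gS with value v at g. For f in
C_c(𝒢) the coefficient of (Ind π)(f) from δ_g to evaluation at h is ∑ f(h t g⁻¹) π(t) over t in S
(`indOp_delta_apply`). By density every a in C⋆(𝒢) has as its (h, g) coefficient the image under π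
of an element of C⋆(S) that does not depend on π (`exists_extend_eq_coeff`). Hence ker Ind π depends
only on ker π, and conjugating π by an arrow merely relabels the coefficients, so induction is
constant on orbits. Primitivity comes from irreducibility of Ind π (`isIrreducible_ind`): cosets of
the full isotropy group are distinguished by their ranges, so functions on the unit space cut a
vector of an invariant subspace down to a single coset.

Continuity (`isOpen_stabPrim`): bisections translate any coefficient to the one at the unit, so an
ideal lies in ker Ind π exactly when the unit coefficients of its elements vanish. For f in C_c(𝒢)
that coefficient is π applied to the restriction to S of the pullback of f to Σ(𝒢) (`coeff_unit`),
and largeness of its norm is an open condition on the kernel (`exists_mem_ker_iff_norm_le`).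

Openness onto the image (`exists_closed_ideal_ind`): continuity of x ↦ 𝒢_x^x makes the isotropy
clopen in 𝒢, so F in C_c(Σ(𝒢)) yields a function in C_c(𝒢) supported on the isotropy. It acts in Ind
π diagonally over 𝒢_x, with entry at g the value of F in the conjugate of π by g
(`indHom_isoCc_apply`). Its norm is therefore the supremum over the orbit, and the induced ideal
detects whether the orbit meets a basic open set. The map from the orbit space is thus inducing, and
an inducing map into a T₀ space descends to an embedding of the T₀ quotient.

Closedness (`isClosed_range_toSubPrim`): subgroups that are not full isotropy groups form an open
subset of the Hausdorff space Sub(𝒢). A function on Σ(𝒢) living over that set and restricting to 1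
in C⋆(S) dies on all isotropy fibers but lies in no primitive ideal over S. -/

theorem starHom_norm_le {B : Type w} [NonUnitalCStarAlgebra B] (π : A →⋆ₙₐ[ℂ] B) (a : A) :
    ‖π a‖ ≤ ‖a‖ :=
  NonUnitalStarAlgHom.norm_apply_le π a

theorem starHom_continuous {B : Type w} [NonUnitalCStarAlgebra B] (π : A →⋆ₙₐ[ℂ] B) :
    Continuous π :=
  AddMonoidHomClass.continuous_of_bound π 1 fun a => by simpa using starHom_norm_le π a

theorem isClosed_ker {B : Type w} [NonUnitalCStarAlgebra B] (π : A →⋆ₙₐ[ℂ] B) :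
    IsClosed (TwoSidedIdeal.ker π : Set A) := by
  have h : (TwoSidedIdeal.ker π : Set A) = π ⁻¹' {0} := by
    ext a; exact TwoSidedIdeal.mem_ker π
  rw [h]; exact isClosed_singleton.preimage (starHom_continuous π)

theorem isClosed_sInf (S : Set (TwoSidedIdeal A)) (h : ∀ I ∈ S, IsClosed (I : Set A)) :
    IsClosed ((sInf S : TwoSidedIdeal A) : Set A) := by
  have e : ((sInf S : TwoSidedIdeal A) : Set A) = ⋂ I ∈ S, (I : Set A) := by
    ext a; simp [TwoSidedIdeal.mem_sInf]
  rw [e]; exact isClosed_biInter h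

theorem IsPrimitive.isClosed {J : TwoSidedIdeal A} (h : IsPrimitive.{v, w} J) :
    IsClosed (J : Set A) := by
  obtain ⟨H, π, -, rfl⟩ := h
  exact isClosed_ker π

/-- The closed ideal generated by an element. -/
def closedIdeal (c : A) : TwoSidedIdeal A := sInf {I | IsClosed (I : Set A) ∧ c ∈ I}

theorem isClosed_closedIdeal (c : A) : IsClosed (closedIdeal c : Set A) :=
  isClosed_sInf _ fun _ h => h.1

theorem closedIdeal_le_iff {c : A} {I : TwoSidedIdeal A} (hI : IsClosed (I : Set A)) :
    closedIdeal c ≤ I ↔ c ∈ I := by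
  refine ⟨fun h => h ?_, fun h => sInf_le ⟨hI, h⟩⟩
  exact (TwoSidedIdeal.mem_sInf A).2 fun J hJ => hJ.2

/-- Lower semicontinuity of the norm: the ideals `ker π` with `‖π b‖ ≤ N` are those containing one
element, the positive part of `b⋆ b - N²`. -/
theorem exists_mem_ker_iff_norm_le (b : A) (N : ℝ) (hN : 0 ≤ N) :
    ∃ c : A, ∀ (H : HilbertSp.{w}) (π : A →⋆ₙₐ[ℂ] (H →L[ℂ] H)), π c = 0 ↔ ‖π b‖ ≤ N := by
  -- Truncation to [-N², N²] on both sides compares y = (π b)⋆(π b) with its truncation using only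
  -- that y is self-adjoint: they agree iff ‖y‖ ≤ N². One c serves all π because functional calculus
  -- commutes with homomorphisms.
  have hg : Continuous fun t : ℝ => t - max (min t (N ^ 2)) (-N ^ 2) := by fun_prop
  have hm : Continuous fun t : ℝ => max (min t (N ^ 2)) (-N ^ 2) := by fun_prop
  have hN2 : 0 ≤ N ^ 2 := sq_nonneg N
  have hm0 : max (min 0 (N ^ 2)) (-N ^ 2) = 0 := by
    rw [min_eq_left hN2, max_eq_left (by linarith)]
  refine ⟨cfcₙ (fun t : ℝ => t - max (min t (N ^ 2)) (-N ^ 2)) (star b * b), fun H π => ?_⟩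
  rw [NonUnitalStarAlgHomClass.map_cfcₙ (S := ℂ) π _ _ hg.continuousOn (by simp [hm0])
    (starHom_continuous π) (IsSelfAdjoint.star_mul_self b) (by
      rw [map_mul, map_star]; exact IsSelfAdjoint.star_mul_self _)]
  rw [map_mul, map_star]
  have hn : ‖star (π b) * π b‖ = ‖π b‖ ^ 2 := by rw [CStarRing.norm_star_mul_self, sq]
  have hsa : IsSelfAdjoint (star (π b) * π b) := IsSelfAdjoint.star_mul_self _
  generalize star (π b) * π b = y at hn hsa
  have key : ‖π b‖ ≤ N ↔ ‖y‖ ≤ N ^ 2 := by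
    rw [hn]; exact (pow_le_pow_iff_left₀ (norm_nonneg _) hN two_ne_zero).symm
  rw [key]
  constructor
  · intro h
    rw [cfcₙ_sub (fun t : ℝ => t) _ y (continuousOn_id) rfl hm.continuousOn hm0, sub_eq_zero,
      cfcₙ_id' ℝ y] at h
    rw [h]
    refine norm_cfcₙ_le fun t _ => ?_
    rw [Real.norm_eq_abs, abs_le]
    exact ⟨le_max_right _ _, max_le (min_le_right _ _) (by linarith)⟩
  · intro h
    rw [← cfcₙ_zero (R := ℝ) y]
    refine cfcₙ_congr fun t ht => ?_
    have h1 : ‖t‖ ≤ N ^ 2 := by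
      have h2 := norm_apply_le_norm_cfcₙ (fun t : ℝ => t) y ht
      rw [cfcₙ_id' ℝ y] at h2
      exact h2.trans h
    rw [Real.norm_eq_abs, abs_le] at h1
    simp only [Pi.zero_apply]
    rw [min_eq_left h1.2, max_eq_left (by linarith [h1.1]), sub_self]

/-- The vectors killed by all operators form a closed invariant subspace, and it is not the whole
space because π is nonzero. -/
theorem IsIrreducible.eq_zero_of_forall {H : HilbertSp.{w}} {π : A →⋆ₙₐ[ℂ] (H →L[ℂ] H)}
    (hπ : IsIrreducible π) {ξ : H} (h : ∀ a, π a ξ = 0) : ξ = 0 := by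
  let K : Submodule ℂ H := ⨅ a, LinearMap.ker (π a : H →ₗ[ℂ] H)
  have hK : ∀ η, η ∈ K ↔ ∀ a, π a η = 0 := fun η => by simp [K]
  have hc : IsClosed (K : Set H) := by
    have : (K : Set H) = ⋂ a, (π a) ⁻¹' {0} := by ext η; simp [hK]
    rw [this]
    exact isClosed_iInter fun a => isClosed_singleton.preimage (π a).continuous
  rcases hπ.2 K hc (fun a η hη => by rw [(hK η).1 hη a]; exact K.zero_mem) with h0 | h0
  · exact (Submodule.mem_bot ℂ).1 (h0 ▸ (hK ξ).2 h)
  · obtain ⟨a, ha⟩ := hπ.1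
    exact absurd (ContinuousLinearMap.ext fun η => (hK η).1 (h0 ▸ Submodule.mem_top) a) ha

/-- The kernel of an irreducible representation is prime. -/
theorem IsIrreducible.exists_mul_ne_zero {H : HilbertSp.{w}} {π : A →⋆ₙₐ[ℂ] (H →L[ℂ] H)}
    (hπ : IsIrreducible π) {a b : A} (ha : π a ≠ 0) (hb : π b ≠ 0) :
    ∃ c, π (a * (c * b)) ≠ 0 := by
  by_contra! hcon
  obtain ⟨ξ, hξ⟩ : ∃ ξ, π b ξ ≠ 0 := by
    by_contra! h; exact hb (ContinuousLinearMap.ext h)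
  -- The vectors killed by all π(a c) form a closed invariant subspace. It contains π(b)ξ ≠ 0, hence
  -- is everything, and then π(a a⋆) = 0 forces π(a) = 0.
  let K : Submodule ℂ H := ⨅ c, LinearMap.ker (π (a * c) : H →ₗ[ℂ] H)
  have hK : ∀ η, η ∈ K ↔ ∀ c, π (a * c) η = 0 := fun η => by simp [K]
  have hc : IsClosed (K : Set H) := by
    have : (K : Set H) = ⋂ c, (π (a * c)) ⁻¹' {0} := by ext η; simp [hK]
    rw [this]
    exact isClosed_iInter fun c => isClosed_singleton.preimage (π (a * c)).continuous
  have hinv : ∀ d, ∀ η ∈ K, π d η ∈ K := fun d η hη => (hK _).2 fun c => by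
    have := (hK η).1 hη (c * d)
    rwa [← mul_assoc, map_mul] at this
  have hmem : π b ξ ∈ K := (hK _).2 fun c => by
    have := congrArg (fun T : H →L[ℂ] H => T ξ) (hcon c)
    rwa [← mul_assoc, map_mul] at this
  rcases hπ.2 K hc hinv with h0 | h0
  · exact hξ ((Submodule.mem_bot ℂ).1 (h0 ▸ hmem))
  · have h1 : π (a * star a) = 0 :=
      ContinuousLinearMap.ext fun η => (hK η).1 (h0 ▸ Submodule.mem_top) (star a)
    refine ha ?_
    rw [← norm_eq_zero, ← sq_eq_zero_iff, sq, ← CStarRing.norm_self_mul_star, ← map_star,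
      ← map_mul, h1, norm_zero]

/-- On kernels of irreducible representations, the subbasis of the hull-kernel topology is a
basis. -/
theorem exists_closed_ideal_of_isOpen {U : Set (TwoSidedIdeal A)}
    (hU : @IsOpen _ (hullKernel A) U) {J : TwoSidedIdeal A} (hJ : IsPrimitive.{v, w} J) (hJU : J ∈ U) :
    ∃ K : TwoSidedIdeal A, IsClosed (K : Set A) ∧ ¬ K ≤ J ∧ ∀ I, ¬ K ≤ I → I ∈ U := by
  obtain ⟨H, π, hπ, rfl⟩ := hJ
  have hle : ∀ K : TwoSidedIdeal A, ¬ K ≤ TwoSidedIdeal.ker π ↔ ∃ a ∈ K, π a ≠ 0 := fun K => by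
    simp only [TwoSidedIdeal.le_iff, Set.not_subset, SetLike.mem_coe, TwoSidedIdeal.mem_ker, ne_eq]
  induction hU with
  | basic V hV =>
    obtain ⟨K, hK, rfl⟩ := hV
    exact ⟨K, hK, hJU, fun I h => h⟩
  | univ =>
    refine ⟨⊤, by simp, ?_, fun _ _ => trivial⟩
    rw [hle]
    obtain ⟨a, ha⟩ := hπ.1
    exact ⟨a, trivial, ha⟩
  | inter V W _ _ hV hW =>
    obtain ⟨K, hK, hKJ, h⟩ := hV hJU.1
    obtain ⟨L, hL, hLJ, h'⟩ := hW hJU.2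
    refine ⟨K ⊓ L, ?_, ?_, fun I hI => ⟨h I fun h0 => hI (inf_le_left.trans h0),
      h' I fun h0 => hI (inf_le_right.trans h0)⟩⟩
    · have : ((K ⊓ L : TwoSidedIdeal A) : Set A) = (K : Set A) ∩ L := by
        ext a; exact TwoSidedIdeal.mem_inf A
      rw [this]; exact hK.inter hL
    · rw [hle] at hKJ hLJ ⊢
      obtain ⟨a, haK, ha⟩ := hKJ
      obtain ⟨b, hbL, hb⟩ := hLJ
      -- Primeness: a c b lies in both ideals and is not killed by π.
      obtain ⟨c, hc⟩ := hπ.exists_mul_ne_zero ha hb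
      exact ⟨_, (TwoSidedIdeal.mem_inf A).2 ⟨K.mul_mem_right _ _ haK,
        L.mul_mem_left _ _ (L.mul_mem_left _ _ hbL)⟩, hc⟩
  | sUnion 𝒱 _ ih =>
    obtain ⟨V, hV, hJV⟩ := hJU
    obtain ⟨K, hK, hKJ, h⟩ := ih V hV hJV
    exact ⟨K, hK, hKJ, fun I hI => ⟨V, hV, h I hI⟩⟩

end CStar

/-! ### Elements of generated C⋆-algebras -/

/-- Evaluation of a family of operators at an index, as a linear map. -/
def OpFamily.coord {ι : Type v} (H : ι → HilbertSp.{u}) (i : ι) : OpFamily H →ₗ[ℂ] (H i →L[ℂ] H i) where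
  toFun a := a i
  map_add' _ _ := rfl
  map_smul' _ _ := rfl

/-- If `X` is stable under products and adjoints, then the C⋆-algebra generated by it is the closed
linear span of `X`. -/
theorem genAlg_subset_of_submodule {ι : Type v} {H : ι → HilbertSp.{u}} {X : Set (OpFamily H)}
    (hmul : ∀ a ∈ X, ∀ b ∈ X, a * b ∈ X) (hstar : ∀ a ∈ X, star a ∈ X)
    (P : Submodule ℂ (OpFamily H)) (hP : IsClosed (P : Set (OpFamily H))) (hX : X ⊆ P) :
    ∀ a ∈ genAlg H X, a ∈ P := by
  let B : NonUnitalStarSubalgebra ℂ (OpFamily H) :=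
    { Submodule.span ℂ X with
      mul_mem' := by
        intro a b ha hb
        change a * b ∈ Submodule.span ℂ X
        induction ha using Submodule.span_induction with
        | mem a ha =>
          induction hb using Submodule.span_induction with
          | mem b hb => exact Submodule.subset_span (hmul a ha b hb)
          | zero => rw [mul_zero]; exact Submodule.zero_mem _
          | add b c _ _ h1 h2 => rw [mul_add]; exact Submodule.add_mem _ h1 h2
          | smul t b _ h1 => rw [mul_smul_comm]; exact Submodule.smul_mem _ _ h1
        | zero => rw [zero_mul]; exact Submodule.zero_mem _
        | add a c _ _ h1 h2 => rw [add_mul]; exact Submodule.add_mem _ h1 h2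
        | smul t a _ h1 => rw [smul_mul_assoc]; exact Submodule.smul_mem _ _ h1
      star_mem' := by
        intro a ha
        change star a ∈ Submodule.span ℂ X
        induction ha using Submodule.span_induction with
        | mem a ha => exact Submodule.subset_span (hstar a ha)
        | zero => rw [star_zero]; exact Submodule.zero_mem _
        | add a c _ _ h1 h2 => rw [star_add]; exact Submodule.add_mem _ h1 h2
        | smul t a _ h1 => rw [star_smul]; exact Submodule.smul_mem _ _ h1 }
  have h1 : NonUnitalStarAlgebra.adjoin ℂ X ≤ B :=
    NonUnitalStarAlgebra.adjoin_le Submodule.subset_span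
  intro a ha
  have h2 : (NonUnitalStarAlgebra.adjoin ℂ X : Set (OpFamily H)) ⊆ P :=
    fun b hb => (Submodule.span_le.2 hX) (h1 hb)
  exact closure_minimal h2 hP ha

/-! ### Compactly supported functions -/

section Cc
variable {Y : Type u} [TopologicalSpace Y]

/-- A function in `C_c(Y)` from a continuous function with compact support. -/
def mkCc (φ : Y → ℂ) (hc : Continuous φ) (hs : HasCompactSupport φ) : C_c(Y, ℂ) := ⟨⟨φ, hc⟩, hs⟩

@[simp] theorem mkCc_apply (φ : Y → ℂ) (hc : Continuous φ) (hs : HasCompactSupport φ) (y : Y) :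
    mkCc φ hc hs y = φ y := rfl

variable [T2Space Y] [LocallyCompactSpace Y]

theorem exists_bump {U : Set Y} (hU : IsOpen U) {y : Y} (hy : y ∈ U) :
    ∃ f : C_c(Y, ℂ), f y = 1 ∧ tsupport f ⊆ U ∧ ∀ z, ‖f z‖ ≤ 1 := by
  obtain ⟨φ, h1, h2, h3, h4⟩ := exists_continuous_sum_one_of_isOpen_isCompact (n := 1)
    (s := fun _ => U) (fun _ => hU) (isCompact_singleton (x := y))
    (fun z hz => Set.mem_iUnion.2 ⟨0, by rwa [Set.mem_singleton_iff.1 hz]⟩)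
  have e : tsupport (fun z => ((φ 0 z : ℝ) : ℂ)) = tsupport (φ 0) := by
    rw [tsupport, tsupport]; congr 1; ext z; simp
  refine ⟨mkCc (fun z => ((φ 0 z : ℝ) : ℂ)) (by fun_prop) ?_, ?_, ?_, fun z => ?_⟩
  · rw [HasCompactSupport, e]; exact h4 0
  · have := h2 (Set.mem_singleton y)
    simp only [Fin.sum_univ_one, Pi.one_apply] at this
    simp [this]
  · exact e.trans_subset (h1 0)
  · have := h3 0 z
    simp only [mkCc_apply, Complex.norm_real, Real.norm_eq_abs, abs_of_nonneg this.1]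
    exact this.2

/-- Additive properties of functions in `C_c(Y)` can be checked on functions with small support. -/
theorem cc_induction {Q : Set Y → Prop} (hQ : ∀ y, ∃ W, IsOpen W ∧ y ∈ W ∧ Q W)
    {P : C_c(Y, ℂ) → Prop} (h0 : P 0) (hadd : ∀ f g, P f → P g → P (f + g))
    (hsmall : ∀ W, ∀ f : C_c(Y, ℂ), Q W → tsupport f ⊆ W → P f) (f : C_c(Y, ℂ)) : P f := by
  classical
  choose W hWo hyW hW using hQ
  obtain ⟨t, ht⟩ := f.hasCompactSupport'.elim_finite_subcover W hWo
    (fun y _ => Set.mem_iUnion.2 ⟨y, hyW y⟩)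
  let e := t.equivFin.symm
  -- A partition of unity on the support of f splits f into summands with small support.
  obtain ⟨φ, h1, h2, -, h4⟩ := exists_continuous_sum_one_of_isOpen_isCompact
    (s := fun i => W (e i)) (fun i => hWo _) f.hasCompactSupport' (by
      intro y hy
      obtain ⟨i, hi, hyi⟩ := Set.mem_iUnion₂.1 (ht hy)
      exact Set.mem_iUnion.2 ⟨e.symm ⟨i, hi⟩, by simpa using hyi⟩)
  let F : Fin t.card → C_c(Y, ℂ) := fun i => mkCc (fun z => (φ i z : ℂ) * f z)
    (by have := f.continuous; fun_prop) (f.hasCompactSupport'.mul_left)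
  have hF : f = ∑ i, F i := by
    ext z
    rw [CompactlySupportedContinuousMap.sum_apply]
    simp only [F, mkCc_apply, ← Finset.sum_mul]
    by_cases hz : z ∈ tsupport f
    · have := h2 hz
      simp only [Finset.sum_apply, Pi.one_apply] at this
      rw [← Complex.ofReal_sum, ← ContinuousMap.sum_apply, ContinuousMap.coe_sum, Finset.sum_apply, this]
      simp
    · rw [image_eq_zero_of_notMem_tsupport hz, mul_zero]
  rw [hF]
  refine Finset.sum_induction _ P hadd h0 fun i _ => hsmall _ _ (hW (e i)) ?_
  refine subset_trans ?_ (h1 i)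
  refine closure_mono fun z hz h => hz ?_
  simp only [F, mkCc_apply]
  rw [show φ i z = 0 from h]; simp

end Cc

/-! ### Convolution and involution on C_c(𝒢) -/

namespace Gpd

section
variable {X G : Type u} {𝒢 : Gpd X G}

/-- Convolution by a function supported on a set on which the range map is injective. -/
theorem conv_eq_of_injOn {W : Set G} (hW : Set.InjOn 𝒢.r W) {f₁ : G → ℂ} (hf : ∀ g, f₁ g ≠ 0 → g ∈ W)
    (f₂ : G → ℂ) {l g : G} (hl : l ∈ W) (e : 𝒢.r l = 𝒢.r g) :
    𝒢.conv f₁ f₂ g = f₁ l * f₂ (𝒢.mul (𝒢.inv l) g) := by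
  rw [conv, finsum_mem_inter_support_eq _ _ {l}, finsum_mem_singleton]
  ext h
  simp only [Set.mem_inter_iff, Set.mem_ofPred_eq, Function.mem_support, Set.mem_singleton_iff]
  refine ⟨fun ⟨h1, h2⟩ => ⟨hW (hf h (left_ne_zero_of_mul h2)) hl (h1.trans e.symm), h2⟩, ?_⟩
  rintro ⟨rfl, h2⟩
  exact ⟨e, h2⟩

theorem conv_eq_zero {f₁ f₂ : G → ℂ} {g : G} (h : ∀ l, f₁ l ≠ 0 → 𝒢.r l ≠ 𝒢.r g) :
    𝒢.conv f₁ f₂ g = 0 := by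
  refine finsum_mem_eq_zero_of_forall_eq_zero fun l hl => ?_
  by_contra h0
  exact h l (left_ne_zero_of_mul h0) hl

theorem exists_of_conv_ne_zero {f₁ f₂ : G → ℂ} {g : G} (h : 𝒢.conv f₁ f₂ g ≠ 0) :
    ∃ l m, f₁ l ≠ 0 ∧ f₂ m ≠ 0 ∧ 𝒢.s l = 𝒢.r m ∧ 𝒢.mul l m = g := by
  obtain ⟨l, hl, hne⟩ := exists_ne_zero_of_finsum_mem_ne_zero h
  have hl' : 𝒢.r l = 𝒢.r g := hl
  refine ⟨l, _, left_ne_zero_of_mul hne, right_ne_zero_of_mul hne, ?_, 𝒢.mul_inv_cancel hl'⟩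
  rw [𝒢.r_mul _ _ (by rw [𝒢.s_inv, hl']), 𝒢.r_inv]

variable [TopologicalSpace G]

variable (𝒢) in
/-- Open bisections. -/
structure IsBisection (W : Set G) : Prop where
  isOpen : IsOpen W
  injOn_r : Set.InjOn 𝒢.r W
  injOn_s : Set.InjOn 𝒢.s W

end

section
variable {X G : Type u} (𝒢 : Gpd X G) [TopologicalSpace X] [TopologicalSpace G] [𝒢.IsEtale]

theorem continuous_r : Continuous 𝒢.r := (IsEtale.isLocalHomeomorph_r (𝒢 := 𝒢)).continuous

theorem t2_units (𝒢 : Gpd X G) [𝒢.IsEtale] [T2Space G] : T2Space X :=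
  T2Space.of_injective_continuous (f := 𝒢.unit) (fun x y h => by
    rw [← 𝒢.r_unit x, h, 𝒢.r_unit]) (IsEtale.continuous_unit (𝒢 := 𝒢))

theorem exists_bisection (g : G) : ∃ W, IsOpen W ∧ g ∈ W ∧ 𝒢.IsBisection W := by
  obtain ⟨U, hU, hi⟩ := r_locInj 𝒢 g
  obtain ⟨V, hV, hj⟩ := s_locInj 𝒢 g
  refine ⟨interior (U ∩ V), isOpen_interior, mem_interior_iff_mem_nhds.2 (Filter.inter_mem hU hV),
    isOpen_interior, hi.mono (interior_subset.trans Set.inter_subset_left),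
    hj.mono (interior_subset.trans Set.inter_subset_right)⟩

theorem conv_add_left (f₁ f₁' : C_c(G, ℂ)) (f₂ : G → ℂ) (g : G) :
    𝒢.conv (f₁ + f₁' : C_c(G, ℂ)) f₂ g = 𝒢.conv f₁ f₂ g + 𝒢.conv f₁' f₂ g := by
  rw [conv, conv, conv, ← finsum_mem_add_distrib']
  · exact finsum_mem_congr rfl fun h _ => by simp [add_mul]
  · exact (finite_r 𝒢 f₁ (𝒢.r g)).subset fun h hh => ⟨fun h0 => hh.2 (by simp [h0]), hh.1⟩
  · exact (finite_r 𝒢 f₁' (𝒢.r g)).subset fun h hh => ⟨fun h0 => hh.2 (by simp [h0]), hh.1⟩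

variable {𝒢} in
-- The range map has a continuous local section σ with values in W, so near g the convolution is the
-- single term f₁(σ(r g)) f₂(σ(r g)⁻¹ g).
theorem IsBisection.continuousAt_conv {W : Set G} (hW : 𝒢.IsBisection W) {f₁ f₂ : G → ℂ}
    (h₁ : Continuous f₁) (h₂ : Continuous f₂) (hf : ∀ g, f₁ g ≠ 0 → g ∈ W) {l g : G} (hl : l ∈ W)
    (e : 𝒢.r l = 𝒢.r g) : ContinuousAt (𝒢.conv f₁ f₂) g := by
  have hop : IsOpenMap 𝒢.r := (IsEtale.isLocalHomeomorph_r (𝒢 := 𝒢)).isOpenMap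
  have : Nonempty G := ⟨l⟩
  let σ := Function.invFunOn 𝒢.r W
  have hσ : ∀ l ∈ W, σ (𝒢.r l) = l := fun l hl => hW.injOn_r.leftInvOn_invFunOn hl
  have hσc : ContinuousAt σ (𝒢.r l) := by
    refine Filter.tendsto_def.2 fun V hV => ?_
    rw [hσ l hl] at hV
    refine Filter.mem_of_superset (hop.image_mem_nhds
      (Filter.inter_mem hV (hW.isOpen.mem_nhds hl))) ?_
    rintro _ ⟨m, ⟨hm, hmW⟩, rfl⟩
    change σ (𝒢.r m) ∈ V
    rwa [hσ m hmW]
  have hσr : ContinuousAt (fun g => σ (𝒢.r g)) g :=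
    ContinuousAt.comp (f := 𝒢.r) (g := σ) (by rwa [← e]) (continuous_r 𝒢).continuousAt
  have hev : ∀ᶠ g' in nhds g, ∃ m ∈ W, 𝒢.r m = 𝒢.r g' := by
    have : 𝒢.r '' W ∈ nhds (𝒢.r g) := by
      rw [← e]; exact hop.image_mem_nhds (hW.isOpen.mem_nhds hl)
    exact (continuous_r 𝒢).continuousAt this
  have heq : (fun g => f₁ (σ (𝒢.r g)) * f₂ (𝒢.mul (𝒢.inv (σ (𝒢.r g))) g)) =ᶠ[nhds g]
      𝒢.conv f₁ f₂ := by
    filter_upwards [hev] with g' ⟨m, hm, hme⟩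
    rw [← hme, hσ m hm, conv_eq_of_injOn hW.injOn_r hf f₂ hm hme]
  refine ContinuousAt.congr ?_ heq
  refine (h₁.continuousAt.comp hσr).mul (h₂.continuousAt.comp ?_)
  have hm := IsEtale.continuousOn_mul (𝒢 := 𝒢)
  have hp : Filter.Tendsto (fun g => ((𝒢.inv (σ (𝒢.r g)), g) : G × G)) (nhds g)
      (nhdsWithin (𝒢.inv (σ (𝒢.r g)), g) {p | 𝒢.s p.1 = 𝒢.r p.2}) := by
    refine tendsto_nhdsWithin_iff.2 ⟨?_, ?_⟩
    · exact ((IsEtale.continuous_inv (𝒢 := 𝒢)).continuousAt.comp hσr).prodMk continuousAt_id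
    · filter_upwards [hev] with g' ⟨m, hm, hme⟩
      change 𝒢.s (𝒢.inv (σ (𝒢.r g'))) = 𝒢.r g'
      rw [𝒢.s_inv, ← hme, hσ m hm]
  refine (hm _ ?_).tendsto.comp hp
  change 𝒢.s (𝒢.inv (σ (𝒢.r g))) = 𝒢.r g
  rw [𝒢.s_inv, ← e, hσ l hl]

variable [T2Space G]

/-- The unit space is Hausdorff, so composable pairs form a closed set, and the product set is the
continuous image of a compact one. -/
theorem isCompact_mul {K L : Set G} (hK : IsCompact K) (hL : IsCompact L) :
    IsCompact {g | ∃ l ∈ K, ∃ m ∈ L, 𝒢.s l = 𝒢.r m ∧ 𝒢.mul l m = g} := by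
  have := t2_units 𝒢
  have hc : IsClosed {p : G × G | 𝒢.s p.1 = 𝒢.r p.2} :=
    isClosed_eq ((IsEtale.continuous_s (𝒢 := 𝒢)).comp continuous_fst)
      ((continuous_r 𝒢).comp continuous_snd)
  have h := ((hK.prod hL).inter_right hc).image_of_continuousOn
    ((IsEtale.continuousOn_mul (𝒢 := 𝒢)).mono Set.inter_subset_right)
  convert h using 1
  ext g
  constructor
  · rintro ⟨l, hl, m, hm, e, rfl⟩
    exact ⟨(l, m), ⟨⟨hl, hm⟩, e⟩, rfl⟩
  · rintro ⟨⟨l, m⟩, ⟨⟨hl, hm⟩, e⟩, rfl⟩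
    exact ⟨l, hl, m, hm, e, rfl⟩

theorem hasCompactSupport_conv (f₁ f₂ : C_c(G, ℂ)) : HasCompactSupport (𝒢.conv f₁ f₂) := by
  refine HasCompactSupport.of_support_subset_isCompact
    (isCompact_mul 𝒢 f₁.hasCompactSupport' f₂.hasCompactSupport') fun g hg => ?_
  obtain ⟨l, m, hl, hm, e, h⟩ := exists_of_conv_ne_zero hg
  exact ⟨l, subset_tsupport _ hl, m, subset_tsupport _ hm, e, h⟩

theorem hasCompactSupport_star (f : C_c(G, ℂ)) :
    HasCompactSupport fun g => star (f (𝒢.inv g)) := by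
  refine HasCompactSupport.of_support_subset_isCompact
    (f.hasCompactSupport'.image (IsEtale.continuous_inv (𝒢 := 𝒢))) fun g hg => ?_
  refine ⟨𝒢.inv g, subset_tsupport _ fun h => hg ?_, 𝒢.inv_inv g⟩
  change star (f (𝒢.inv g)) = 0
  rw [show f (𝒢.inv g) = 0 from h, star_zero]

variable [LocallyCompactSpace G]

/-- By additivity in f₁ one may assume that f₁ is supported in a bisection. Where r(g) lies off the
range image of the support, which is compact and hence closed, the convolution vanishes in a
neighbourhood. -/
theorem continuous_conv (f₁ f₂ : C_c(G, ℂ)) : Continuous (𝒢.conv f₁ f₂) := by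
  have := t2_units 𝒢
  refine cc_induction (P := fun f₁ => Continuous (𝒢.conv f₁ f₂)) (exists_bisection 𝒢) ?_ ?_ ?_ f₁
  · have : 𝒢.conv (0 : C_c(G, ℂ)) f₂ = fun _ => 0 := funext fun g => by simp [conv]
    rw [this]; exact continuous_const
  · intro f f' h h'
    have : 𝒢.conv (f + f' : C_c(G, ℂ)) f₂ = fun g => 𝒢.conv f f₂ g + 𝒢.conv f' f₂ g :=
      funext (conv_add_left 𝒢 f f' f₂)
    rw [this]; exact h.add h'
  · intro W f hW hf
    refine continuous_iff_continuousAt.2 fun g => ?_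
    by_cases hg : ∃ l ∈ tsupport f, 𝒢.r l = 𝒢.r g
    · obtain ⟨l, hl, e⟩ := hg
      exact hW.continuousAt_conv f.continuous f₂.continuous
        (fun g hg => hf (subset_tsupport _ hg)) (hf hl) e
    · have hcl : IsClosed (𝒢.r '' tsupport f) :=
        (f.hasCompactSupport'.image (continuous_r 𝒢)).isClosed
      have hev : ∀ᶠ g' in nhds g, 𝒢.r g' ∈ (𝒢.r '' tsupport f)ᶜ :=
        (continuous_r 𝒢).continuousAt (hcl.isOpen_compl.mem_nhds fun ⟨l, hl, e⟩ => hg ⟨l, hl, e⟩)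
      refine (continuousAt_const (y := (0 : ℂ))).congr ?_
      filter_upwards [hev] with g' hg'
      exact (conv_eq_zero fun l hl e => hg' ⟨l, subset_tsupport _ hl, e⟩).symm

/-- Convolution as an operation on `C_c(𝒢)`. -/
def convCc (f₁ f₂ : C_c(G, ℂ)) : C_c(G, ℂ) :=
  mkCc (𝒢.conv f₁ f₂) (continuous_conv 𝒢 f₁ f₂) (hasCompactSupport_conv 𝒢 f₁ f₂)

end

end Gpd

namespace Gpd

/-! ### Norm bounds for representations and the canonical map `C_c(𝒢) → C⋆(𝒢)` -/

section
variable {X G : Type u} {𝒢 : Gpd X G}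

theorem inv_unit (x : X) : 𝒢.inv (𝒢.unit x) = 𝒢.unit x := by
  refine (𝒢.eq_inv_of_mul (by rw [𝒢.s_unit, 𝒢.r_unit]) ?_).symm
  have := 𝒢.unit_mul (𝒢.unit x)
  rwa [𝒢.r_unit] at this ⊢

/-- Only h = r(g) contributes: functions on the units act by pointwise multiplication. A
representation is therefore multiplicative on them for the pointwise product. -/
theorem conv_of_units {φ : G → ℂ} (hφ : ∀ g, φ g ≠ 0 → g = 𝒢.unit (𝒢.r g)) (ψ : G → ℂ) (g : G) :
    𝒢.conv φ ψ g = φ (𝒢.unit (𝒢.r g)) * ψ g := by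
  have hi : Set.InjOn 𝒢.r (Set.range 𝒢.unit) := by
    rintro _ ⟨x, rfl⟩ _ ⟨y, rfl⟩ h
    rw [𝒢.r_unit, 𝒢.r_unit] at h; rw [h]
  rw [conv_eq_of_injOn hi (fun g hg => ⟨_, (hφ g hg).symm⟩) ψ (Set.mem_range_self (𝒢.r g))
    (𝒢.r_unit _), inv_unit, 𝒢.unit_mul]

end

section
variable {X G : Type u} {𝒢 : Gpd X G} [TopologicalSpace G]

theorem op_mul_of_units (ρ : 𝒢.Rep) {φ ψ : C_c(G, ℂ)} (hφ : ∀ g, φ g ≠ 0 → g = 𝒢.unit (𝒢.r g))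
    (hψ : ∀ g, ψ g ≠ 0 → g = 𝒢.unit (𝒢.r g)) : ρ.op (φ * ψ) = ρ.op φ * ρ.op ψ := by
  refine ρ.op_conv φ ψ _ fun g => ?_
  rw [conv_of_units hφ, CompactlySupportedContinuousMap.mul_apply]
  by_cases h : ψ g = 0
  · rw [h, mul_zero, mul_zero]
  · rw [← hψ g h]

/-- With θ = √(φ - φ²) and T = ρ(φ), one has T - T² = ρ(θ)² ≥ 0, so ‖Tξ‖² ≤ ⟨Tξ, ξ⟩ ≤ ‖Tξ‖‖ξ‖. This
stays inside C_c(𝒢), where no unit is available. -/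
theorem norm_op_le_one_of_units (ρ : 𝒢.Rep) {φ : C_c(G, ℂ)}
    (hφ : ∀ g, φ g ≠ 0 → g = 𝒢.unit (𝒢.r g)) {t : G → ℝ} (ht : ∀ g, φ g = t g)
    (h0 : ∀ g, 0 ≤ t g) (h1 : ∀ g, t g ≤ 1) : ‖ρ.op φ‖ ≤ 1 := by
  have htc : Continuous t := by
    have : t = fun g => (φ g).re := funext fun g => by rw [ht, Complex.ofReal_re]
    rw [this]; exact Complex.continuous_re.comp φ.continuous
  have hs : ∀ (ψ : C_c(G, ℂ)) (s : G → ℝ), (∀ g, ψ g ≠ 0 → g = 𝒢.unit (𝒢.r g)) →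
      (∀ g, ψ g = s g) → star (ρ.op ψ) = ρ.op ψ := by
    intro ψ s hψ hs
    refine (ρ.op_star ψ ψ fun g => ?_).symm
    have hr : star (ψ (𝒢.inv g)) = ψ (𝒢.inv g) := by rw [hs]; exact Complex.conj_ofReal _
    rw [hr]
    by_cases h : ψ g = 0
    · by_cases h' : ψ (𝒢.inv g) = 0
      · rw [h, h']
      · have := hψ _ h'
        rw [← 𝒢.inv_inv g, this, inv_unit, inv_unit]
    · rw [hψ g h, inv_unit]
  -- Taking φ - φ² rather than 1 - φ² keeps the support compact.
  let θ : C_c(G, ℂ) := mkCc (fun g => ((Real.sqrt (t g - t g ^ 2) : ℝ) : ℂ)) (by fun_prop) (by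
    refine φ.hasCompactSupport'.mono fun g hg h => hg ?_
    have : t g = 0 := by
      have h' : φ g = 0 := h
      rw [ht] at h'; exact_mod_cast h'
    simp [this])
  have hθ : ∀ g, θ g ≠ 0 → g = 𝒢.unit (𝒢.r g) := fun g hg => hφ g fun h => hg (by
    have : t g = 0 := by rw [ht] at h; exact_mod_cast h
    simp [θ, this])
  have e : θ * θ = φ - φ * φ := by
    ext g
    simp only [CompactlySupportedContinuousMap.mul_apply, CompactlySupportedContinuousMap.sub_apply,
      ht, θ, mkCc_apply]
    rw [← Complex.ofReal_mul, Real.mul_self_sqrt (by nlinarith [h0 g, h1 g])]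
    push_cast; ring
  have e2 : ρ.op θ * ρ.op θ = ρ.op φ - ρ.op φ * ρ.op φ := by
    rw [← op_mul_of_units ρ hθ hθ, e, map_sub, op_mul_of_units ρ hφ hφ]
  have a1 := hs φ t hφ ht
  have a2 := hs θ _ hθ (fun g => rfl)
  refine ContinuousLinearMap.opNorm_le_bound _ zero_le_one fun ξ => ?_
  rw [one_mul]
  have sq1 : ∀ T : ρ.H →L[ℂ] ρ.H, star T = T → ⟪(T * T) ξ, ξ⟫_ℂ = (‖T ξ‖ : ℂ) ^ 2 := by
    intro T hT
    refine Eq.trans ?_ (inner_self_eq_norm_sq_to_K (𝕜 := ℂ) (T ξ))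
    rw [← ContinuousLinearMap.adjoint_inner_left]
    change _ = ⟪(star T) (T ξ), ξ⟫_ℂ
    rw [hT]; rfl
  have h2 := sq1 _ a2
  rw [e2, _root_.sub_apply, inner_sub_left, sq1 _ a1] at h2
  have h3 : (⟪ρ.op φ ξ, ξ⟫_ℂ).re = ‖ρ.op φ ξ‖ ^ 2 + ‖ρ.op θ ξ‖ ^ 2 := by
    have := congrArg Complex.re h2
    rw [Complex.sub_re] at this
    norm_cast at this
    linarith
  have h4 : (⟪ρ.op φ ξ, ξ⟫_ℂ).re ≤ ‖ρ.op φ ξ‖ * ‖ξ‖ :=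
    (Complex.re_le_norm _).trans (norm_inner_le_norm _ _)
  by_contra! h5
  nlinarith [sq_nonneg ‖ρ.op θ ξ‖, norm_nonneg ξ]

end

section
variable {X G : Type u} (𝒢 : Gpd X G) [TopologicalSpace X] [TopologicalSpace G] [𝒢.IsEtale]
variable [T2Space G]

/-- The involution of `C_c(𝒢)`. -/
def starCc (f : C_c(G, ℂ)) : C_c(G, ℂ) :=
  mkCc (fun g => star (f (𝒢.inv g)))
    (continuous_star.comp (f.continuous.comp (IsEtale.continuous_inv (𝒢 := 𝒢))))
    (hasCompactSupport_star 𝒢 f)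

variable {𝒢} in
theorem op_starCc (ρ : 𝒢.Rep) (f : C_c(G, ℂ)) : ρ.op (𝒢.starCc f) = star (ρ.op f) :=
  ρ.op_star f _ fun _ => rfl

variable [LocallyCompactSpace G]

variable {𝒢} in
theorem op_convCc (ρ : 𝒢.Rep) (f₁ f₂ : C_c(G, ℂ)) :
    ρ.op (𝒢.convCc f₁ f₂) = ρ.op f₁ * ρ.op f₂ :=
  ρ.op_conv f₁ f₂ _ fun _ => rfl

variable {𝒢} in
-- For a bisection, f⋆ * f is supported on units and its nonzero values have the form |f(m)|², so
-- the bound for functions on units controls ‖ρ(f)‖² = ‖ρ(f⋆ * f)‖.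
theorem IsBisection.norm_op_le {W : Set G} (hW : 𝒢.IsBisection W) (ρ : 𝒢.Rep) {f : C_c(G, ℂ)}
    (hf : tsupport f ⊆ W) {M : ℝ} (hM : 0 < M) (hfM : ∀ g, ‖f g‖ ≤ M) : ‖ρ.op f‖ ≤ M := by
  have hfW : ∀ g, f g ≠ 0 → g ∈ W := fun g hg => hf (subset_tsupport _ hg)
  have key : ∀ g, 𝒢.conv (𝒢.starCc f) f g ≠ 0 → g = 𝒢.unit (𝒢.r g) ∧
      ∃ m, 𝒢.conv (𝒢.starCc f) f g = ((‖f m‖ ^ 2 : ℝ) : ℂ) := by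
    intro g hg
    obtain ⟨l, m, hl, hm, e, rfl⟩ := exists_of_conv_ne_zero hg
    have hl' : 𝒢.inv l ∈ W := hfW _ fun h => hl (by simp [starCc, h])
    have hlm : 𝒢.inv l = m := hW.injOn_r hl' (hfW m hm) (by rw [𝒢.r_inv, e])
    subst hlm
    refine ⟨by rw [𝒢.mul_inv, 𝒢.r_unit], 𝒢.inv l, ?_⟩
    have hi : Set.InjOn 𝒢.r (𝒢.inv ⁻¹' W) := fun a ha b hb h => by
      rw [← 𝒢.inv_inv a, ← 𝒢.inv_inv b, hW.injOn_s ha hb (by rw [𝒢.s_inv, 𝒢.s_inv, h])]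
    rw [conv_eq_of_injOn hi (fun g hg => hfW _ fun h => hg (by simp [starCc, h])) f
      (show l ∈ 𝒢.inv ⁻¹' W from hl') (by rw [𝒢.r_mul _ _ e]), 𝒢.inv_mul_cancel e]
    simp only [starCc, mkCc_apply]
    rw [← Complex.normSq_eq_norm_sq]
    exact Complex.normSq_eq_conj_mul_self.symm
  have hM2 : 0 < M ^ 2 := by positivity
  -- Rescaling by M⁻² brings the values into [0, 1].
  have hb : ‖ρ.op (((M ^ 2 : ℝ) : ℂ)⁻¹ • 𝒢.convCc (𝒢.starCc f) f)‖ ≤ 1 := by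
    refine norm_op_le_one_of_units ρ (t := fun g => (M ^ 2)⁻¹ * (𝒢.conv (𝒢.starCc f) f g).re)
      (fun g hg => (key g fun h => hg ?_).1) (fun g => ?_) (fun g => ?_) (fun g => ?_)
    · simp [convCc, h]
    · rw [CompactlySupportedContinuousMap.smul_apply, convCc, mkCc_apply]
      by_cases h : 𝒢.conv (𝒢.starCc f) f g = 0
      · simp [h]
      · obtain ⟨m, hm⟩ := (key g h).2
        rw [hm, Complex.ofReal_re, smul_eq_mul, ← Complex.ofReal_inv, ← Complex.ofReal_mul]
    · by_cases h : 𝒢.conv (𝒢.starCc f) f g = 0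
      · simp [h]
      · obtain ⟨m, hm⟩ := (key g h).2
        simp only [hm, Complex.ofReal_re]; positivity
    · by_cases h : 𝒢.conv (𝒢.starCc f) f g = 0
      · simp [h]
      · obtain ⟨m, hm⟩ := (key g h).2
        simp only [hm, Complex.ofReal_re]
        rw [inv_mul_le_one₀ hM2]
        exact pow_le_pow_left₀ (norm_nonneg _) (hfM m) 2
  rw [map_smul, norm_smul, op_convCc, op_starCc, CStarRing.norm_star_mul_self, norm_inv,
    Complex.norm_real, Real.norm_of_nonneg hM2.le, inv_mul_le_one₀ hM2, ← sq] at hb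
  exact (pow_le_pow_iff_left₀ (norm_nonneg _) hM.le two_ne_zero).1 hb

/-- f is a finite sum of functions supported in bisections, each bounded in every representation by
a constant depending on the function alone. Uniformity in ρ is what makes the family of all ρ(f) an
element of `OpFamily`. -/
theorem exists_op_bound (f : C_c(G, ℂ)) : ∃ C : ℝ, ∀ ρ : 𝒢.Rep, ‖ρ.op f‖ ≤ C := by
  refine cc_induction (P := fun f => ∃ C : ℝ, ∀ ρ : 𝒢.Rep, ‖ρ.op f‖ ≤ C) (exists_bisection 𝒢)
    ⟨0, fun ρ => by simp⟩ ?_ ?_ f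
  · rintro f g ⟨C, hC⟩ ⟨D, hD⟩
    refine ⟨C + D, fun ρ => ?_⟩
    rw [map_add]
    exact (norm_add_le _ _).trans (add_le_add (hC ρ) (hD ρ))
  · intro W f hW hf
    obtain ⟨C, hC0, hC⟩ := exists_norm_bound f
    -- The bisection estimate divides by its constant, so C is enlarged to be positive.
    exact ⟨C + 1, fun ρ => hW.norm_op_le ρ hf (by positivity) fun g => (hC g).trans (by linarith)⟩

/-- The family of operators `ρ(f)`. -/
def ccFamily : C_c(G, ℂ) →ₗ[ℂ] OpFamily (fun ρ : 𝒢.Rep => ρ.H) where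
  toFun f := OpFamily.mk (fun ρ => ρ.op f) (exists_op_bound 𝒢 f).choose
    (exists_op_bound 𝒢 f).choose_spec
  map_add' f g := Subtype.ext (funext fun ρ => map_add ρ.op f g)
  map_smul' c f := Subtype.ext (funext fun ρ => map_smul ρ.op c f)

theorem range_ccFamily : Set.range (ccFamily 𝒢) = {a | ∃ f : C_c(G, ℂ), ∀ ρ : 𝒢.Rep, a ρ = ρ.op f} := by
  ext a
  refine ⟨?_, ?_⟩
  · rintro ⟨f, rfl⟩; exact ⟨f, fun _ => rfl⟩
  · rintro ⟨f, hf⟩; exact ⟨f, Subtype.ext (funext fun ρ => (hf ρ).symm)⟩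

/-- The canonical map `C_c(𝒢) → C⋆(𝒢)`. -/
def toCStar (f : C_c(G, ℂ)) : 𝒢.CStar :=
  ⟨ccFamily 𝒢 f, NonUnitalStarSubalgebra.le_topologicalClosure _
    (NonUnitalStarAlgebra.subset_adjoin ℂ _ ⟨f, fun _ => rfl⟩)⟩

/-- The image of C_c(𝒢) is already a ⋆-subalgebra, being stable under convolution and involution, so
generating a C⋆-algebra from it only adds limits. -/
theorem exists_norm_sub_toCStar_lt (a : 𝒢.CStar) {ε : ℝ} (hε : 0 < ε) :
    ∃ f : C_c(G, ℂ), ‖a - 𝒢.toCStar f‖ < ε := by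
  have h := genAlg_subset_of_submodule (H := fun ρ : 𝒢.Rep => ρ.H)
    (X := {a | ∃ f : C_c(G, ℂ), ∀ ρ : 𝒢.Rep, a ρ = ρ.op f}) ?_ ?_
    (LinearMap.range (ccFamily 𝒢)).topologicalClosure
    (Submodule.isClosed_topologicalClosure _) ?_ a.1 a.2
  · obtain ⟨b, ⟨f, rfl⟩, hb⟩ := Metric.mem_closure_iff.1 h ε hε
    exact ⟨f, by rwa [dist_eq_norm] at hb⟩
  · rintro a ⟨f, hf⟩ b ⟨g, hg⟩
    exact ⟨𝒢.convCc f g, fun ρ => by rw [op_convCc, ← hf, ← hg]; rfl⟩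
  · rintro a ⟨f, hf⟩
    exact ⟨𝒢.starCc f, fun ρ => by rw [op_starCc, ← hf]; rfl⟩
  · rw [← range_ccFamily]
    exact Submodule.le_topologicalClosure (LinearMap.range (ccFamily 𝒢))

/-- A closed linear condition holds on `C⋆(𝒢)` if it holds on `C_c(𝒢)`. -/
theorem cstar_induction {P : 𝒢.CStar → Prop} (hP : IsClosed {a | P a})
    (h : ∀ f, P (𝒢.toCStar f)) (a : 𝒢.CStar) : P a := by
  refine hP.closure_subset (Metric.mem_closure_iff.2 fun ε hε => ?_)
  obtain ⟨f, hf⟩ := exists_norm_sub_toCStar_lt 𝒢 a hε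
  exact ⟨_, h f, by rwa [dist_eq_norm]⟩

end

end Gpd

/-! ### Group C⋆-algebras -/

section
variable {Γ : Type u} [Group Γ]

/-- The unitary of the group C⋆-algebra given by a group element. -/
def GroupCStar.of (g : Γ) : GroupCStar Γ := ⟨GroupCStar.gen g, GroupCStar.gen_mem g⟩

theorem URep.extend_of (π : URep Γ) (g : Γ) : π.extend (GroupCStar.of g) = π.op g := rfl

theorem GroupCStar.ext_rep {a b : GroupCStar Γ} (h : ∀ π : URep Γ, π.extend a = π.extend b) : a = b :=
  Subtype.ext (Subtype.ext (funext h))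

theorem GroupCStar.of_mul (g h : Γ) : of (g * h) = of g * of h :=
  ext_rep fun π => by rw [map_mul, URep.extend_of, URep.extend_of, URep.extend_of, map_mul]; rfl

theorem GroupCStar.of_star (g : Γ) : star (of g) = of g⁻¹ :=
  ext_rep fun π => by rw [map_star, URep.extend_of, URep.extend_of, map_inv]; rfl

/-- Closed linear subspaces of the group C⋆-algebra containing the group are everything. -/
theorem GroupCStar.mem_of_isClosed (P : Submodule ℂ (OpFamily fun π : URep Γ => π.H))
    (hP : IsClosed (P : Set (OpFamily fun π : URep Γ => π.H))) (h : ∀ g : Γ, gen g ∈ P)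
    (a : GroupCStar Γ) : a.1 ∈ P := by
  refine genAlg_subset_of_submodule ?_ ?_ P hP ?_ a.1 a.2
  · rintro a ⟨g, hg⟩ b ⟨k, hk⟩
    refine ⟨g * k, fun π => ?_⟩
    rw [map_mul, Submonoid.coe_mul, ← hg, ← hk]; rfl
  · rintro a ⟨g, hg⟩
    refine ⟨g⁻¹, fun π => ?_⟩
    rw [map_inv]; exact congrArg star (hg π)
  · rintro a ⟨g, hg⟩
    have : a = gen g := Subtype.ext (funext hg)
    rw [this]; exact h g

theorem GroupCStar.induction {P : GroupCStar Γ → Prop} (hP : IsClosed {a | P a})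
    (hadd : ∀ a b, P a → P b → P (a + b)) (hsmul : ∀ (c : ℂ) a, P a → P (c • a))
    (h : ∀ g, P (of g)) (a : GroupCStar Γ) : P a := by
  let Q : Submodule ℂ (GroupCStar Γ) :=
    { carrier := {a | P a}, add_mem' := hadd _ _, smul_mem' := fun c a => hsmul c a,
      zero_mem' := by have := hsmul 0 _ (h 1); rwa [zero_smul] at this }
  let ι : GroupCStar Γ →ₗ[ℂ] OpFamily fun π : URep Γ => π.H :=
    { toFun := fun a => a.1, map_add' := fun _ _ => rfl, map_smul' := fun _ _ => rfl }
  have hemb : Topology.IsClosedEmbedding ι :=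
    (isClosed_genAlg _ _).isClosedEmbedding_subtypeVal
  have := mem_of_isClosed (Q.map ι) (hemb.isClosedMap _ hP) (fun g => ⟨of g, h g, rfl⟩) a
  obtain ⟨b, hb, e⟩ := this
  rw [← Subtype.ext e]; exact hb

end

namespace Gpd

/-! ### Matrix coefficients of induced representations -/

section
variable {X G : Type u} {𝒢 : Gpd X G} {S : 𝒢.Sub}

theorem norm_apply_le_ind (π : URep S.El) (ξ : IndSp π) (g : G) : ‖ξ.1 g‖ ≤ ‖ξ‖ := by
  by_cases hg : 𝒢.s g = S.base
  · obtain ⟨c, k, rfl⟩ := S.exists_rep g hg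
    rw [ξ.2.2.1 _ _ (S.s_rep c), norm_star_op, ← norm_restr, ← restr_apply]
    exact lp.norm_apply_le_norm (by simp) _ c
  · rw [ξ.2.1 g hg, norm_zero]; exact norm_nonneg _

/-- Evaluation at an arrow. -/
def evalArr (π : URep S.El) (g : G) : IndSp π →L[ℂ] π.H :=
  LinearMap.mkContinuous
    { toFun := fun ξ => ξ.1 g, map_add' := fun _ _ => rfl, map_smul' := fun _ _ => rfl } 1
    fun ξ => by rw [one_mul]; exact norm_apply_le_ind π ξ g

theorem norm_evalArr_le (π : URep S.El) (g : G) : ‖evalArr π g‖ ≤ 1 :=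
  LinearMap.mkContinuous_norm_le _ zero_le_one _

/-- The function supported on the coset of `g` with value `v` at `g`. -/
def delta (π : URep S.El) (g : G) : π.H →L[ℂ] IndSp π := ContinuousLinearMap.adjoint (evalArr π g)

theorem norm_delta_le (π : URep S.El) (g : G) : ‖delta π g‖ ≤ 1 := by
  rw [delta, LinearIsometryEquiv.norm_map]; exact norm_evalArr_le π g

theorem inner_delta_left (π : URep S.El) (g : G) (v : π.H) (ξ : IndSp π) :
    ⟪delta π g v, ξ⟫_ℂ = ⟪v, ξ.1 g⟫_ℂ :=
  ContinuousLinearMap.adjoint_inner_left _ _ _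

theorem inner_delta_right (π : URep S.El) (g : G) (v : π.H) (ξ : IndSp π) :
    ⟪ξ, delta π g v⟫_ℂ = ⟪ξ.1 g, v⟫_ℂ :=
  ContinuousLinearMap.adjoint_inner_right _ _ _

theorem delta_eq_zero (π : URep S.El) {g : G} (hg : 𝒢.s g ≠ S.base) (v : π.H) : delta π g v = 0 := by
  refine ext_inner_right ℂ fun ξ => ?_
  rw [inner_delta_left, ξ.2.1 g hg, inner_zero_right, inner_zero_left]

theorem delta_mul (π : URep S.El) {g : G} (hg : 𝒢.s g = S.base) (k : S.El) (v : π.H) :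
    delta π (𝒢.mul g k.1) v = delta π g ((π.op k : π.H →L[ℂ] π.H) v) := by
  refine ext_inner_right ℂ fun ξ => ?_
  rw [inner_delta_left, inner_delta_left, ξ.2.2.1 g k hg]
  exact ContinuousLinearMap.adjoint_inner_right _ _ _

theorem restr_delta_rep (π : URep S.El) [DecidableEq S.Coset] (c : S.Coset) (v : π.H) :
    restr π (delta π (S.rep c) v) = lp.single 2 c v := by
  obtain ⟨η, hη⟩ := restr_surjective π (lp.single 2 c v)
  have : delta π (S.rep c) v = η := by
    refine ext_inner_right ℂ fun ξ => ?_
    rw [inner_delta_left]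
    change _ = ⟪restr π η, restr π ξ⟫_ℂ
    rw [hη, lp.inner_single_left, restr_apply]
  rw [this, hη]

theorem delta_rep_self (π : URep S.El) (c : S.Coset) (v : π.H) :
    (delta π (S.rep c) v).1 (S.rep c) = v := by
  classical
  rw [← restr_apply, restr_delta_rep]
  exact lp.single_apply_self (E := fun _ : S.Coset => π.H) 2 c v

theorem delta_rep_ne (π : URep S.El) {c d : S.Coset} (h : d ≠ c) (v : π.H) :
    (delta π (S.rep c) v).1 (S.rep d) = 0 := by
  classical
  rw [← restr_apply, restr_delta_rep]
  exact lp.single_apply_ne (E := fun _ : S.Coset => π.H) 2 c v h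

theorem op_star_op (π : URep S.El) (k : S.El) (v : π.H) :
    star (π.op k : π.H →L[ℂ] π.H) ((π.op k : π.H →L[ℂ] π.H) v) = v :=
  congrArg (fun T : π.H →L[ℂ] π.H => T v) (Unitary.star_mul_self_of_mem (π.op k).2)

theorem delta_apply_self (π : URep S.El) {g : G} (hg : 𝒢.s g = S.base) (v : π.H) :
    (delta π g v).1 g = v := by
  obtain ⟨c, k, rfl⟩ := S.exists_rep g hg
  rw [delta_mul π (S.s_rep c), (delta π _ _).2.2.1 _ _ (S.s_rep c), delta_rep_self, op_star_op]

theorem delta_apply_mul (π : URep S.El) {g : G} (hg : 𝒢.s g = S.base) (k : S.El) (v : π.H) :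
    (delta π g v).1 (𝒢.mul g k.1) = star (π.op k : π.H →L[ℂ] π.H) v := by
  rw [(delta π g v).2.2.1 g k hg, delta_apply_self π hg]

theorem exists_of_delta_apply_ne_zero (π : URep S.El) {g h : G} (hg : 𝒢.s g = S.base) {v : π.H}
    (hne : (delta π g v).1 h ≠ 0) : ∃ k : S.El, h = 𝒢.mul g k.1 := by
  have hh : 𝒢.s h = S.base := by
    by_contra h0; exact hne ((delta π g v).2.1 h h0)
  obtain ⟨c, k, rfl⟩ := S.exists_rep g hg
  obtain ⟨d, l, rfl⟩ := S.exists_rep h hh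
  have hdc : d = c := by
    by_contra h0
    rw [delta_mul π (S.s_rep c), (delta π _ _).2.2.1 _ _ (S.s_rep d), delta_rep_ne π h0,
      map_zero] at hne
    exact hne rfl
  subst hdc
  refine ⟨k⁻¹ * l, ?_⟩
  rw [𝒢.mul_assoc _ _ _ (S.s_rep' d k) (S.comp k.2 (k⁻¹ * l).2), ← Sub.coe_mul]
  simp

theorem s_mul_inv_comp {g h : G} (hg : 𝒢.s g = S.base) (hh : 𝒢.s h = S.base) (t : S.El) :
    𝒢.s h = 𝒢.r t.1 ∧ 𝒢.s (𝒢.mul h t.1) = 𝒢.r (𝒢.inv g) := by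
  have h1 : 𝒢.s h = 𝒢.r t.1 := by rw [hh, S.r_eq _ t.2]
  exact ⟨h1, by rw [𝒢.s_mul _ _ h1, S.s_eq _ t.2, 𝒢.r_inv, hg]⟩

theorem mul_inv_injective {g h : G} (hg : 𝒢.s g = S.base) (hh : 𝒢.s h = S.base) :
    Function.Injective fun t : S.El => 𝒢.mul (𝒢.mul h t.1) (𝒢.inv g) := by
  have key : ∀ t : S.El, 𝒢.mul (𝒢.inv h) (𝒢.mul (𝒢.mul (𝒢.mul h t.1) (𝒢.inv g)) g) = t.1 := by
    intro t
    obtain ⟨h1, h2⟩ := s_mul_inv_comp hg hh t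
    have h3 : 𝒢.s (𝒢.mul h t.1) = 𝒢.s g := by rw [h2, 𝒢.r_inv]
    rw [𝒢.mul_assoc _ _ _ h2 (𝒢.s_inv g), 𝒢.inv_mul, ← h3, 𝒢.mul_unit, 𝒢.inv_mul_cancel h1]
  intro t t' e
  have := key t
  rw [show 𝒢.mul (𝒢.mul h t.1) (𝒢.inv g) = _ from e, key t'] at this
  exact Subtype.ext this.symm

variable [TopologicalSpace X] [TopologicalSpace G] [𝒢.IsEtale]

theorem finite_coeff (f : C_c(G, ℂ)) {g h : G} (hg : 𝒢.s g = S.base) (hh : 𝒢.s h = S.base) :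
    {t : S.El | f (𝒢.mul (𝒢.mul h t.1) (𝒢.inv g)) ≠ 0}.Finite := by
  refine Set.Finite.of_finite_image ((finite_r 𝒢 f (𝒢.r h)).subset ?_)
    (mul_inv_injective hg hh).injOn
  rintro _ ⟨t, ht, rfl⟩
  obtain ⟨h1, h2⟩ := s_mul_inv_comp hg hh t
  exact ⟨ht, by rw [𝒢.r_mul _ _ h2, 𝒢.r_mul _ _ h1]⟩

/-- The only arrows l for which δ_g v can be nonzero at l⁻¹h are l = h t g⁻¹ with t in S. There l⁻¹h
= g t⁻¹, and by equivariance the value is π(t)v. -/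
theorem indOp_delta_apply (π : URep S.El) (f : C_c(G, ℂ)) {g h : G} (hg : 𝒢.s g = S.base)
    (hh : 𝒢.s h = S.base) (v : π.H) : (indOp π f (delta π g v)).1 h =
      ∑ᶠ t : S.El, f (𝒢.mul (𝒢.mul h t.1) (𝒢.inv g)) • (π.op t : π.H →L[ℂ] π.H) v := by
  rw [indOp_apply, convVec, ← finsum_mem_univ (fun t : S.El => _)]
  have hval : ∀ t : S.El, 𝒢.mul (𝒢.inv (𝒢.mul (𝒢.mul h t.1) (𝒢.inv g))) h = 𝒢.mul g t⁻¹.1 := by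
    intro t
    obtain ⟨h1, h2⟩ := s_mul_inv_comp hg hh t
    have h3 : 𝒢.s (𝒢.inv t.1) = 𝒢.r (𝒢.inv h) := by rw [𝒢.s_inv, 𝒢.r_inv, h1]
    have h4 : 𝒢.s g = 𝒢.r (𝒢.inv t.1) := by rw [hg, 𝒢.r_inv, S.s_eq _ t.2]
    rw [𝒢.mul_inv_rev h2, 𝒢.inv_inv, 𝒢.mul_inv_rev h1,
      𝒢.mul_assoc _ _ _ (by rw [𝒢.r_mul _ _ h3, h4])
        (by rw [𝒢.s_mul _ _ h3, 𝒢.s_inv]), 𝒢.mul_assoc _ _ _ h3 (𝒢.s_inv h), 𝒢.inv_mul, h1,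
      ← 𝒢.s_inv, 𝒢.mul_unit, Sub.coe_inv]
  rw [finsum_mem_eq_of_bijOn (fun t : S.El => 𝒢.mul (𝒢.mul h t.1) (𝒢.inv g))
    (t := Set.range fun t : S.El => 𝒢.mul (𝒢.mul h t.1) (𝒢.inv g))
    (g := fun l => f l • (delta π g v).1 (𝒢.mul (𝒢.inv l) h))]
  · refine finsum_mem_inter_support_eq' _ _ _ fun l hl => ⟨fun e => ?_, ?_⟩
    · have e' : 𝒢.r l = 𝒢.r h := e
      obtain ⟨k, hk⟩ := exists_of_delta_apply_ne_zero π hg (right_ne_zero_of_smul hl)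
      refine ⟨k⁻¹, ?_⟩
      obtain ⟨h1, h2⟩ := s_mul_inv_comp hg hh k⁻¹
      have := hval k⁻¹
      rw [_root_.inv_inv k, ← hk] at this
      have h5 : ∀ m, 𝒢.r m = 𝒢.r h → 𝒢.mul h (𝒢.inv (𝒢.mul (𝒢.inv m) h)) = m := by
        intro m hm
        rw [𝒢.mul_inv_rev (by rw [𝒢.s_inv, hm]), 𝒢.inv_inv, 𝒢.mul_inv_cancel hm.symm]
      change 𝒢.mul (𝒢.mul h _) (𝒢.inv g) = l
      rw [← h5 l e', ← this, h5]
      rw [𝒢.r_mul _ _ h2, 𝒢.r_mul _ _ h1]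
    · rintro ⟨t, rfl⟩
      obtain ⟨h1, h2⟩ := s_mul_inv_comp hg hh t
      change 𝒢.r (𝒢.mul (𝒢.mul h t.1) (𝒢.inv g)) = 𝒢.r h
      rw [𝒢.r_mul _ _ h2, 𝒢.r_mul _ _ h1]
  · exact ⟨fun t _ => ⟨t, rfl⟩, (mul_inv_injective hg hh).injOn, fun l ⟨t, ht⟩ => ⟨t, trivial, ht⟩⟩
  · intro t _
    simp only [hval]
    rw [delta_apply_mul π hg, map_inv]
    congr 2
    exact (star_star _).symm

/-- The induced representation, acting on `IndSp π`. -/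
def indHom (π : URep S.El) : 𝒢.CStar →⋆ₙₐ[ℂ] (IndSp π →L[ℂ] IndSp π) := (indRep S π).extend

theorem mem_ker_ind_iff (π : URep S.El) (a : 𝒢.CStar) :
    a ∈ TwoSidedIdeal.ker (indRep S π).extend ↔ indHom π a = 0 := TwoSidedIdeal.mem_ker _

theorem inner_indHom_star (π : URep S.El) (a : 𝒢.CStar) (ξ η : IndSp π) :
    ⟪indHom π (star a) ξ, η⟫_ℂ = ⟪ξ, indHom π a η⟫_ℂ := by
  rw [map_star]; exact ContinuousLinearMap.adjoint_inner_left _ _ _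

/-- Matrix coefficients of the induced representation. -/
def coeff (π : URep S.El) (a : 𝒢.CStar) (h g : G) : π.H →L[ℂ] π.H :=
  evalArr π h ∘L indHom π a ∘L delta π g

theorem inner_coeff (π : URep S.El) (a : 𝒢.CStar) (h g : G) (v w : π.H) :
    ⟪w, coeff π a h g v⟫_ℂ = ⟪delta π h w, indHom π a (delta π g v)⟫_ℂ := by
  rw [inner_delta_left]; rfl

theorem norm_indHom_le (π : URep S.El) (a : 𝒢.CStar) : ‖indHom π a‖ ≤ ‖a‖ :=
  starHom_norm_le (indRep S π).extend a

theorem norm_coeff_le_norm_indHom (π : URep S.El) (a : 𝒢.CStar) (h g : G) :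
    ‖coeff π a h g‖ ≤ ‖indHom π a‖ := by
  refine ContinuousLinearMap.opNorm_le_bound _ (norm_nonneg _) fun v => ?_
  refine (norm_apply_le_ind π _ h).trans ?_
  refine ((indHom π a).le_opNorm _).trans (mul_le_mul_of_nonneg_left ?_ (norm_nonneg _))
  simpa using (delta π g).le_of_opNorm_le (norm_delta_le π g) v

theorem norm_coeff_le (π : URep S.El) (a : 𝒢.CStar) (h g : G) : ‖coeff π a h g‖ ≤ ‖a‖ :=
  (norm_coeff_le_norm_indHom π a h g).trans (norm_indHom_le π a)

theorem coeff_sub (π : URep S.El) (a b : 𝒢.CStar) (h g : G) :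
    coeff π (a - b) h g = coeff π a h g - coeff π b h g := by
  rw [coeff, map_sub, ContinuousLinearMap.sub_comp, ContinuousLinearMap.comp_sub]; rfl

theorem coeff_eq_zero (π : URep S.El) {a : 𝒢.CStar} (ha : indHom π a = 0) (h g : G) :
    coeff π a h g = 0 := by
  rw [coeff, ha, ContinuousLinearMap.zero_comp, ContinuousLinearMap.comp_zero]

theorem continuous_coeff (π : URep S.El) (h g : G) : Continuous fun a : 𝒢.CStar => coeff π a h g := by
  refine (LipschitzWith.of_dist_le_mul (K := 1) fun a b => ?_).continuous
  rw [dist_eq_norm, dist_eq_norm, ← coeff_sub, NNReal.coe_one, one_mul]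
  exact norm_coeff_le π _ h g

/-- A vector orthogonal to all δ_g v vanishes pointwise. So vanishing coefficients first kill a⋆ on
every δ_h w, and then, by taking adjoints, kill a on every vector. Arrows outside 𝒢_x cause no
trouble since their δ is zero. -/
theorem indHom_eq_zero_of_coeff (π : URep S.El) (a : 𝒢.CStar)
    (ha : ∀ h g, 𝒢.s h = S.base → 𝒢.s g = S.base → coeff π a h g = 0) : indHom π a = 0 := by
  have h1 : ∀ h g v w, ⟪delta π h w, indHom π a (delta π g v)⟫_ℂ = 0 := by
    intro h g v w
    by_cases hh : 𝒢.s h = S.base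
    · by_cases hg : 𝒢.s g = S.base
      · rw [← inner_coeff, ha h g hh hg]; exact inner_zero_right w
      · rw [delta_eq_zero π hg v, map_zero, inner_zero_right]
    · rw [delta_eq_zero π hh w, inner_zero_left]
  have h2 : ∀ h w, indHom π (star a) (delta π h w) = 0 := by
    intro h w
    refine Subtype.ext (funext fun g => ?_)
    refine ext_inner_right ℂ fun v => ?_
    rw [← inner_delta_right, inner_indHom_star, h1]
    exact (inner_zero_left v).symm
  refine ContinuousLinearMap.ext fun ξ => Subtype.ext (funext fun h => ?_)
  refine ext_inner_left ℂ fun w => ?_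
  rw [← inner_delta_left, ← inner_indHom_star, h2, inner_zero_left]
  exact (inner_zero_right w).symm

variable [T2Space G]

/-- In W the arrow l is the only one with source r(g), so after passing to the adjoint the
convolution sum has one term. -/
theorem indOp_delta_of_bisection (π : URep S.El) {W : Set G} (hW : 𝒢.IsBisection W) {f : C_c(G, ℂ)}
    (hf : tsupport f ⊆ W) {l g : G} (hl : l ∈ W) (e : 𝒢.s l = 𝒢.r g) (v : π.H) :
    indOp π f (delta π g v) = f l • delta π (𝒢.mul l g) v := by
  refine ext_inner_right ℂ fun ξ => ?_
  rw [indOp_star π (𝒢.starCc f) f (fun g => by simp [starCc, 𝒢.inv_inv]), inner_delta_left,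
    inner_smul_left, inner_delta_left, indOp_apply, convVec,
    finsum_mem_inter_support_eq _ _ {𝒢.inv l}, finsum_mem_singleton]
  · simp only [starCc, mkCc_apply, 𝒢.inv_inv, inner_smul_right]; rfl
  · ext m
    simp only [Set.mem_inter_iff, Set.mem_ofPred_eq, Function.mem_support, Set.mem_singleton_iff]
    refine ⟨fun ⟨h1, h2⟩ => ⟨?_, h2⟩, ?_⟩
    · have h3 : 𝒢.inv m ∈ W := hf (subset_tsupport _ fun h0 => left_ne_zero_of_smul h2 (by
        simp [starCc, h0]))
      rw [← 𝒢.inv_inv m, hW.injOn_s h3 hl (by rw [𝒢.s_inv, h1, e])]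
    · rintro ⟨rfl, h2⟩
      exact ⟨by rw [𝒢.r_inv, e], h2⟩

variable [LocallyCompactSpace G]

/-- A bump on a bisection through g, with value 1 at g, acts as left translation by g. The same f
works for all subgroups and representations. -/
theorem exists_indOp_delta (x : X) (g : G) (hg : 𝒢.s g = x) : ∃ f : C_c(G, ℂ),
    ∀ (S : 𝒢.Sub) (π : URep S.El) (h : G) (_ : x = 𝒢.r h) (v : π.H),
      indOp π f (delta π h v) = delta π (𝒢.mul g h) v := by
  obtain ⟨W, hWo, hgW, hW⟩ := exists_bisection 𝒢 g
  obtain ⟨f, hf1, hf, -⟩ := exists_bump hWo hgW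
  refine ⟨f, fun S π h hh v => ?_⟩
  rw [indOp_delta_of_bisection π hW hf hgW (hg.trans hh), hf1, one_smul]

theorem coeff_toCStar (π : URep S.El) (f : C_c(G, ℂ)) {g h : G} (hg : 𝒢.s g = S.base)
    (hh : 𝒢.s h = S.base) : coeff π (𝒢.toCStar f) h g =
      ∑ t ∈ (finite_coeff f hg hh).toFinset,
        f (𝒢.mul (𝒢.mul h t.1) (𝒢.inv g)) • (π.op t : π.H →L[ℂ] π.H) := by
  ext v
  refine (indOp_delta_apply π f hg hh v).trans ?_
  rw [finsum_eq_sum_of_support_subset (s := (finite_coeff f hg hh).toFinset)]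
  · simp
  · intro t ht
    simp only [Set.Finite.coe_toFinset]
    exact fun h0 => ht (by simp [h0])

/-- The matrix coefficients are given by elements of the group C⋆-algebra. -/
theorem exists_extend_eq_coeff (a : 𝒢.CStar) {g h : G} (hg : 𝒢.s g = S.base)
    (hh : 𝒢.s h = S.base) : ∃ e : GroupCStar S.El, ∀ π : URep S.El, π.extend e = coeff π a h g := by
  -- All π are treated at once: the coefficients form a bounded family depending continuously on a.
  -- For a in C_c(𝒢) it is a finite combination of group elements, so it always lies in the closed
  -- algebra C⋆(S).
  let E : 𝒢.CStar → OpFamily (fun π : URep S.El => π.H) := fun a =>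
    OpFamily.mk (fun π => coeff π a h g) ‖a‖ fun π => norm_coeff_le π a h g
  have hE : Continuous E := by
    refine (LipschitzWith.of_dist_le_mul (K := 1) fun a b => ?_).continuous
    rw [dist_eq_norm, dist_eq_norm, NNReal.coe_one, one_mul]
    refine OpFamily.norm_le _ _ (norm_nonneg _) fun π => ?_
    change ‖coeff π a h g - coeff π b h g‖ ≤ _
    rw [← coeff_sub]; exact norm_coeff_le π _ h g
  suffices hmem : E a ∈ genAlg (fun π : URep S.El => π.H) {a | ∃ g, ∀ π : URep S.El, a π = π.op g} from
    ⟨⟨E a, hmem⟩, fun π => rfl⟩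
  refine cstar_induction 𝒢 (P := fun a => E a ∈ genAlg (fun π : URep S.El => π.H)
    {a | ∃ g, ∀ π : URep S.El, a π = π.op g}) ((isClosed_genAlg _ _).preimage hE) (fun f => ?_) a
  have : E (𝒢.toCStar f) = ∑ t ∈ (finite_coeff f hg hh).toFinset,
      f (𝒢.mul (𝒢.mul h t.1) (𝒢.inv g)) • GroupCStar.gen t := by
    refine Subtype.ext (funext fun π => ?_)
    refine (coeff_toCStar π f hg hh).trans ?_
    exact (map_sum (OpFamily.coord (fun π : URep S.El => π.H) π)
      (fun t => f (𝒢.mul (𝒢.mul h t.1) (𝒢.inv g)) • GroupCStar.gen t) _).symm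
  rw [this]
  exact sum_mem fun g _ => SMulMemClass.smul_mem _ (GroupCStar.gen_mem g)

/-- The coefficients of a are images of elements of C⋆(S) chosen independently of the
representation. If π kills these elements, so does π'. -/
theorem ker_ind_le_of_ker_le {π π' : URep S.El}
    (h : TwoSidedIdeal.ker π.extend ≤ TwoSidedIdeal.ker π'.extend) :
    TwoSidedIdeal.ker (indRep S π).extend ≤ TwoSidedIdeal.ker (indRep S π').extend := by
  intro a ha
  refine (mem_ker_ind_iff π' a).2 (indHom_eq_zero_of_coeff π' a fun k g hk hg => ?_)
  obtain ⟨e, he⟩ := exists_extend_eq_coeff (S := S) a hg hk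
  have h1 : e ∈ TwoSidedIdeal.ker π.extend := by
    rw [TwoSidedIdeal.mem_ker, he, coeff_eq_zero π ((mem_ker_ind_iff π a).1 ha)]
  rw [← he]
  exact (TwoSidedIdeal.mem_ker _).1 (h h1)

theorem indIdeal_eq {π : URep S.El} {J : TwoSidedIdeal (GroupCStar S.El)}
    (h : TwoSidedIdeal.ker π.extend = J) :
    indIdeal S J = TwoSidedIdeal.ker (indRep S π).extend := by
  refine le_antisymm (sInf_le ⟨π, h, rfl⟩) (le_sInf ?_)
  rintro _ ⟨π', h', rfl⟩
  exact ker_ind_le_of_ker_le (h.trans h'.symm).le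

/-- An ideal is in the kernel of the induced representation if its coefficients at the unit
vanish. -/
theorem le_ker_ind_iff (π : URep S.El) (I : TwoSidedIdeal 𝒢.CStar) :
    I ≤ TwoSidedIdeal.ker (indRep S π).extend ↔
      ∀ a ∈ I, coeff π a (𝒢.unit S.base) (𝒢.unit S.base) = 0 := by
  constructor
  · intro h a ha
    exact coeff_eq_zero π ((mem_ker_ind_iff π a).1 (h ha)) _ _
  · intro H a ha
    refine (mem_ker_ind_iff π a).2 (indHom_eq_zero_of_coeff π a fun h g hh hg => ?_)
    -- With m and n translating the unit to h and g, the (h, g) coefficient of a is the unit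
    -- coefficient of m⋆ a n, which still belongs to I.
    obtain ⟨m, hm⟩ := exists_indOp_delta S.base h hh
    obtain ⟨n, hn⟩ := exists_indOp_delta S.base g hg
    have hm' := fun w => hm S π (𝒢.unit S.base) (𝒢.r_unit _).symm w
    have hn' := fun w => hn S π (𝒢.unit S.base) (𝒢.r_unit _).symm w
    rw [← hh, 𝒢.mul_unit, hh] at hm'
    rw [← hg, 𝒢.mul_unit, hg] at hn'
    refine ContinuousLinearMap.ext fun v => ext_inner_left ℂ fun w => ?_
    have h1 := H _ (I.mul_mem_right _ (𝒢.toCStar n) (I.mul_mem_left (star (𝒢.toCStar m)) _ ha))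
    have h2 := inner_coeff π (star (𝒢.toCStar m) * a * 𝒢.toCStar n) (𝒢.unit S.base)
      (𝒢.unit S.base) v w
    have h3 := inner_indHom_star π (star (𝒢.toCStar m)) (delta π (𝒢.unit S.base) w)
      (indHom π a (indHom π (𝒢.toCStar n) (delta π (𝒢.unit S.base) v)))
    rw [star_star] at h3
    rw [inner_coeff, ← hm', ← hn']
    rw [h1, map_mul, map_mul] at h2
    exact h3.trans h2.symm

end

end Gpd

/-! ### Irreducible representations of groups -/

section
variable {Γ : Type u} [Group Γ]

theorem URep.extend_of_one (π : URep Γ) : π.extend (GroupCStar.of 1) = 1 := by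
  rw [extend_of, map_one]; rfl

theorem GroupCStar.mul_of_one (a : GroupCStar Γ) : a * of 1 = a :=
  ext_rep fun π => by rw [map_mul, URep.extend_of_one, mul_one]

theorem URep.of_one_notMem_ker {π : URep Γ} (hπ : IsIrreducible π.extend) (c : ℂ) (hc : c ≠ 0) :
    c • GroupCStar.of 1 ∉ TwoSidedIdeal.ker π.extend := by
  rw [TwoSidedIdeal.mem_ker, map_smul, URep.extend_of_one]
  intro h
  obtain ⟨a, ha⟩ := hπ.1
  refine ha (ContinuousLinearMap.ext fun ξ => ?_)
  have h1 : c • (π.extend a ξ) = 0 := congrArg (fun T : π.H →L[ℂ] π.H => T (π.extend a ξ)) h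
  exact (smul_eq_zero.1 h1).resolve_left hc

theorem URep.extend_mem (π : URep Γ) {K : Submodule ℂ π.H} (hK : IsClosed (K : Set π.H))
    (h : ∀ g, ∀ ξ ∈ K, (π.op g : π.H →L[ℂ] π.H) ξ ∈ K) (a : GroupCStar Γ) {ξ : π.H} (hξ : ξ ∈ K) :
    π.extend a ξ ∈ K := by
  refine GroupCStar.induction (P := fun a => π.extend a ξ ∈ K) ?_ ?_ ?_ (fun g => h g ξ hξ) a
  · exact hK.preimage ((ContinuousLinearMap.apply ℂ π.H ξ).continuous.comp
      (starHom_continuous π.extend))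
  · intro a b ha hb
    rw [map_add]; exact K.add_mem ha hb
  · intro c a ha
    rw [map_smul]; exact K.smul_mem c ha

theorem URep.isIrreducible_of_forall {π : URep Γ} (h0 : ∃ ξ : π.H, ξ ≠ 0)
    (h : ∀ K : Submodule ℂ π.H, IsClosed (K : Set π.H) →
      (∀ g, ∀ ξ ∈ K, (π.op g : π.H →L[ℂ] π.H) ξ ∈ K) → K = ⊥ ∨ K = ⊤) : IsIrreducible π.extend := by
  refine ⟨⟨GroupCStar.of 1, fun h1 => ?_⟩, fun K hK hinv => h K hK fun g => hinv (GroupCStar.of g)⟩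
  rw [URep.extend_of_one] at h1
  obtain ⟨ξ, hξ⟩ := h0
  exact hξ (congrArg (fun T : π.H →L[ℂ] π.H => T ξ) h1)

theorem URep.exists_ne_zero {π : URep Γ} (hπ : IsIrreducible π.extend) : ∃ ξ : π.H, ξ ≠ 0 := by
  obtain ⟨a, ha⟩ := hπ.1
  by_contra! h
  exact ha (ContinuousLinearMap.ext fun ξ => h _)

theorem URep.isIrreducible_comp {Δ : Type u} [Group Δ] {π : URep Γ} (hπ : IsIrreducible π.extend)
    (φ : Δ →* Γ) (hφ : Function.Surjective φ) : IsIrreducible (π.comp φ).extend := by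
  refine isIrreducible_of_forall (π := π.comp φ) (exists_ne_zero (π := π) hπ) fun K hK h => hπ.2 K hK fun a ξ hξ => ?_
  refine π.extend_mem hK (fun g ξ hξ => ?_) a hξ
  obtain ⟨d, rfl⟩ := hφ g
  exact h d ξ hξ

/-- Irreducible representations of the group C⋆-algebra come from unitary representations. -/
theorem IsPrimitive.exists_urep {J : TwoSidedIdeal (GroupCStar Γ)} (hJ : IsPrimitive.{u + 1, u} J) :
    ∃ π : URep Γ, IsIrreducible π.extend ∧ TwoSidedIdeal.ker π.extend = J := by
  obtain ⟨H, σ, hσ, rfl⟩ := hJ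
  -- The element 1 is a right unit, so σ(1)ξ - ξ is killed by every σ(a) and vanishes by
  -- irreducibility.
  have h1 : σ (GroupCStar.of 1) = 1 := by
    refine ContinuousLinearMap.ext fun ξ => sub_eq_zero.1 (hσ.eq_zero_of_forall fun a => ?_)
    rw [map_sub, sub_eq_zero]
    have := congrArg (fun b => σ b ξ) (GroupCStar.mul_of_one a)
    simp only [map_mul] at this
    exact this
  let π : URep Γ :=
    { H := H
      op := MonoidHom.mk' (fun g => ⟨σ (GroupCStar.of g), by
        rw [Unitary.mem_iff, ← map_star, ← map_mul, ← map_mul, GroupCStar.of_star,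
          ← GroupCStar.of_mul, ← GroupCStar.of_mul, inv_mul_cancel, mul_inv_cancel, h1]
        exact ⟨rfl, rfl⟩⟩) fun g h => Subtype.ext
          ((congrArg σ (GroupCStar.of_mul g h)).trans (map_mul σ _ _)) }
  have hπ : ∀ a, π.extend a = σ a := by
    refine fun a => GroupCStar.induction (P := fun a => π.extend a = σ a) ?_ ?_ ?_ (fun g => rfl) a
    · exact isClosed_eq (starHom_continuous π.extend) (starHom_continuous σ)
    · intro a b ha hb
      rw [map_add, map_add, ha, hb]
    · intro c a ha
      rw [map_smul, map_smul, ha]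
  have e : π.extend = σ := NonUnitalStarAlgHom.ext hπ
  exact ⟨π, by rw [e]; exact hσ, by rw [e]⟩

end

namespace Gpd

/-! ### Irreducibility of induced representations -/

section
variable {X G : Type u} {𝒢 : Gpd X G}

theorem convVec_of_units {V : Type*} [AddCommGroup V] [Module ℂ V] {φ : G → ℂ}
    (hφ : ∀ g, φ g ≠ 0 → g = 𝒢.unit (𝒢.r g)) (ξ : G → V) (g : G) :
    𝒢.convVec φ ξ g = φ (𝒢.unit (𝒢.r g)) • ξ g := by
  rw [convVec, finsum_mem_inter_support_eq _ _ {𝒢.unit (𝒢.r g)}, finsum_mem_singleton, inv_unit,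
    𝒢.unit_mul]
  ext h
  simp only [Set.mem_inter_iff, Set.mem_ofPred_eq, Function.mem_support, Set.mem_singleton_iff]
  refine ⟨fun ⟨h1, h2⟩ => ⟨?_, h2⟩, fun ⟨h1, h2⟩ => ⟨by rw [h1, 𝒢.r_unit], h2⟩⟩
  rw [hφ h (left_ne_zero_of_smul h2), h1]

/-- Two arrows from x with the same range differ on the right by an element of the full isotropy
group. This lets functions on the unit space separate cosets. -/
theorem iso_rep_injective (x : X) : Function.Injective fun c => 𝒢.r ((𝒢.iso x).rep c) := by
  intro c d h
  have e : 𝒢.s (𝒢.inv ((𝒢.iso x).rep c)) = 𝒢.r ((𝒢.iso x).rep d) := by rw [𝒢.s_inv]; exact h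
  have hm : 𝒢.mul (𝒢.inv ((𝒢.iso x).rep c)) ((𝒢.iso x).rep d) ∈ (𝒢.iso x).carrier :=
    ⟨by rw [𝒢.r_mul _ _ e, 𝒢.r_inv, Sub.s_rep]; rfl, by rw [𝒢.s_mul _ _ e, Sub.s_rep]; rfl⟩
  refine ((𝒢.iso x).rep_inj (k := ⟨_, hm⟩) (k' := 1) ?_).1
  rw [𝒢.mul_inv_cancel h, Sub.coe_one, ← (𝒢.iso x).s_rep d, 𝒢.mul_unit]

variable [TopologicalSpace X] [TopologicalSpace G] [𝒢.IsEtale]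

variable (𝒢) in
-- Near a unit both g and the unit at r(g) lie in one bisection, and they have the same range.
theorem exists_open_units (x : X) : ∃ W, IsOpen W ∧ 𝒢.unit x ∈ W ∧ ∀ g ∈ W, g = 𝒢.unit (𝒢.r g) := by
  obtain ⟨W, hWo, hW, hb⟩ := exists_bisection 𝒢 (𝒢.unit x)
  refine ⟨W ∩ (fun g => 𝒢.unit (𝒢.r g)) ⁻¹' W, hWo.inter (hWo.preimage
    ((IsEtale.continuous_unit (𝒢 := 𝒢)).comp (continuous_r 𝒢))), ⟨hW, ?_⟩, fun g hg => ?_⟩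
  · simpa [𝒢.r_unit] using hW
  · exact hb.injOn_r hg.1 hg.2 (𝒢.r_unit _).symm

variable [T2Space G] [LocallyCompactSpace G]

/-- A finite set A of cosets carries almost all of ‖ξ‖². A bump on the units that is 1 at the range
of c₀ and 0 at the ranges of the other cosets in A multiplies ξ into a vector close to its component
at c₀. -/
theorem delta_mem_of_mem {S : 𝒢.Sub} (hS : Function.Injective fun c => 𝒢.r (S.rep c))
    (π : URep S.El) {K : Submodule ℂ (IndSp π)}
    (hK : IsClosed (K : Set (IndSp π))) (hinv : ∀ f, ∀ ξ ∈ K, indOp π f ξ ∈ K) {ξ : IndSp π}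
    (hξ : ξ ∈ K) (c₀ : S.Coset) :
    delta π (S.rep c₀) (ξ.1 (S.rep c₀)) ∈ K := by
  classical
  have := t2_units 𝒢
  refine hK.closure_subset (Metric.mem_closure_iff.2 fun ε hε => ?_)
  have hsum : HasSum (fun c => ‖ξ.1 (S.rep c)‖ ^ 2) (‖ξ‖ ^ 2) := by
    rw [norm_sq_ind]; exact ξ.2.2.2.hasSum
  obtain ⟨A, hA⟩ : ∃ A : Finset S.Coset, ∀ B, A ⊆ B →
      ‖ξ‖ ^ 2 - ε ^ 2 < ∑ c ∈ B, ‖ξ.1 (S.rep c)‖ ^ 2 := by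
    have := hsum.eventually (lt_mem_nhds (show ‖ξ‖ ^ 2 - ε ^ 2 < ‖ξ‖ ^ 2 by
      have : 0 < ε ^ 2 := by positivity
      linarith))
    simpa using Filter.mem_atTop_sets.1 this
  obtain ⟨W, hWo, hxW, hW⟩ := exists_open_units 𝒢 (𝒢.r (S.rep c₀))
  let F : Set X := ((A.erase c₀).image fun c => 𝒢.r (S.rep c) : Finset X)
  have hF : IsClosed F := (Finset.finite_toSet _).isClosed
  obtain ⟨f, hf1, hf2, hf3⟩ := exists_bump (hWo.inter (hF.isOpen_compl.preimage (continuous_r 𝒢)))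
    (y := 𝒢.unit (𝒢.r (S.rep c₀))) ⟨hxW, by
      intro hmem
      obtain ⟨c, hc, e⟩ := Finset.mem_image.1 hmem
      rw [𝒢.r_unit] at e
      exact (Finset.mem_erase.1 hc).1 (hS e)⟩
  have hfsupp : ∀ g, f g ≠ 0 → g ∈ W ∩ 𝒢.r ⁻¹' Fᶜ := fun g hg => hf2 (subset_tsupport _ hg)
  refine ⟨indOp π f ξ, hinv f ξ hξ, ?_⟩
  rw [dist_comm, dist_eq_norm]
  set D : IndSp π := indOp π f ξ - delta π (S.rep c₀) (ξ.1 (S.rep c₀))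
  have hD : ∀ c, D.1 (S.rep c) = f (𝒢.unit (𝒢.r (S.rep c))) • ξ.1 (S.rep c) -
      (delta π (S.rep c₀) (ξ.1 (S.rep c₀))).1 (S.rep c) := fun c => by
    rw [← convVec_of_units (fun g hg => hW g (hfsupp g hg).1)]; rfl
  -- The error D vanishes on A ∪ {c₀} and is dominated by ξ elsewhere. Summing, ‖D‖² is at most the
  -- mass of ξ outside A ∪ {c₀}, which is below ε².
  have hle : ∀ c, (if c ∈ insert c₀ A then ‖ξ.1 (S.rep c)‖ ^ 2 else 0) + ‖D.1 (S.rep c)‖ ^ 2 ≤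
      ‖ξ.1 (S.rep c)‖ ^ 2 := by
    intro c
    rw [hD]
    by_cases hc : c = c₀
    · subst hc
      simp [hf1, delta_rep_self]
    · rw [delta_rep_ne π hc, sub_zero]
      by_cases hcA : c ∈ A
      · have h0 : f (𝒢.unit (𝒢.r (S.rep c))) = 0 := by
          by_contra h0
          refine (hfsupp _ h0).2 (Finset.mem_image.2 ⟨c, Finset.mem_erase.2 ⟨hc, hcA⟩, ?_⟩)
          rw [𝒢.r_unit]
        simp [h0, hcA]
      · rw [if_neg (by simp [hc, hcA]), zero_add, norm_smul]
        refine pow_le_pow_left₀ (by positivity) ?_ 2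
        exact mul_le_of_le_one_left (norm_nonneg _) (hf3 _)
  have hs1 : HasSum (fun c => if c ∈ insert c₀ A then ‖ξ.1 (S.rep c)‖ ^ 2 else 0)
      (∑ c ∈ insert c₀ A, ‖ξ.1 (S.rep c)‖ ^ 2) := by
    have : ∑ c ∈ insert c₀ A, ‖ξ.1 (S.rep c)‖ ^ 2 =
        ∑ c ∈ insert c₀ A, if c ∈ insert c₀ A then ‖ξ.1 (S.rep c)‖ ^ 2 else 0 :=
      Finset.sum_congr rfl fun c hc => (if_pos hc).symm
    rw [this]
    exact hasSum_sum_of_ne_finset_zero fun c hc => if_neg hc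
  have hs2 : HasSum (fun c => ‖D.1 (S.rep c)‖ ^ 2) (‖D‖ ^ 2) := by
    rw [norm_sq_ind]; exact D.2.2.2.hasSum
  have h1 := hasSum_le hle (hs1.add hs2) hsum
  have h2 := hA _ (Finset.subset_insert c₀ A)
  exact lt_of_pow_lt_pow_left₀ 2 hε.le (by linarith)

/-- Irreducible representations of isotropy groups induce irreducible representations. -/
theorem isIrreducible_ind {x : X} {π : URep (𝒢.iso x).El} (hπ : IsIrreducible π.extend) :
    IsIrreducible (indRep (𝒢.iso x) π).extend := by
  have key : ∀ K : Submodule ℂ (IndSp π), IsClosed (K : Set (IndSp π)) →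
      (∀ f, ∀ ξ ∈ K, indOp π f ξ ∈ K) → K = ⊥ ∨ K = ⊤ := by
    intro K hK hinv
    refine or_iff_not_imp_left.2 fun hne => ?_
    obtain ⟨ξ, hξ, hξ0⟩ := (Submodule.ne_bot_iff K).1 hne
    obtain ⟨c, hc⟩ : ∃ c, ξ.1 ((𝒢.iso x).rep c) ≠ 0 := by
      by_contra! h
      exact hξ0 (restr_injective π (lp.ext (funext h)))
    have hcu : 𝒢.s ((𝒢.iso x).rep c) = x := (𝒢.iso x).s_rep c
    have hmove : ∀ g h, 𝒢.s g = 𝒢.r h → ∀ v, delta π h v ∈ K → delta π (𝒢.mul g h) v ∈ K := by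
      intro g h e v hv
      obtain ⟨n, hn⟩ := exists_indOp_delta (𝒢 := 𝒢) _ g rfl
      rw [← hn _ π h e]
      exact hinv _ _ hv
    -- L consists of the v with δ_x v in K. It is invariant under the isotropy group, since
    -- δ_x(π(k)v) is the translate of δ_x v by k. It contains a nonzero value of ξ, so
    -- irreducibility of π gives L = ⊤, and translation puts every δ_g v in K.
    let L : Submodule ℂ π.H := K.comap (delta π (𝒢.unit x) : π.H →ₗ[ℂ] IndSp π)
    have hL : IsClosed (L : Set π.H) := hK.preimage (delta π (𝒢.unit x)).continuous
    have hLinv : ∀ k, ∀ v ∈ L, (π.op k : π.H →L[ℂ] π.H) v ∈ L := by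
      intro k v hv
      change delta π (𝒢.unit x) ((π.op k : π.H →L[ℂ] π.H) v) ∈ K
      have hk1 : 𝒢.r k.1 = x := k.2.1
      have hk2 : 𝒢.s k.1 = x := k.2.2
      rw [← delta_mul π (𝒢.s_unit x)]
      have e1 : 𝒢.mul (𝒢.unit x) k.1 = 𝒢.mul k.1 (𝒢.unit x) := by
        have e2 := 𝒢.unit_mul k.1
        have e3 := 𝒢.mul_unit k.1
        rw [hk1] at e2; rw [hk2] at e3
        rw [e2, e3]
      rw [e1]
      exact hmove _ _ (by rw [hk2, 𝒢.r_unit]) v hv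
    have hvL : ξ.1 ((𝒢.iso x).rep c) ∈ L := by
      have h1 := delta_mem_of_mem (iso_rep_injective x) π hK hinv hξ c
      have h2 := hmove (𝒢.inv ((𝒢.iso x).rep c)) _ (𝒢.s_inv _) _ h1
      rw [𝒢.inv_mul, hcu] at h2
      exact h2
    have hLtop : L = ⊤ := by
      refine (hπ.2 L hL fun a v hv => π.extend_mem hL hLinv a hv).resolve_left fun h0 => ?_
      rw [h0] at hvL
      exact hc ((Submodule.mem_bot ℂ).1 hvL)
    have hall : ∀ g v, delta π g v ∈ K := by
      intro g v
      by_cases hg : 𝒢.s g = x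
      · have h1 : v ∈ L := hLtop ▸ Submodule.mem_top
        have h2 := hmove g (𝒢.unit x) (by rw [hg, 𝒢.r_unit]) v h1
        have h3 := 𝒢.mul_unit g
        rw [hg] at h3
        rwa [h3] at h2
      · rw [delta_eq_zero π hg]; exact K.zero_mem
    -- A vector orthogonal to K is orthogonal to every δ_g v, hence zero at every arrow.
    rw [← hK.submodule_topologicalClosure_eq, Submodule.topologicalClosure_eq_top_iff,
      Submodule.eq_bot_iff]
    intro η hη
    refine Subtype.ext (funext fun g => ext_inner_left ℂ fun v => ?_)
    rw [← inner_delta_left, Submodule.inner_right_of_mem_orthogonal (hall g v) hη]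
    exact (inner_zero_right v).symm
  refine ⟨?_, fun K hK hinv => key K hK fun f => hinv (𝒢.toCStar f)⟩
  obtain ⟨v, hv⟩ := URep.exists_ne_zero hπ
  obtain ⟨n, hn⟩ := exists_indOp_delta x (𝒢.unit x) (𝒢.s_unit x)
  refine ⟨𝒢.toCStar n, fun h0 => hv ?_⟩
  have h1 : indOp π n (delta π (𝒢.unit x) v) = 0 :=
    congrArg (fun T : IndSp π →L[ℂ] IndSp π => T (delta π (𝒢.unit x) v)) h0
  rw [hn _ π _ (𝒢.r_unit x).symm] at h1
  have h2 : 𝒢.mul (𝒢.unit x) (𝒢.unit x) = 𝒢.unit x := by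
    have := 𝒢.unit_mul (𝒢.unit x)
    rwa [𝒢.r_unit] at this
  rw [h2] at h1
  rw [← delta_apply_self π (g := 𝒢.unit x) (𝒢.s_unit x) v, h1]; rfl

theorem StabPrim.exists_urep (p : 𝒢.StabPrim) : ∃ π : URep (𝒢.iso p.unit).El,
    IsIrreducible π.extend ∧ TwoSidedIdeal.ker π.extend = p.ideal.1 ∧
      p.ind = TwoSidedIdeal.ker (indRep (𝒢.iso p.unit) π).extend := by
  obtain ⟨π, h1, h2⟩ := p.ideal.2.exists_urep
  exact ⟨π, h1, h2, indIdeal_eq h2⟩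

theorem StabPrim.isPrimitive_ind (p : 𝒢.StabPrim) : IsPrimitive.{u + 1, u} p.ind := by
  obtain ⟨π, h1, -, h⟩ := p.exists_urep
  exact ⟨_, _, isIrreducible_ind h1, h.symm⟩

end

end Gpd

namespace Gpd

/-! ### The space of subgroups and its group bundle -/

section
variable {X G : Type u} {𝒢 : Gpd X G}

theorem Sub.ext_carrier {S T : 𝒢.Sub} (h : S.carrier = T.carrier) : S = T := by
  have hb : S.base = T.base := by
    have := S.unit_mem
    rw [h] at this
    rw [← T.r_eq _ this, 𝒢.r_unit]
  cases S; cases T; cases h; cases hb; rfl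

theorem SigmaArr.arr_mul {σ τ : 𝒢.SigmaArr} (h : σ.grp = τ.grp) :
    (SigmaArr.mul σ τ).arr = 𝒢.mul σ.arr τ.arr ∧ (SigmaArr.mul σ τ).grp = σ.grp := by
  rw [SigmaArr.mul, dif_pos h]; exact ⟨rfl, rfl⟩

theorem fiberOp_eq_single {S : 𝒢.Sub} (π : URep S.El) {F : 𝒢.SigmaArr → ℂ} (g : S.El)
    (h : ∀ k, k ≠ g → F (sigmaPt S k) = 0) :
    fiberOp π F = F (sigmaPt S g) • (π.op g : π.H →L[ℂ] π.H) := by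
  rw [fiberOp, finsum_eq_single _ g fun k hk => by rw [h k hk, zero_smul]]

variable [TopologicalSpace G]

theorem Sub.isOpen_meet {U : Set G} (hU : IsOpen U) :
    IsOpen {T : 𝒢.Sub | (T.carrier ∩ U).Nonempty} := by
  let _ := fellTopology G
  refine isOpen_induced_iff.2 ⟨{A | (A ∩ U).Nonempty}, ?_, rfl⟩
  refine TopologicalSpace.isOpen_generateFrom_of_mem ⟨∅, 1, fun _ => U, isCompact_empty,
    fun _ => hU, ?_⟩
  ext A; simp

theorem Sub.isOpen_miss {K : Set G} (hK : IsCompact K) :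
    IsOpen {T : 𝒢.Sub | T.carrier ∩ K = ∅} := by
  let _ := fellTopology G
  refine isOpen_induced_iff.2 ⟨{A | A ∩ K = ∅}, ?_, rfl⟩
  refine TopologicalSpace.isOpen_generateFrom_of_mem ⟨K, 0, fun _ => ∅, hK, fun i => i.elim0, ?_⟩
  ext A; simp

theorem Sub.le_nhds {F : Filter 𝒢.Sub} {S : 𝒢.Sub}
    (hU : ∀ U : Set G, IsOpen U → (S.carrier ∩ U).Nonempty →
      ∀ᶠ T in F, (Sub.carrier T ∩ U).Nonempty)
    (hK : ∀ K : Set G, IsCompact K → S.carrier ∩ K = ∅ → ∀ᶠ T in F, Sub.carrier T ∩ K = ∅) :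
    F ≤ nhds S := by
  let _ := fellTopology G
  rw [nhds_induced, ← Filter.tendsto_iff_comap, TopologicalSpace.tendsto_nhds_generateFrom_iff]
  rintro _ ⟨K, n, U, hKc, hUo, rfl⟩ ⟨h1, h2⟩
  filter_upwards [hK K hKc h1, Filter.eventually_all.2 fun i => hU (U i) (hUo i) (h2 i)] with T t1 t2
  exact ⟨t1, t2⟩

variable [TopologicalSpace X] [𝒢.IsEtale]

theorem Sub.continuous_base : Continuous (Sub.base : 𝒢.Sub → X) := by
  refine continuous_def.2 fun V hV => ?_
  convert Sub.isOpen_meet (𝒢 := 𝒢) (hV.preimage (continuous_r 𝒢)) using 1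
  ext T
  refine ⟨fun h => ⟨_, T.unit_mem, ?_⟩, ?_⟩
  · change 𝒢.r (𝒢.unit T.base) ∈ V
    rwa [𝒢.r_unit]
  · rintro ⟨g, hg, hgV⟩
    change T.base ∈ V
    rwa [← T.r_eq g hg]

variable [T2Space G]

/-- All elements of T have the same range, so a bisection around a limit point contains at most one
of them. Arrows being Hausdorff, the limit point must be that element. -/
theorem Sub.isClosed_carrier (T : 𝒢.Sub) : IsClosed T.carrier := by
  have := t2_units 𝒢
  refine isClosed_of_closure_subset fun g hg => ?_
  obtain ⟨W, hWo, hgW, hW⟩ := exists_bisection 𝒢 g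
  obtain ⟨t, htW, ht⟩ := mem_closure_iff.1 hg W hWo hgW
  by_cases h : g = t
  · rwa [h]
  · obtain ⟨t', ⟨ht'W, ht't⟩, ht'⟩ := mem_closure_iff.1 hg (W \ {t})
      (hWo.sdiff isClosed_singleton) ⟨hgW, h⟩
    exact absurd (hW.injOn_r ht'W htW ((T.r_eq _ ht').trans (T.r_eq _ ht).symm)) ht't

/-- An ultrafilter of subgroups whose bases converge to x converges to the set of arrows all of
whose neighbourhoods meet almost every subgroup. Continuity of the groupoid operations makes this
limit a subgroup at x. -/
theorem Sub.isCompact_base {K : Set X} (hK : IsCompact K) :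
    IsCompact {T : 𝒢.Sub | T.base ∈ K} := by
  refine isCompact_iff_ultrafilter_le_nhds.2 fun F hF => ?_
  rw [Filter.le_principal_iff] at hF
  obtain ⟨x, hxK, hx⟩ := isCompact_iff_ultrafilter_le_nhds.1 hK (F.map Sub.base)
    (Filter.le_principal_iff.2 hF)
  have hx' : Filter.Tendsto (Sub.base : 𝒢.Sub → X) F (nhds x) := hx
  have := t2_units 𝒢
  let C : Set G := {g | ∀ U, IsOpen U → g ∈ U → ∀ᶠ T in (F : Filter 𝒢.Sub), (T.carrier ∩ U).Nonempty}
  -- Applied to both range and source: limit arrows begin and end at x because the unit space is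
  -- Hausdorff.
  have heq : ∀ p : G → X, Continuous p → (∀ T : 𝒢.Sub, ∀ g ∈ T.carrier, p g = T.base) →
      ∀ g ∈ C, p g = x := by
    intro p hp hpT g hg
    by_contra hne
    obtain ⟨u, v, hu, hv, hgu, hxv, hd⟩ := t2_separation hne
    obtain ⟨T, ⟨h, hhT, hhu⟩, hTv⟩ :=
      ((hg _ (hu.preimage hp) hgu).and (hx' (hv.mem_nhds hxv))).exists
    refine Set.disjoint_left.1 hd hhu ?_
    rw [hpT T h hhT]; exact hTv
  have hr := heq 𝒢.r (continuous_r 𝒢) fun T g hg => T.r_eq g hg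
  have hs := heq 𝒢.s (IsEtale.continuous_s (𝒢 := 𝒢)) fun T g hg => T.s_eq g hg
  let S : 𝒢.Sub :=
    { base := x
      carrier := C
      r_eq := hr
      s_eq := hs
      unit_mem := by
        intro U hU hxU
        have : ∀ᶠ T in (F : Filter 𝒢.Sub), 𝒢.unit T.base ∈ U :=
          (((IsEtale.continuous_unit (𝒢 := 𝒢)).tendsto x).comp hx') (hU.mem_nhds hxU)
        filter_upwards [this] with T hT
        exact ⟨_, T.unit_mem, hT⟩
      mul_mem := by
        intro g hg h hh U hU hghU
        have hcomp : 𝒢.s g = 𝒢.r h := (hs g hg).trans (hr h hh).symm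
        have hm := IsEtale.continuousOn_mul (𝒢 := 𝒢) (g, h) hcomp
        have hN := hm (hU.mem_nhds hghU)
        rw [Filter.mem_map, mem_nhdsWithin] at hN
        obtain ⟨O, hO, hghO, hsub⟩ := hN
        obtain ⟨u, v, hu, hv, hgu, hhv, huv⟩ := isOpen_prod_iff.1 hO g h hghO
        filter_upwards [hg u hu hgu, hh v hv hhv] with T ⟨a, haT, hau⟩ ⟨b, hbT, hbv⟩
        have h1 : (a, b) ∈ O ∩ {p : G × G | 𝒢.s p.1 = 𝒢.r p.2} :=
          ⟨huv ⟨hau, hbv⟩, T.comp haT hbT⟩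
        exact ⟨_, T.mul_mem a haT b hbT, hsub h1⟩
      inv_mem := by
        intro g hg U hU hgU
        filter_upwards [hg _ (hU.preimage (IsEtale.continuous_inv (𝒢 := 𝒢))) hgU] with T ⟨a, haT, haU⟩
        exact ⟨_, T.inv_mem a haT, haU⟩ }
  refine ⟨S, hxK, Sub.le_nhds ?_ ?_⟩
  · rintro U hU ⟨g, hg, hgU⟩
    exact hg U hU hgU
  · intro L hL hSL
    -- For an ultrafilter, not meeting U frequently enough means that almost all subgroups miss U.
    -- Finitely many such U cover L.
    have h1 : ∀ g ∈ L, ∃ U, IsOpen U ∧ g ∈ U ∧ ∀ᶠ T in (F : Filter 𝒢.Sub), T.carrier ∩ U = ∅ := by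
      intro g hg
      have : g ∉ C := fun h => by
        have : g ∈ S.carrier ∩ L := ⟨h, hg⟩
        rw [hSL] at this; exact this
      simp only [C, Set.mem_ofPred_eq, not_forall] at this
      obtain ⟨U, hU, hgU, hn⟩ := this
      refine ⟨U, hU, hgU, ?_⟩
      filter_upwards [Ultrafilter.eventually_not.2 hn] with T hT
      exact Set.not_nonempty_iff_eq_empty.1 hT
    choose! U hUo hgU hUF using h1
    obtain ⟨t, htL, ht⟩ := hL.elim_nhds_subcover U fun g hg => (hUo g hg).mem_nhds (hgU g hg)
    filter_upwards [(Filter.eventually_all_finset t).2 fun g hg => hUF g (htL g hg)] with T hT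
    refine Set.eq_empty_of_forall_notMem fun g ⟨hgT, hgL⟩ => ?_
    obtain ⟨i, hi, hgi⟩ := Set.mem_iUnion₂.1 (ht hgL)
    have : g ∈ Sub.carrier T ∩ U i := ⟨hgT, hgi⟩
    rw [hT i hi] at this; exact this

variable [LocallyCompactSpace G]

theorem Sub.exists_compact_nhds_miss (T : 𝒢.Sub) {g : G} (hg : g ∉ T.carrier) :
    ∃ K, IsCompact K ∧ K ∈ nhds g ∧ T.carrier ∩ K = ∅ := by
  obtain ⟨K, hK, hKs, hKc⟩ := local_compact_nhds (T.isClosed_carrier.isOpen_compl.mem_nhds hg)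
  exact ⟨K, hKc, hK, Set.disjoint_iff_inter_eq_empty.1 (Set.subset_compl_iff_disjoint_left.1 hKs)⟩

/-- If g lies in S but not in the closed set T, some compact neighbourhood K of g misses T. Meeting
the interior of K and missing K are disjoint Fell-open conditions. -/
instance : T2Space 𝒢.Sub := by
  have key : ∀ S T : 𝒢.Sub, (∃ g ∈ S.carrier, g ∉ T.carrier) →
      ∃ u v : Set 𝒢.Sub, IsOpen u ∧ IsOpen v ∧ S ∈ u ∧ T ∈ v ∧ Disjoint u v := by
    rintro S T ⟨g, hgS, hgT⟩
    obtain ⟨K, hKc, hK, hKT⟩ := T.exists_compact_nhds_miss hgT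
    refine ⟨_, _, Sub.isOpen_meet isOpen_interior, Sub.isOpen_miss hKc,
      ⟨g, hgS, mem_interior_iff_mem_nhds.2 hK⟩, hKT, ?_⟩
    refine Set.disjoint_left.2 fun R ⟨h, hhR, hhK⟩ hR => ?_
    have : h ∈ R.carrier ∩ K := ⟨hhR, interior_subset hhK⟩
    rw [show R.carrier ∩ K = ∅ from hR] at this
    exact this
  refine ⟨fun S T hne => ?_⟩
  have hc : S.carrier ≠ T.carrier := fun h => hne (Sub.ext_carrier h)
  by_cases h : S.carrier ⊆ T.carrier
  · obtain ⟨u, v, hu, hv, h1, h2, hd⟩ :=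
      key T S (Set.not_subset.1 fun h' => hc (h.antisymm h'))
    exact ⟨v, u, hv, hu, h2, h1, hd.symm⟩
  · exact key S T (Set.not_subset.1 h)

end

/-! ### The étale structure and local compactness of Σ(𝒢) -/

section
variable {X G : Type u} {𝒢 : Gpd X G} [TopologicalSpace G]

theorem SigmaArr.continuous_grp : Continuous (SigmaArr.grp : 𝒢.SigmaArr → 𝒢.Sub) :=
  continuous_fst.comp (continuous_induced_dom (f := fun σ : 𝒢.SigmaArr => (σ.grp, σ.arr)))

theorem SigmaArr.continuous_arr : Continuous (SigmaArr.arr : 𝒢.SigmaArr → G) :=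
  continuous_snd.comp (continuous_induced_dom (f := fun σ : 𝒢.SigmaArr => (σ.grp, σ.arr)))

theorem SigmaArr.isInducing :
    Topology.IsInducing fun σ : 𝒢.SigmaArr => (σ.grp, σ.arr) := ⟨rfl⟩

/-- The image of a basic set u × v consists of the subgroups in u that meet v, and meeting an open
set is Fell-open. -/
theorem SigmaArr.isOpenMap_grp : IsOpenMap (SigmaArr.grp : 𝒢.SigmaArr → 𝒢.Sub) := by
  intro O hO
  obtain ⟨P, hP, rfl⟩ := SigmaArr.isInducing.isOpen_iff.1 hO
  refine isOpen_iff_forall_mem_open.2 ?_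
  rintro _ ⟨σ, hσ, rfl⟩
  obtain ⟨u, v, hu, hv, h1, h2, huv⟩ := isOpen_prod_iff.1 hP σ.grp σ.arr hσ
  refine ⟨u ∩ {T | (T.carrier ∩ v).Nonempty}, ?_, hu.inter (Sub.isOpen_meet hv),
    h1, σ.arr, σ.mem, h2⟩
  rintro T ⟨hTu, g, hgT, hgv⟩
  exact ⟨⟨T, g, hgT⟩, huv ⟨hTu, hgv⟩, rfl⟩

variable [TopologicalSpace X] [𝒢.IsEtale]

instance : 𝒢.sigmaGpd.IsEtale where
  continuous_s := SigmaArr.continuous_grp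
  continuous_unit := SigmaArr.isInducing.continuous_iff.2
    (continuous_id.prodMk ((IsEtale.continuous_unit (𝒢 := 𝒢)).comp Sub.continuous_base))
  continuous_inv := SigmaArr.isInducing.continuous_iff.2
    (SigmaArr.continuous_grp.prodMk
      ((IsEtale.continuous_inv (𝒢 := 𝒢)).comp SigmaArr.continuous_arr))
  continuousOn_mul := by
    refine SigmaArr.isInducing.continuousOn_iff.2 ?_
    have h1 : ContinuousOn (fun p : 𝒢.SigmaArr × 𝒢.SigmaArr => (p.1.grp, 𝒢.mul p.1.arr p.2.arr))
        {p | p.1.grp = p.2.grp} := by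
      refine (SigmaArr.continuous_grp.comp continuous_fst).continuousOn.prodMk ?_
      refine (IsEtale.continuousOn_mul (𝒢 := 𝒢)).comp (f := fun p : 𝒢.SigmaArr × 𝒢.SigmaArr =>
        (p.1.arr, p.2.arr)) ?_ ?_
      · exact ((SigmaArr.continuous_arr.comp continuous_fst).prodMk
          (SigmaArr.continuous_arr.comp continuous_snd)).continuousOn
      · intro p hp
        have hp' : p.1.grp = p.2.grp := hp
        exact p.1.grp.comp p.1.mem (hp' ▸ p.2.mem)
    refine h1.congr fun p hp => ?_
    have := SigmaArr.arr_mul (σ := p.1) (τ := p.2) hp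
    exact Prod.ext this.2 this.1
  isLocalHomeomorph_r := by
    -- Over a bisection W of 𝒢 the open projection to Sub(𝒢) is injective: elements of one subgroup
    -- have equal ranges, and W contains at most one arrow of each range.
    refine isLocalHomeomorph_iff_isOpenEmbedding_restrict.2 fun σ => ?_
    obtain ⟨W, hWo, hσW, hW⟩ := exists_bisection 𝒢 σ.arr
    have hV : IsOpen (SigmaArr.arr ⁻¹' W : Set 𝒢.SigmaArr) :=
      hWo.preimage SigmaArr.continuous_arr
    refine ⟨_, hV.mem_nhds hσW, .of_continuous_injective_isOpenMap
      (SigmaArr.continuous_grp.comp continuous_subtype_val) ?_ (SigmaArr.isOpenMap_grp.domRestrict hV)⟩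
    rintro ⟨σ, hσ⟩ ⟨τ, hτ⟩ h
    have h' : σ.grp = τ.grp := h
    refine Subtype.ext (SigmaArr.ext h' (hW.injOn_r hσ hτ ?_))
    rw [σ.grp.r_eq _ σ.mem, τ.grp.r_eq _ τ.mem, h']

theorem isOpen_subPrim (K : TwoSidedIdeal 𝒢.sigmaGpd.CStar)
    (hK : IsClosed (K : Set 𝒢.sigmaGpd.CStar)) :
    IsOpen {p : 𝒢.SubPrim | ¬ K ≤ TwoSidedIdeal.comap (fiberHom p.grp) p.ideal.1} :=
  let _ := hullKernel 𝒢.sigmaGpd.CStar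
  isOpen_induced_iff.2
    ⟨_, TopologicalSpace.isOpen_generateFrom_of_mem ⟨K, hK, rfl⟩, rfl⟩

variable [T2Space G] [LocallyCompactSpace G]

instance : T2Space 𝒢.SigmaArr :=
  T2Space.of_injective_continuous (f := fun σ : 𝒢.SigmaArr => (σ.grp, σ.arr))
    (fun _ _ h => SigmaArr.ext (congrArg Prod.fst h) (congrArg Prod.snd h))
    SigmaArr.isInducing.continuous

/-- Along an ultrafilter the arrows converge in K, and the subgroups converge because their bases
stay in the compact set r(K). The limit arrow belongs to the limit subgroup, as otherwise almost all
subgroups would miss a compact neighbourhood of it. Besides local compactness of Σ(𝒢), this keeps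
pullbacks from C_c(𝒢) compactly supported. -/
theorem SigmaArr.isCompact_preimage_arr {K : Set G} (hK : IsCompact K) :
    IsCompact (SigmaArr.arr ⁻¹' K : Set 𝒢.SigmaArr) := by
  refine isCompact_iff_ultrafilter_le_nhds.2 fun F hF => ?_
  rw [Filter.le_principal_iff] at hF
  obtain ⟨g, hgK, hg⟩ := isCompact_iff_ultrafilter_le_nhds.1 hK (F.map SigmaArr.arr)
    (Filter.le_principal_iff.2 hF)
  obtain ⟨S, -, hS⟩ := isCompact_iff_ultrafilter_le_nhds.1
    (Sub.isCompact_base (𝒢 := 𝒢) (hK.image (continuous_r 𝒢))) (F.map SigmaArr.grp)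
    (Filter.le_principal_iff.2 (by
      refine Filter.mem_map.2 (Filter.mem_of_superset hF fun σ hσ => ?_)
      exact ⟨σ.arr, hσ, σ.grp.r_eq _ σ.mem⟩))
  have hg' : Filter.Tendsto (SigmaArr.arr : 𝒢.SigmaArr → G) F (nhds g) := hg
  have hS' : Filter.Tendsto (SigmaArr.grp : 𝒢.SigmaArr → 𝒢.Sub) F (nhds S) := hS
  have hmem : g ∈ S.carrier := by
    by_contra h
    obtain ⟨L, hLc, hL, hSL⟩ := S.exists_compact_nhds_miss h
    obtain ⟨σ, h1, h2⟩ := ((hg'.eventually hL).and (hS'.eventually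
      ((Sub.isOpen_miss hLc).mem_nhds hSL))).exists
    have : σ.arr ∈ σ.grp.carrier ∩ L := ⟨σ.mem, h1⟩
    rw [show σ.grp.carrier ∩ L = ∅ from h2] at this; exact this
  refine ⟨⟨S, g, hmem⟩, hgK, ?_⟩
  rw [SigmaArr.isInducing.nhds_eq_comap, ← Filter.tendsto_iff_comap, nhds_prod_eq]
  exact hS'.prodMk hg'

instance : LocallyCompactSpace 𝒢.SigmaArr := by
  have : WeaklyLocallyCompactSpace 𝒢.SigmaArr := ⟨fun σ => by
    obtain ⟨K, hKc, hK⟩ := exists_compact_mem_nhds σ.arr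
    exact ⟨_, SigmaArr.isCompact_preimage_arr hKc, SigmaArr.continuous_arr.continuousAt hK⟩⟩
  infer_instance

/-! ### Fibers of `C⋆(Σ(𝒢))` -/

theorem extend_fiberHom {S : 𝒢.Sub} (π : URep S.El) (F : C_c(𝒢.SigmaArr, ℂ)) :
    π.extend (fiberHom S (𝒢.sigmaGpd.toCStar F)) = fiberOp π F := rfl

/-- A bump on a bisection of Σ(𝒢) through (S, g) meets the fiber over S in the single element g. So
q_S reaches every group element, even by functions living in a prescribed neighbourhood. -/
theorem exists_fiberHom_eq_of (S : 𝒢.Sub) (g : S.El) {U : Set 𝒢.SigmaArr} (hU : IsOpen U)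
    (hg : sigmaPt S g ∈ U) : ∃ F : C_c(𝒢.SigmaArr, ℂ), (∀ σ, F σ ≠ 0 → σ ∈ U) ∧
      fiberHom S (𝒢.sigmaGpd.toCStar F) = GroupCStar.of g := by
  obtain ⟨W, hWo, hgW, hW⟩ := exists_bisection 𝒢.sigmaGpd (sigmaPt S g)
  obtain ⟨F, hF1, hF2, -⟩ := exists_bump (hU.inter hWo) ⟨hg, hgW⟩
  have hF : ∀ σ, F σ ≠ 0 → σ ∈ U ∩ W := fun σ hσ => hF2 (subset_tsupport _ hσ)
  refine ⟨F, fun σ hσ => (hF σ hσ).1, GroupCStar.ext_rep fun π => ?_⟩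
  rw [extend_fiberHom, fiberOp_eq_single π g, hF1, one_smul]; rfl
  intro k hk
  by_contra h
  exact hk (sigmaPt_injective S (hW.injOn_r (hF _ h).2 hgW rfl))

/-- Since q_S hits every group element, π and π ∘ q_S have the same closed invariant subspaces.
Primitivity makes `exists_closed_ideal_of_isOpen` applicable to points of Sub(𝒢)^prim. -/
theorem isPrimitive_comap_fiberHom {S : 𝒢.Sub} {J : TwoSidedIdeal (GroupCStar S.El)}
    (hJ : IsPrimitive.{u + 1, u} J) : IsPrimitive.{u + 1, u} (TwoSidedIdeal.comap (fiberHom S) J) := by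
  obtain ⟨π, hπ, rfl⟩ := hJ.exists_urep
  refine ⟨π.H, π.extend.comp (fiberHom S), ⟨?_, fun K hK hinv => ?_⟩, ?_⟩
  · obtain ⟨F, -, hF⟩ := exists_fiberHom_eq_of S 1 isOpen_univ trivial
    refine ⟨𝒢.sigmaGpd.toCStar F, ?_⟩
    rw [NonUnitalStarAlgHom.comp_apply, hF]
    have := URep.of_one_notMem_ker hπ 1 one_ne_zero
    rwa [one_smul, TwoSidedIdeal.mem_ker] at this
  · refine hπ.2 K hK fun a ξ hξ => π.extend_mem hK (fun g ξ hξ => ?_) a hξ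
    obtain ⟨F, -, hF⟩ := exists_fiberHom_eq_of S g isOpen_univ trivial
    have := hinv (𝒢.sigmaGpd.toCStar F) ξ hξ
    rwa [NonUnitalStarAlgHom.comp_apply, hF] at this
  · refine TwoSidedIdeal.ext fun a => ?_
    rw [TwoSidedIdeal.mem_ker, TwoSidedIdeal.mem_comap, TwoSidedIdeal.mem_ker]; rfl

theorem isClosed_range_toSubPrim (hcont : Continuous 𝒢.iso) :
    IsClosed (Set.range (StabPrim.toSubPrim (𝒢 := 𝒢))) := by
  rw [← isOpen_compl_iff, isOpen_iff_forall_mem_open]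
  rintro ⟨S, J⟩ hp
  have hS : S ≠ 𝒢.iso S.base := by
    intro h
    obtain ⟨x, rfl⟩ : ∃ x, S = 𝒢.iso x := ⟨_, h⟩
    exact hp ⟨⟨x, J⟩, rfl⟩
  -- Sub(𝒢) is Hausdorff, and T ↦ isotropy group at the base of T is continuous.
  have hN : IsOpen {T : 𝒢.Sub | T ≠ 𝒢.iso T.base} :=
    (isClosed_eq continuous_id (hcont.comp Sub.continuous_base)).isOpen_compl
  obtain ⟨F, hF, hFS⟩ := exists_fiberHom_eq_of S 1 (hN.preimage SigmaArr.continuous_grp) hS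
  -- K consists of the elements vanishing on all isotropy fibers. It contains F, which lives over
  -- non-isotropy subgroups, whereas F restricts to 1, outside J, over S.
  let K : TwoSidedIdeal 𝒢.sigmaGpd.CStar :=
    sInf (Set.range fun x => TwoSidedIdeal.ker (fiberHom (𝒢.iso x)))
  have hK : IsClosed (K : Set 𝒢.sigmaGpd.CStar) := by
    refine isClosed_sInf _ ?_
    rintro _ ⟨x, rfl⟩
    exact isClosed_ker _
  refine ⟨_, ?_, isOpen_subPrim K hK, fun hle => ?_⟩
  · rintro p hp ⟨q, rfl⟩
    refine hp fun a ha => ?_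
    have h1 : a ∈ TwoSidedIdeal.ker (fiberHom (𝒢.iso q.unit)) := by
      exact (TwoSidedIdeal.mem_sInf _).1 ha _ ⟨q.unit, rfl⟩
    rw [TwoSidedIdeal.mem_ker] at h1
    refine (TwoSidedIdeal.mem_comap _).2 ?_
    change fiberHom (𝒢.iso q.unit) a ∈ q.ideal.1
    rw [h1]; exact TwoSidedIdeal.zero_mem _
  · have hFK : 𝒢.sigmaGpd.toCStar F ∈ K := by
      refine (TwoSidedIdeal.mem_sInf _).2 ?_
      rintro _ ⟨x, rfl⟩
      refine (TwoSidedIdeal.mem_ker _).2 (GroupCStar.ext_rep fun π => ?_)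
      rw [extend_fiberHom, fiberOp_eq_single π 1 (fun k _ => ?_)]
      · rw [show F (sigmaPt (𝒢.iso x) 1) = 0 from by_contra fun h => hF _ h rfl, zero_smul, map_zero]
      · by_contra h; exact hF _ h rfl
    have h1 := (TwoSidedIdeal.mem_comap _).1 (hle hFK)
    obtain ⟨π, hπ, hJ⟩ := J.2.exists_urep
    change fiberHom S _ ∈ J.1 at h1
    rw [hFS, ← hJ] at h1
    refine URep.of_one_notMem_ker hπ 1 one_ne_zero ?_
    rwa [one_smul]

end

end Gpd

/-! ### Kernels under isomorphisms of groups -/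

section
variable {Γ Δ : Type u} [Group Γ] [Group Δ]

theorem URep.extend_map (π : URep Δ) (φ : Γ →* Δ) (a : GroupCStar Γ) :
    π.extend (GroupCStar.map φ a) = (π.comp φ).extend a := rfl

theorem URep.extend_comp_id (π : URep Γ) {φ : Γ →* Γ} (h : φ = MonoidHom.id Γ) (a : GroupCStar Γ) :
    (π.comp φ).extend a = π.extend a := by
  subst h; rfl

theorem URep.image_ker {φ : Γ →* Δ} {ψ : Δ →* Γ} (h : ψ.comp φ = MonoidHom.id Γ)
    (h' : φ.comp ψ = MonoidHom.id Δ) (π : URep Γ) :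
    GroupCStar.map φ '' (TwoSidedIdeal.ker π.extend : Set (GroupCStar Γ)) =
      (TwoSidedIdeal.ker (π.comp ψ).extend : Set (GroupCStar Δ)) := by
  ext b
  constructor
  · rintro ⟨a, ha, rfl⟩
    refine (TwoSidedIdeal.mem_ker _).2 ?_
    rw [extend_map]
    exact (π.extend_comp_id h a).trans ((TwoSidedIdeal.mem_ker _).1 ha)
  · intro hb
    refine ⟨GroupCStar.map ψ b, ?_, ?_⟩
    · exact (TwoSidedIdeal.mem_ker _).2 ((TwoSidedIdeal.mem_ker _).1 hb)
    · refine GroupCStar.ext_rep fun σ => ?_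
      exact σ.extend_comp_id h' b

end

namespace Gpd

/-! ### Induction is constant on orbits -/

section
variable {X G : Type u} {𝒢 : Gpd X G}

theorem conj_inv_comp (g : G) {x y : X} (hs : 𝒢.s g = x) (hr : 𝒢.r g = y) {hs' : 𝒢.s (𝒢.inv g) = y}
    {hr' : 𝒢.r (𝒢.inv g) = x} :
    (𝒢.conj (𝒢.inv g) hs' hr').comp (𝒢.conj g hs hr) = MonoidHom.id _ := by
  refine MonoidHom.ext fun t => Subtype.ext ?_
  have h1 : 𝒢.s g = 𝒢.r t.1 := hs.trans t.2.1.symm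
  have h2 : 𝒢.s t.1 = 𝒢.r (𝒢.inv g) := t.2.2.trans hr'.symm
  have h3 : 𝒢.s (𝒢.mul g t.1) = 𝒢.r (𝒢.inv g) := by rw [𝒢.s_mul _ _ h1, h2]
  change 𝒢.mul (𝒢.mul (𝒢.inv g) (𝒢.mul (𝒢.mul g t.1) (𝒢.inv g))) (𝒢.inv (𝒢.inv g)) = t.1
  rw [𝒢.inv_inv, 𝒢.mul_assoc _ _ _ h1 h2, 𝒢.inv_mul_cancel (by rw [𝒢.r_mul _ _ h2, h1]),
    𝒢.mul_assoc _ _ _ h2 (𝒢.s_inv g), 𝒢.inv_mul, ← 𝒢.r_inv, ← h2, 𝒢.mul_unit]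

theorem conj_comp_inv (g : G) {x y : X} (hs : 𝒢.s g = x) (hr : 𝒢.r g = y) {hs' : 𝒢.s (𝒢.inv g) = y}
    {hr' : 𝒢.r (𝒢.inv g) = x} :
    (𝒢.conj g hs hr).comp (𝒢.conj (𝒢.inv g) hs' hr') = MonoidHom.id _ := by
  have := conj_inv_comp (𝒢.inv g) hs' hr' (hs' := by rwa [𝒢.inv_inv]) (hr' := by rwa [𝒢.inv_inv])
  simpa only [𝒢.inv_inv] using this

/-- The representation of the isotropy group at `y = r(g)` obtained by conjugation by `g`. -/
def conjRep {x y : X} (π : URep (𝒢.iso x).El) (g : G) (hs : 𝒢.s g = x) (hr : 𝒢.r g = y) :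
    URep (𝒢.iso y).El :=
  π.comp (𝒢.conj (𝒢.inv g) ((𝒢.s_inv g).trans hr) ((𝒢.r_inv g).trans hs))

theorem conjRep_op {x y : X} (π : URep (𝒢.iso x).El) (g : G) (hs : 𝒢.s g = x) (hr : 𝒢.r g = y)
    (t : (𝒢.iso y).El) : (conjRep π g hs hr).op t =
      π.op (𝒢.conj (𝒢.inv g) ((𝒢.s_inv g).trans hr) ((𝒢.r_inv g).trans hs) t) := rfl

theorem image_ker_conjRep {x y : X} (π : URep (𝒢.iso x).El) (g : G) (hs : 𝒢.s g = x)
    (hr : 𝒢.r g = y) :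
    GroupCStar.map (𝒢.conj g hs hr) '' (TwoSidedIdeal.ker π.extend : Set (GroupCStar _)) =
      (TwoSidedIdeal.ker (conjRep π g hs hr).extend : Set (GroupCStar _)) :=
  URep.image_ker (conj_inv_comp g hs hr) (conj_comp_inv g hs hr) π

theorem conj_inv_bijective {x y : X} (g : G) (hs : 𝒢.s g = x) (hr : 𝒢.r g = y) :
    Function.Bijective (𝒢.conj (𝒢.inv g) ((𝒢.s_inv g).trans hr) ((𝒢.r_inv g).trans hs)) := by
  refine Function.bijective_iff_has_inverse.2 ⟨𝒢.conj g hs hr, fun t => ?_, fun t => ?_⟩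
  · exact DFunLike.congr_fun (conj_comp_inv g hs hr (hs' := (𝒢.s_inv g).trans hr)
      (hr' := (𝒢.r_inv g).trans hs)) t
  · exact DFunLike.congr_fun (conj_inv_comp g hs hr (hs' := (𝒢.s_inv g).trans hr)
      (hr' := (𝒢.r_inv g).trans hs)) t

/-- Realizes the translate of p by g through an explicit representation, the one that occurs as the
diagonal entry at g in `indHom_isoCc_apply`. -/
theorem exists_orbitRel (p : 𝒢.StabPrim) {π : URep (𝒢.iso p.unit).El}
    (hπ : IsIrreducible π.extend) (hker : TwoSidedIdeal.ker π.extend = p.ideal.1) (g : G)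
    (hs : 𝒢.s g = p.unit) : ∃ J : Prim.{u + 1, u} (GroupCStar (𝒢.iso (𝒢.r g)).El),
      J.1 = TwoSidedIdeal.ker (conjRep π g hs rfl).extend ∧ orbitRel p ⟨𝒢.r g, J⟩ := by
  have hprim : IsPrimitive.{u + 1, u} (TwoSidedIdeal.ker (conjRep π g hs rfl).extend) :=
    ⟨(conjRep π g hs rfl).H, (conjRep π g hs rfl).extend,
      URep.isIrreducible_comp hπ _ (conj_inv_bijective g hs rfl).2, rfl⟩
  refine ⟨⟨_, hprim⟩, rfl, g, hs, rfl, ?_⟩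
  rw [← hker]
  exact image_ker_conjRep π g hs rfl

variable [TopologicalSpace X] [TopologicalSpace G] [𝒢.IsEtale] [T2Space G] [LocallyCompactSpace G]

/-- On C_c(𝒢) the substitution t ↦ g⁻¹tg matches the two sums term by term, because h t k⁻¹ =
(hg)(g⁻¹tg)(kg)⁻¹. The rest is density. -/
theorem coeff_conjRep {x y : X} (π : URep (𝒢.iso x).El) (g : G) (hs : 𝒢.s g = x)
    (hr : 𝒢.r g = y) (a : 𝒢.CStar) {h k : G} (hh : 𝒢.s h = y) (hk : 𝒢.s k = y) :
    coeff (conjRep π g hs hr) a h k = coeff π a (𝒢.mul h g) (𝒢.mul k g) := by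
  have eh : 𝒢.s h = 𝒢.r g := hh.trans hr.symm
  have ek : 𝒢.s k = 𝒢.r g := hk.trans hr.symm
  have hh' : 𝒢.s (𝒢.mul h g) = (𝒢.iso x).base := (𝒢.s_mul _ _ eh).trans hs
  have hk' : 𝒢.s (𝒢.mul k g) = (𝒢.iso x).base := (𝒢.s_mul _ _ ek).trans hs
  refine cstar_induction 𝒢 (P := fun a => coeff (conjRep π g hs hr) a h k =
    coeff π a (𝒢.mul h g) (𝒢.mul k g))
    (isClosed_eq (continuous_coeff (conjRep π g hs hr) h k) (continuous_coeff π _ _))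
    (fun f => ContinuousLinearMap.ext fun v => ?_) a
  refine (indOp_delta_apply (conjRep π g hs hr) f (g := k) (h := h) hk hh v).trans
    (Eq.trans ?_ (indOp_delta_apply π f hk' hh' v).symm)
  refine finsum_eq_of_bijective _ (conj_inv_bijective g hs hr) fun t => ?_
  rw [conjRep_op]
  refine congrArg (fun l => f l • _) ?_
  have t1 : 𝒢.r t.1 = y := t.2.1
  have t2 : 𝒢.s t.1 = y := t.2.2
  have e1 : 𝒢.s (𝒢.inv g) = 𝒢.r t.1 := by rw [𝒢.s_inv, hr, t1]
  have e2 : 𝒢.s t.1 = 𝒢.r g := by rw [hr, t2]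
  have e3 : 𝒢.s (𝒢.mul (𝒢.inv g) t.1) = 𝒢.r g := by rw [𝒢.s_mul _ _ e1, e2]
  have e4 : 𝒢.s h = 𝒢.r t.1 := by rw [hh, t1]
  change _ = 𝒢.mul (𝒢.mul (𝒢.mul h g) (𝒢.mul (𝒢.mul (𝒢.inv g) t.1) (𝒢.inv (𝒢.inv g))))
    (𝒢.inv (𝒢.mul k g))
  have e6 : 𝒢.s (𝒢.inv g) = 𝒢.r (𝒢.inv k) := by rw [𝒢.s_inv, 𝒢.r_inv, ek]
  have e7 : 𝒢.r (𝒢.mul t.1 g) = 𝒢.s h := by rw [𝒢.r_mul _ _ e2, e4]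
  have e8 : 𝒢.s (𝒢.mul t.1 g) = 𝒢.r (𝒢.mul (𝒢.inv g) (𝒢.inv k)) := by
    rw [𝒢.s_mul _ _ e2, 𝒢.r_mul _ _ e6, 𝒢.r_inv]
  rw [𝒢.inv_inv, 𝒢.mul_assoc _ _ _ e1 e2, 𝒢.mul_assoc h g _ eh
    (by rw [𝒢.r_mul _ _ (by rw [𝒢.s_inv, e7, eh]), 𝒢.r_inv]),
    𝒢.mul_inv_cancel (by rw [e7, eh]), 𝒢.mul_inv_rev ek,
    𝒢.mul_assoc _ _ _ e7.symm e8, 𝒢.mul_assoc _ _ _ e2 (by rw [𝒢.r_mul _ _ e6, 𝒢.r_inv]),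
    𝒢.mul_inv_cancel (by rw [𝒢.r_inv, ek]), 𝒢.mul_assoc _ _ _ e4 (by rw [t2, 𝒢.r_inv, hk])]

/-- Right multiplication by g is a bijection from 𝒢_y onto 𝒢_x, so the two representations have the
same coefficients up to relabelling. -/
theorem ker_ind_conjRep {x y : X} (π : URep (𝒢.iso x).El) (g : G) (hs : 𝒢.s g = x)
    (hr : 𝒢.r g = y) :
    TwoSidedIdeal.ker (indRep (𝒢.iso y) (conjRep π g hs hr)).extend =
      TwoSidedIdeal.ker (indRep (𝒢.iso x) π).extend := by
  refine TwoSidedIdeal.ext fun a => ?_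
  rw [mem_ker_ind_iff, mem_ker_ind_iff]
  constructor
  · intro h
    refine indHom_eq_zero_of_coeff π a fun k l hk hl => ?_
    have key : ∀ k, 𝒢.s k = x → 𝒢.s (𝒢.mul k (𝒢.inv g)) = y ∧ 𝒢.mul (𝒢.mul k (𝒢.inv g)) g = k := by
      intro k hk
      have e : 𝒢.s k = 𝒢.r (𝒢.inv g) := by rw [hk, 𝒢.r_inv, hs]
      refine ⟨by rw [𝒢.s_mul _ _ e, 𝒢.s_inv, hr], ?_⟩
      rw [𝒢.mul_assoc _ _ _ e (𝒢.s_inv g), 𝒢.inv_mul, hs, ← hk, 𝒢.mul_unit]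
    have h1 := coeff_conjRep π g hs hr a (key k hk).1 (key l hl).1
    rw [(key k hk).2, (key l hl).2] at h1
    exact h1.symm.trans (coeff_eq_zero _ h _ _)
  · intro h
    refine indHom_eq_zero_of_coeff _ a fun k l hk hl => ?_
    exact (coeff_conjRep π g hs hr a hk hl).trans (coeff_eq_zero π h _ _)

theorem ind_eq_of_orbitRel {p q : 𝒢.StabPrim} (h : orbitRel p q) : p.ind = q.ind := by
  obtain ⟨g, hs, hr, him⟩ := h
  obtain ⟨π, -, hker, hind⟩ := p.exists_urep
  have h2 : TwoSidedIdeal.ker (conjRep π g hs hr).extend = q.ideal.1 :=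
    SetLike.coe_injective (by rw [← image_ker_conjRep, hker, him])
  rw [hind, ← ker_ind_conjRep π g hs hr]
  exact (indIdeal_eq h2).symm

/-! ### Continuity of induction -/

/-- The pullback of functions on `𝒢` to `Σ(𝒢)`. -/
def resCc (f : C_c(G, ℂ)) : C_c(𝒢.SigmaArr, ℂ) :=
  mkCc (fun σ => f σ.arr) (f.continuous.comp SigmaArr.continuous_arr)
    (HasCompactSupport.of_support_subset_isCompact
      (SigmaArr.isCompact_preimage_arr f.hasCompactSupport') fun _ hσ => subset_tsupport _ hσ)

/-- When h and g are the unit, h t g⁻¹ is t itself and the coefficient is ∑ f(t) π(t). This is the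
bridge from C⋆(𝒢) to C⋆(Σ(𝒢)). -/
theorem coeff_unit {S : 𝒢.Sub} (π : URep S.El) (f : C_c(G, ℂ)) :
    coeff π (𝒢.toCStar f) (𝒢.unit S.base) (𝒢.unit S.base) =
      π.extend (fiberHom S (𝒢.sigmaGpd.toCStar (resCc f))) := by
  rw [coeff_toCStar π f (𝒢.s_unit _) (𝒢.s_unit _), extend_fiberHom]
  have he : ∀ t : S.El, 𝒢.mul (𝒢.mul (𝒢.unit S.base) t.1) (𝒢.inv (𝒢.unit S.base)) = t.1 := by
    intro t
    have h1 := 𝒢.unit_mul t.1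
    have h2 := 𝒢.mul_unit t.1
    rw [S.r_eq _ t.2] at h1
    rw [S.s_eq _ t.2] at h2
    rw [inv_unit, h1, h2]
  simp only [he]
  exact (fiberOp_eq_sum π (resCc f) _ fun t ht => by
    have ht' : f t.1 ≠ 0 := ht
    rw [Set.Finite.mem_toFinset]; simpa only [Set.mem_ofPred_eq, he] using ht').symm

/-- Noncontainment is witnessed by a nonzero unit coefficient of some a in I. Replacing a by a
nearby f in C_c(𝒢) turns this into a norm inequality in a fiber of C⋆(Σ(𝒢)), which is an open
condition. -/
theorem isOpen_stabPrim (I : TwoSidedIdeal 𝒢.CStar) : IsOpen {p : 𝒢.StabPrim | ¬ I ≤ p.ind} := by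
  have hle : ∀ (p : 𝒢.StabPrim) (π : URep (𝒢.iso p.unit).El),
      TwoSidedIdeal.ker π.extend = p.ideal.1 → (¬ I ≤ p.ind ↔
        ∃ a ∈ I, coeff π a (𝒢.unit p.unit) (𝒢.unit p.unit) ≠ 0) := by
    intro p π hker
    rw [show p.ind = _ from indIdeal_eq hker, le_ker_ind_iff]
    push Not; rfl
  refine isOpen_iff_forall_mem_open.2 fun p₀ hp₀ => ?_
  obtain ⟨π₀, -, hker₀, -⟩ := p₀.exists_urep
  obtain ⟨a, haI, ha⟩ := (hle p₀ π₀ hker₀).1 hp₀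
  set N := ‖coeff π₀ a (𝒢.unit p₀.unit) (𝒢.unit p₀.unit)‖
  have hN : 0 < N := norm_pos_iff.2 ha
  -- The threshold N/2 lies between N/3 and 2N/3: at p₀ the coefficient of f exceeds 2N/3, and
  -- wherever it exceeds N/2 the coefficient of a cannot vanish.
  obtain ⟨f, hf⟩ := exists_norm_sub_toCStar_lt 𝒢 a (ε := N / 3) (by positivity)
  obtain ⟨c, hc⟩ := exists_mem_ker_iff_norm_le.{u + 1, u} (𝒢.sigmaGpd.toCStar (resCc f)) (N / 2)
    (by positivity)
  have hmem : ∀ (p : 𝒢.StabPrim) (π : URep (𝒢.iso p.unit).El),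
      TwoSidedIdeal.ker π.extend = p.ideal.1 →
        (¬ closedIdeal c ≤ TwoSidedIdeal.comap (fiberHom (𝒢.iso p.unit)) p.ideal.1 ↔
          N / 2 < ‖coeff π (𝒢.toCStar f) (𝒢.unit p.unit) (𝒢.unit p.unit)‖) := by
    intro p π hker
    rw [closedIdeal_le_iff (isPrimitive_comap_fiberHom p.ideal.2).isClosed,
      show coeff π (𝒢.toCStar f) (𝒢.unit p.unit) (𝒢.unit p.unit) = _ from coeff_unit π f, ← not_le]
    have h1 := hc π.H (π.extend.comp (fiberHom (𝒢.iso p.unit)))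
    rw [NonUnitalStarAlgHom.comp_apply, NonUnitalStarAlgHom.comp_apply] at h1
    rw [← h1, ← hker, TwoSidedIdeal.mem_comap, TwoSidedIdeal.mem_ker]
  refine ⟨_, ?_, (isOpen_subPrim (closedIdeal c) (isClosed_closedIdeal c)).preimage
    (continuous_induced_dom (f := StabPrim.toSubPrim (𝒢 := 𝒢))), (hmem p₀ π₀ hker₀).2 ?_⟩
  · intro p hp
    obtain ⟨π, -, hker, -⟩ := p.exists_urep
    have h1 := (hmem p π hker).1 hp
    refine (hle p π hker).2 ⟨a, haI, fun h0 => ?_⟩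
    have h2 := norm_coeff_le π (a - 𝒢.toCStar f) (𝒢.unit p.unit) (𝒢.unit p.unit)
    rw [coeff_sub, h0, zero_sub, norm_neg] at h2
    linarith
  · have h2 := norm_coeff_le π₀ (a - 𝒢.toCStar f) (𝒢.unit p₀.unit) (𝒢.unit p₀.unit)
    rw [coeff_sub] at h2
    have h3 := norm_sub_norm_le (coeff π₀ a (𝒢.unit p₀.unit) (𝒢.unit p₀.unit))
      (coeff π₀ (𝒢.toCStar f) (𝒢.unit p₀.unit) (𝒢.unit p₀.unit))
    have h4 : N = ‖coeff π₀ a (𝒢.unit p₀.unit) (𝒢.unit p₀.unit)‖ := rfl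
    linarith

end

end Gpd

/-! ### Separation in the Jacobson topology -/

theorem Prim.isOpen_not_le {A : Type v} [NonUnitalCStarAlgebra A] {K : TwoSidedIdeal A}
    (hK : IsClosed (K : Set A)) : IsOpen {J : Prim.{v, w} A | ¬ K ≤ J.1} :=
  let _ := hullKernel A
  isOpen_induced_iff.2 ⟨_, TopologicalSpace.isOpen_generateFrom_of_mem ⟨K, hK, rfl⟩, rfl⟩

/-- A primitive ideal is closed and so is itself a test ideal, whence inseparable primitive ideals
contain each other. -/
instance {A : Type v} [NonUnitalCStarAlgebra A] : T0Space (Prim.{v, w} A) := by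
  have key : ∀ {I J : Prim.{v, w} A}, Inseparable I J → I.1 ≤ J.1 := fun {I J} h => by
    by_contra hIJ
    exact (h.mem_open_iff (Prim.isOpen_not_le I.2.isClosed)).2 hIJ le_rfl
  exact ⟨fun I J h => Subtype.ext (le_antisymm (key h) (key h.symm))⟩

namespace Gpd

/-! ### Extension of functions from the isotropy bundle -/

section
variable {X G : Type u} {𝒢 : Gpd X G}

open Classical in
/-- The function on `𝒢` that is `F(𝒢_x^x, g)` at `g ∈ 𝒢_x^x` and zero outside of the isotropy. -/
def isoFun (F : 𝒢.SigmaArr → ℂ) (g : G) : ℂ :=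
  if h : 𝒢.r g = 𝒢.s g then F ⟨𝒢.iso (𝒢.r g), g, rfl, h.symm⟩ else 0

theorem isoFun_of_eq (F : 𝒢.SigmaArr → ℂ) {g : G} (h : 𝒢.r g = 𝒢.s g) :
    isoFun F g = F ⟨𝒢.iso (𝒢.r g), g, rfl, h.symm⟩ := dif_pos h

theorem isoFun_of_ne (F : 𝒢.SigmaArr → ℂ) {g : G} (h : 𝒢.r g ≠ 𝒢.s g) : isoFun F g = 0 :=
  dif_neg h

theorem isoFun_coe (F : 𝒢.SigmaArr → ℂ) {x : X} (k : (𝒢.iso x).El) :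
    isoFun F k.1 = F (sigmaPt (𝒢.iso x) k) := by
  obtain ⟨k, rfl, hs⟩ := k
  exact isoFun_of_eq F hs.symm

theorem exists_of_isoFun_ne_zero {F : 𝒢.SigmaArr → ℂ} {g : G} (h : isoFun F g ≠ 0) :
    𝒢.r g = 𝒢.s g ∧ ∃ σ, F σ ≠ 0 ∧ σ.arr = g := by
  have hg : 𝒢.r g = 𝒢.s g := by
    by_contra h'
    exact h (isoFun_of_ne F h')
  rw [isoFun_of_eq F hg] at h
  exact ⟨hg, _, h, rfl⟩

theorem convVec_isoFun {V : Type*} [AddCommGroup V] [Module ℂ V] (F : 𝒢.SigmaArr → ℂ) (ξ : G → V)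
    {y : X} {g : G} (hg : 𝒢.r g = y) : 𝒢.convVec (isoFun F) ξ g =
      ∑ᶠ k : (𝒢.iso y).El, F (sigmaPt (𝒢.iso y) k) • ξ (𝒢.mul (𝒢.inv k.1) g) := by
  subst hg
  rw [convVec, finsum_mem_inter_support_eq' _ _ (𝒢.iso (𝒢.r g)).carrier]
  · rw [← finsum_set_coe_eq_finsum_mem]
    exact finsum_congr fun k => by rw [← isoFun_coe F (x := 𝒢.r g) k]
  · intro h hh
    have h1 : isoFun F h ≠ 0 := fun h0 => hh (by simp only [h0, zero_smul])
    refine ⟨fun e => ⟨e, ?_⟩, fun e => e.1⟩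
    rw [← (exists_of_isoFun_ne_zero h1).1]; exact e

variable [TopologicalSpace X] [TopologicalSpace G] [𝒢.IsEtale]

/-- Let W be a bisection around an isotropy arrow g. By Fell continuity the isotropy group at any
unit near r(g) meets W, and W has only one arrow with that range. -/
theorem isOpen_isotropy (hcont : Continuous 𝒢.iso) : IsOpen {g | 𝒢.r g = 𝒢.s g} := by
  refine isOpen_iff_forall_mem_open.2 fun g hg => ?_
  obtain ⟨W, hWo, hgW, hW⟩ := exists_bisection 𝒢 g
  refine ⟨W ∩ 𝒢.r ⁻¹' (𝒢.iso ⁻¹' {T | (T.carrier ∩ W).Nonempty}), ?_,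
    hWo.inter (((Sub.isOpen_meet hWo).preimage hcont).preimage (continuous_r 𝒢)),
    hgW, g, ⟨rfl, Eq.symm hg⟩, hgW⟩
  rintro h ⟨hhW, t, ⟨ht1, ht2⟩, htW⟩
  obtain rfl : t = h := hW.injOn_r htW hhW ht1
  exact ht2.symm

variable [T2Space G]

/-- The isotropy is clopen, so extension by zero is harmless. On it the function is F composed with
the continuous map g ↦ (isotropy group at r(g), g). -/
theorem continuous_isoFun (hcont : Continuous 𝒢.iso) {F : 𝒢.SigmaArr → ℂ} (hF : Continuous F) :
    Continuous (isoFun F) := by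
  have := t2_units 𝒢
  have ho := isOpen_isotropy hcont
  have hc : IsClosed {g | 𝒢.r g = 𝒢.s g} :=
    isClosed_eq (continuous_r 𝒢) (IsEtale.continuous_s (𝒢 := 𝒢))
  refine continuous_iff_continuousAt.2 fun g => ?_
  by_cases hg : 𝒢.r g = 𝒢.s g
  · have h1 : Continuous fun g : {g | 𝒢.r g = 𝒢.s g} => isoFun F g.1 := by
      have h2 : Continuous fun g : {g | 𝒢.r g = 𝒢.s g} =>
          (⟨𝒢.iso (𝒢.r g.1), g.1, rfl, Eq.symm g.2⟩ : 𝒢.SigmaArr) :=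
        SigmaArr.isInducing.continuous_iff.2
          ((hcont.comp ((continuous_r 𝒢).comp continuous_subtype_val)).prodMk
            continuous_subtype_val)
      refine (hF.comp h2).congr fun g => ?_
      exact (isoFun_of_eq F g.2).symm
    exact (continuousOn_iff_continuous_domRestrict.2 h1).continuousAt (ho.mem_nhds hg)
  · refine (continuousAt_const (y := (0 : ℂ))).congr ?_
    filter_upwards [hc.isOpen_compl.mem_nhds hg] with h hh
    exact (isoFun_of_ne F hh).symm

/-- The function `isoFun F` for `F ∈ C_c(Σ(𝒢))`. -/
def isoCc (hcont : Continuous 𝒢.iso) (F : C_c(𝒢.SigmaArr, ℂ)) : C_c(G, ℂ) :=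
  mkCc (isoFun F) (continuous_isoFun hcont F.continuous)
    (HasCompactSupport.of_support_subset_isCompact
      (F.hasCompactSupport'.image SigmaArr.continuous_arr) fun g hg => by
        obtain ⟨-, σ, hσ, rfl⟩ := exists_of_isoFun_ne_zero hg
        exact ⟨σ, subset_tsupport _ hσ, rfl⟩)

variable [LocallyCompactSpace G]

/-- Isotropy at r(g) moves g only within its own coset, so equivariance turns the sum into an
operator on ξ(g): the action is diagonal over 𝒢_x. -/
theorem indHom_isoCc_apply (hcont : Continuous 𝒢.iso) (F : C_c(𝒢.SigmaArr, ℂ)) {x : X}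
    (π : URep (𝒢.iso x).El) (ξ : IndSp π) {g : G} (hg : 𝒢.s g = x) :
    (indHom π (𝒢.toCStar (isoCc hcont F)) ξ).1 g = fiberOp (conjRep π g hg rfl) F (ξ.1 g) := by
  change 𝒢.convVec (isoFun F) ξ.1 g = _
  rw [convVec_isoFun F ξ.1 rfl,
    finsum_eq_sum_of_support_subset (s := (finite_fiber F (𝒢.iso (𝒢.r g))).toFinset)]
  · refine Eq.trans ?_ (congrArg (fun T : π.H →L[ℂ] π.H => T (ξ.1 g))
      (fiberOp_eq_sum (conjRep π g hg rfl) F (finite_fiber F (𝒢.iso (𝒢.r g))).toFinset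
        (by simp))).symm
    refine Eq.trans ?_ (sum_apply (F := π.H →L[ℂ] π.H) _ _ _).symm
    refine Finset.sum_congr rfl fun k _ => ?_
    -- k⁻¹g = g(g⁻¹k⁻¹g), which moves the action of k to the right of g.
    have hc : 𝒢.mul (𝒢.inv k.1) g = 𝒢.mul g (𝒢.conj (𝒢.inv g) ((𝒢.s_inv g).trans rfl)
        ((𝒢.r_inv g).trans hg) k⁻¹).1 := by
      have e1 : 𝒢.s (𝒢.inv g) = 𝒢.r (𝒢.inv k.1) := by rw [𝒢.s_inv, 𝒢.r_inv]; exact k.2.2.symm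
      have e2 : 𝒢.s (𝒢.inv k.1) = 𝒢.r g := by rw [𝒢.s_inv]; exact k.2.1
      change _ = 𝒢.mul g (𝒢.mul (𝒢.mul (𝒢.inv g) (𝒢.inv k.1)) (𝒢.inv (𝒢.inv g)))
      rw [𝒢.inv_inv, 𝒢.mul_assoc _ _ _ e1 e2, 𝒢.mul_inv_cancel]
      rw [𝒢.r_mul _ _ e2, ← e1, 𝒢.s_inv]
    change F _ • ξ.1 (𝒢.mul (𝒢.inv k.1) g) = F _ • _
    rw [hc, ξ.2.2.1 g _ hg, map_inv, map_inv]
    exact congrArg (fun T : π.H →L[ℂ] π.H => F _ • T (ξ.1 g)) (star_star _)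
  · intro k hk
    simp only [Set.Finite.coe_toFinset]
    exact fun h0 => hk (by simp only [h0, zero_smul])

theorem norm_indHom_isoCc_le (hcont : Continuous 𝒢.iso) (F : C_c(𝒢.SigmaArr, ℂ)) {x : X}
    (π : URep (𝒢.iso x).El) {M : ℝ} (hM : 0 ≤ M)
    (h : ∀ (g : G) (hg : 𝒢.s g = x), ‖fiberOp (conjRep π g hg rfl) F‖ ≤ M) :
    ‖indHom π (𝒢.toCStar (isoCc hcont F))‖ ≤ M := by
  refine ContinuousLinearMap.opNorm_le_bound _ hM fun ξ => ?_
  refine abs_le_of_sq_le_sq' ?_ (by positivity) |>.2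
  rw [norm_sq_ind, mul_pow, norm_sq_ind, ← tsum_mul_left]
  refine Summable.tsum_le_tsum (fun c => ?_) (indHom π _ ξ).2.2.2 (ξ.2.2.2.mul_left _)
  rw [indHom_isoCc_apply hcont F π ξ ((𝒢.iso x).s_rep c), ← mul_pow]
  exact pow_le_pow_left₀ (norm_nonneg _)
    (ContinuousLinearMap.le_of_opNorm_le _ (h _ ((𝒢.iso x).s_rep c)) _) 2

/-- This operator is the coefficient at the unit, since extending F from the isotropy and pulling
back to Σ(𝒢) recovers F over isotropy groups. -/
theorem norm_fiberOp_le (hcont : Continuous 𝒢.iso) (F : C_c(𝒢.SigmaArr, ℂ)) {x : X}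
    (π : URep (𝒢.iso x).El) : ‖fiberOp π F‖ ≤ ‖indHom π (𝒢.toCStar (isoCc hcont F))‖ := by
  have h := norm_coeff_le_norm_indHom π (𝒢.toCStar (isoCc hcont F)) (𝒢.unit x) (𝒢.unit x)
  have e : fiberOp π (resCc (𝒢 := 𝒢) (isoCc hcont F)) = fiberOp π F :=
    finsum_congr fun k => congrArg (fun c : ℂ => c • (π.op k : π.H →L[ℂ] π.H)) (isoFun_coe F k)
  rw [show coeff π (𝒢.toCStar (isoCc hcont F)) (𝒢.unit x) (𝒢.unit x) = _ from
    coeff_unit π (isoCc hcont F), extend_fiberHom, e] at h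
  exact h

/-! ### The homeomorphism -/

/-- Some b in K survives at p and is approximated by F in C_c(Σ(𝒢)). L is generated by the element
testing whether the diagonal operator of F has norm at most N/2. If L survives in Ind q, some
diagonal entry is large, and b survives at the corresponding point of the orbit of q. -/
theorem exists_closed_ideal_ind (hcont : Continuous 𝒢.iso) {K : TwoSidedIdeal 𝒢.sigmaGpd.CStar}
    {p : 𝒢.StabPrim} (hp : ¬ K ≤ TwoSidedIdeal.comap (fiberHom (𝒢.iso p.unit)) p.ideal.1) :
    ∃ L : TwoSidedIdeal 𝒢.CStar, IsClosed (L : Set 𝒢.CStar) ∧ ¬ L ≤ p.ind ∧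
      ∀ q : 𝒢.StabPrim, ¬ L ≤ q.ind → ∃ q', orbitRel q q' ∧
        ¬ K ≤ TwoSidedIdeal.comap (fiberHom (𝒢.iso q'.unit)) q'.ideal.1 := by
  have hmem : ∀ (p : 𝒢.StabPrim) (π : URep (𝒢.iso p.unit).El),
      TwoSidedIdeal.ker π.extend = p.ideal.1 → ∀ b,
        b ∈ TwoSidedIdeal.comap (fiberHom (𝒢.iso p.unit)) p.ideal.1 ↔
          π.extend (fiberHom (𝒢.iso p.unit) b) = 0 := by
    intro p π hker b
    rw [← hker, TwoSidedIdeal.mem_comap, TwoSidedIdeal.mem_ker]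
  obtain ⟨b, hbK, hb⟩ := SetLike.not_le_iff_exists.1 hp
  obtain ⟨π₀, -, hker₀, hind₀⟩ := p.exists_urep
  rw [hmem p π₀ hker₀] at hb
  set N := ‖π₀.extend (fiberHom (𝒢.iso p.unit) b)‖ with hNdef
  have hN : 0 < N := norm_pos_iff.2 hb
  -- Again N/3 < N/2 < 2N/3: the test succeeds at p, and success at a conjugate forces b to be
  -- nonzero there.
  obtain ⟨F, hF⟩ := exists_norm_sub_toCStar_lt 𝒢.sigmaGpd b (ε := N / 3) (by positivity)
  have hclose : ∀ {x : X} (π : URep (𝒢.iso x).El),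
      ‖π.extend (fiberHom (𝒢.iso x) b) - fiberOp π F‖ < N / 3 := by
    intro x π
    rw [← extend_fiberHom, ← map_sub, ← map_sub]
    exact ((starHom_norm_le π.extend _).trans (starHom_norm_le (fiberHom _) _)).trans_lt hF
  obtain ⟨c, hc⟩ := exists_mem_ker_iff_norm_le.{u + 1, u} (𝒢.toCStar (isoCc hcont F)) (N / 2)
    (by positivity)
  have hcind : ∀ (p : 𝒢.StabPrim) (π : URep (𝒢.iso p.unit).El),
      p.ind = TwoSidedIdeal.ker (indRep (𝒢.iso p.unit) π).extend →
        (closedIdeal c ≤ p.ind ↔ ‖indHom π (𝒢.toCStar (isoCc hcont F))‖ ≤ N / 2) := by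
    intro p π h
    rw [closedIdeal_le_iff p.isPrimitive_ind.isClosed, h, mem_ker_ind_iff]
    exact hc _ (indRep (𝒢.iso p.unit) π).extend
  refine ⟨closedIdeal c, isClosed_closedIdeal c, ?_, fun q hq => ?_⟩
  · rw [hcind p π₀ hind₀, not_le]
    have h1 := norm_fiberOp_le hcont F π₀
    have h2 := hclose π₀
    have h3 := norm_sub_norm_le (π₀.extend (fiberHom (𝒢.iso p.unit) b)) (fiberOp π₀ F)
    linarith
  · obtain ⟨π, hπ, hker, hind⟩ := q.exists_urep
    rw [hcind q π hind] at hq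
    have : ∃ (g : G) (hg : 𝒢.s g = q.unit), N / 2 < ‖fiberOp (conjRep π g hg rfl) F‖ := by
      by_contra! h
      exact hq (norm_indHom_isoCc_le hcont F π (by positivity) h)
    obtain ⟨g, hg, hgN⟩ := this
    obtain ⟨J, hJ, hrel⟩ := exists_orbitRel q hπ hker g hg
    refine ⟨_, hrel, fun hle => ?_⟩
    have h1 := (hmem ⟨𝒢.r g, J⟩ (conjRep π g hg rfl) hJ.symm b).1 (hle hbK)
    have h2 := hclose (conjRep π g hg rfl)
    rw [h1, zero_sub, norm_neg] at h2
    linarith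

variable (𝒢) in
/-- The induction map on the orbit space. -/
def indPrim : 𝒢.OrbitSpace → Prim.{u + 1, u} 𝒢.CStar :=
  Quot.lift (fun p => ⟨p.ind, p.isPrimitive_ind⟩) fun _ _ h => Subtype.ext (ind_eq_of_orbitRel h)

theorem continuous_indPrim : Continuous 𝒢.indPrim := by
  let _ := hullKernel 𝒢.CStar
  refine continuous_induced_rng.2 (continuous_generateFrom_iff.2 ?_)
  rintro _ ⟨K, -, rfl⟩
  exact isOpen_coinduced.2 (isOpen_stabPrim K)

/-- An open set of orbits pulls back to a saturated open set, which contains a basic neighbourhood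
of p given by an ideal K. The ideal L attached to K defines an open set of primitive ideals whose
preimage stays inside, because passing from q to q' in its orbit does not change the class. -/
theorem isInducing_indPrim (hcont : Continuous 𝒢.iso) : Topology.IsInducing 𝒢.indPrim := by
  refine Topology.isInducing_iff_nhds.2 fun o => le_antisymm
    (Filter.tendsto_iff_comap.1 continuous_indPrim.continuousAt) ?_
  induction o using Quot.ind with | mk p => ?_
  intro U hU
  obtain ⟨V, hVU, hV, hpV⟩ := mem_nhds_iff.1 hU
  have hV' : IsOpen ((fun p : 𝒢.StabPrim => (Quot.mk _ p : 𝒢.OrbitSpace)) ⁻¹' V) :=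
    isOpen_coinduced.1 hV
  let _ := hullKernel 𝒢.sigmaGpd.CStar
  obtain ⟨V₁, hV₁, e₁⟩ := isOpen_induced_iff.1 hV'
  obtain ⟨V₂, hV₂, rfl⟩ := isOpen_induced_iff.1 hV₁
  have hiff : ∀ q : 𝒢.StabPrim, TwoSidedIdeal.comap (fiberHom (𝒢.iso q.unit)) q.ideal.1 ∈ V₂ ↔
      (Quot.mk _ q : 𝒢.OrbitSpace) ∈ V := fun q => (Set.ext_iff.1 e₁ q)
  obtain ⟨K, -, hpK, hK⟩ := exists_closed_ideal_of_isOpen hV₂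
    (isPrimitive_comap_fiberHom p.ideal.2) ((hiff p).2 hpV)
  obtain ⟨L, hL, hpL, hLK⟩ := exists_closed_ideal_ind hcont hpK
  refine ⟨_, (Prim.isOpen_not_le hL).mem_nhds (show 𝒢.indPrim (Quot.mk _ p) ∈ _ from hpL), ?_⟩
  intro o ho
  induction o using Quot.ind with | mk q => ?_
  obtain ⟨q', hrel, hq'⟩ := hLK q ho
  rw [Quot.sound hrel]
  exact hVU ((hiff q').1 (hK _ hq'))

end

/-- The T₀ property of the target lets the map factor through the quotient. An inducing map from a
T₀ space is injective, so only surjectivity onto the image remains. -/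
theorem exists_homeomorph {X G : Type u} [TopologicalSpace X] [TopologicalSpace G] [T2Space G]
    [LocallyCompactSpace G] {𝒢 : Gpd X G} [𝒢.IsEtale] (hcont : Continuous 𝒢.iso) :
    ∃ e : SeparationQuotient 𝒢.OrbitSpace ≃ₜ
        {I : Prim.{u + 1, u} 𝒢.CStar // ∃ p : 𝒢.StabPrim, I.1 = p.ind},
      ∀ p : 𝒢.StabPrim, (e (SeparationQuotient.mk (Quot.mk _ p))).1.1 = p.ind := by
  have hind := isInducing_indPrim hcont
  let f : 𝒢.OrbitSpace → {I : Prim.{u + 1, u} 𝒢.CStar // ∃ p : 𝒢.StabPrim, I.1 = p.ind} :=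
    fun o => ⟨𝒢.indPrim o, by
      induction o using Quot.ind with | mk p => exact ⟨p, rfl⟩⟩
  have hf : Topology.IsInducing f := Topology.IsInducing.of_comp_iff (g := Subtype.val)
    Topology.IsInducing.subtypeVal |>.1 hind
  let F := SeparationQuotient.lift f fun a b h => (h.map hf.continuous).eq
  have hs : Function.Surjective F := by
    rintro ⟨I, p, hp⟩
    exact ⟨SeparationQuotient.mk (Quot.mk _ p), Subtype.ext (Subtype.ext hp.symm)⟩
  -- Neighbourhood filters of the quotient are images of those upstairs, which are pulled back from
  -- the target through the surjective quotient map.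
  have hF : Topology.IsInducing F := by
    refine Topology.isInducing_iff_nhds.2 fun a => ?_
    obtain ⟨a, rfl⟩ := SeparationQuotient.surjective_mk a
    have e : f = F ∘ SeparationQuotient.mk := rfl
    rw [← SeparationQuotient.map_mk_nhds, hf.nhds_eq_comap, e, ← Filter.comap_comap]
    exact Filter.map_comap_of_surjective SeparationQuotient.surjective_mk _
  exact ⟨(Equiv.ofBijective F ⟨hF.injective, hs⟩).toHomeomorphOfIsInducing hF, fun _ => rfl⟩

end Gpd

end

end EtaleGpd

theorem theorem3p16 {X G : Type u} [TopologicalSpace X] [TopologicalSpace G] [T2Space G]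
    [LocallyCompactSpace G] (𝒢 : EtaleGpd.Gpd X G) [𝒢.IsEtale] (hcont : Continuous 𝒢.iso) :
    IsClosed (Set.range (EtaleGpd.Gpd.StabPrim.toSubPrim (𝒢 := 𝒢))) ∧
    (∀ (p : 𝒢.StabPrim) (π : EtaleGpd.URep (𝒢.iso p.unit).El),
      TwoSidedIdeal.ker π.extend = p.ideal.1 →
        TwoSidedIdeal.ker (EtaleGpd.Gpd.indRep (𝒢.iso p.unit) π).extend = p.ind) ∧
    ∃ e : SeparationQuotient 𝒢.OrbitSpace ≃ₜ
        {I : EtaleGpd.Prim.{u + 1, u} 𝒢.CStar // ∃ p : 𝒢.StabPrim, I.1 = p.ind},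
      ∀ p : 𝒢.StabPrim, (e (SeparationQuotient.mk (Quot.mk _ p))).1.1 = p.ind :=
  ⟨EtaleGpd.Gpd.isClosed_range_toSubPrim hcont, fun _ _ h => (EtaleGpd.Gpd.indIdeal_eq h).symm,
    EtaleGpd.Gpd.exists_homeomorph hcont⟩
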